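/- Let $\Bbbk$ be an algebraically closed field. A $\Bbbk$-linear category is called finitary if it is ($\Bbbk$-linearly) equivalent to $A$-proj for a finite dimensional unital associative $\Bbbk$-algebra $A$. A finitary $2$-category is a $2$-category with finitely many objects, with finitary categories of $1$-morphisms, with (bi)additive and $\Bbbk$-(bi)linear compositions, and with indecomposable identity $1$-morphisms. It is fiat if it has a weak (object preserving) involution $\star$, reversing both $1$- and $2$-morphisms, such that $(\mathrm{F},\mathrm{F}^\star)$ is an adjoint pair for every $1$-morphism $\mathrm{F}$. For indecomposable $1$-morphisms, $\mathrm{F}\ge_L\mathrm{G}$ (resp. $\mathrm{F}\ge_J\mathrm{G}$) means that $\mathrm{F}$ is isomorphic to a direct summand of $\mathrm{K}\mathrm{G}$ (resp. $\mathrm{K}_1\mathrm{G}\mathrm{K}_2$) for some $1$-morphism $\mathrm{K}$ (resp. $\mathrm{K}_1,\mathrm{K}_2$); left (resp. two-sided) cells are the equivalence classes of these preorders. A finitary $2$-representation is a functorial $\Bbbk$-linear action on finitary categories $\mathbf{M}(\mathtt{j})$. It is transitive if for all indecomposable $X\in\mathbf{M}(\mathtt{j})$, $Y\in\mathbf{M}(\mathtt{l})$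 there is a $1$-morphism $\mathrm{K}:\mathtt{j}\to\mathtt{l}$ such that $Y$ is a direct summand of $\mathrm{K}X$, and simple transitive if, moreover, it has no nonzero proper stable ideals. The apex of a $2$-representation, when it exists, is the unique maximal element, for the two-sided order, in the set of all two-sided cells whose elements are not annihilated. Let $\mathscr{C}$ be a fiat $2$-category which has a unique maximal two-sided cell $\mathcal{J}$. Let $\mathcal{L}$ be a left cell in $\mathcal{J}$, let $\mathtt{i}$ be the common source of all $1$-morphisms in $\mathcal{L}$, and put $\mathcal{H}=\mathcal{L}\cap\mathcal{L}^\star$. Let $\mathscr{A}_{\mathcal{H}}$ be the $2$-full $2$-subcategory of $\mathscr{C}$, with single object $\mathtt{i}$, whose $1$-morphisms are generated by $\mathcal{H}$ and $\mathbb{1}_{\mathtt{i}}$ under composition, finite direct sums and direct summands. Let $\mathbf{M}$ be a simple transitive $2$-representation of $\mathscr{C}$ with apex $\mathcal{J}$. A subquotient of the restriction $\mathbf{M}|_{\mathscr{A}_{\mathcal{H}}}$ is a quotient $\mathbf{N}'/\mathbf{I}'$, where $\mathbf{N}'$ is a $2$-subrepresentation on a full subcategory of $\mathbf{M}(\mathtt{i})$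 closed under finite direct sums and direct summands, and $\mathbf{I}'$ is a stable ideal of $\mathbf{N}'$. Then $\mathbf{M}|_{\mathscr{A}_{\mathcal{H}}}$ has a unique simple transitive subquotient with apex $\mathcal{H}$. More precisely, there is a multiplicity free direct sum $\mathrm{F}$ of representatives of the isomorphism classes of $1$-morphisms in $\mathcal{H}$, and for every such $\mathrm{F}$: 1. the additive closure in $\mathbf{M}(\mathtt{i})$ of all objects $\mathrm{F}M$, $M\in\mathbf{M}(\mathtt{i})$, is stable under $\mathscr{A}_{\mathcal{H}}$, and the resulting $2$-subrepresentation $\mathbf{N}$ of $\mathbf{M}|_{\mathscr{A}_{\mathcal{H}}}$ is transitive; 2. $\mathbf{N}$ has a stable ideal $\mathbf{I}$ such that $\mathbf{N}/\mathbf{I}$ is simple transitive with apex $\mathcal{H}$; 3. every simple transitive subquotient $\mathbf{N}'/\mathbf{I}'$ of $\mathbf{M}|_{\mathscr{A}_{\mathcal{H}}}$ with apex $\mathcal{H}$ is equivalent to $\mathbf{N}/\mathbf{I}$ as a $2$-representation of $\mathscr{A}_{\mathcal{H}}$; in fact $\mathbf{N}\subseteq\mathbf{N}'$, $\mathbf{I}\subseteq\mathbf{I}'$,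 and the inclusion $\mathbf{N}\subseteq\mathbf{N}'$ induces an equivalence of categories from $\mathbf{N}/\mathbf{I}$ to $\mathbf{N}'/\mathbf{I}'$. -/

import Mathlib

open CategoryTheory CategoryTheory.Limits CategoryTheory.Bicategory Opposite

universe w v u v' u' uk

namespace TwoRepTheory

section Categories

variable {D : Type u} [Category.{v} D] [Preadditive D]

/-- An object of an additive category is indecomposable if it is nonzero and in every decomposition
of it as a direct sum one of the two summands is zero. -/
def IsIndec (X : D) : Prop :=
  ¬ IsZero X ∧ ∀ (Y Z : D) (b : BinaryBicone Y Z), Nonempty b.IsBilimit → Nonempty (b.pt ≅ X) →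
    IsZero Y ∨ IsZero Z

/-- `X` is a direct summand of `Y`. All categories in which this is used are idempotent
complete, so that direct summands are the same as retracts. -/
def IsSummand (X Y : D) : Prop := Nonempty (Retract X Y)

/-- The additive closure of a class of objects: the smallest class of objects which contains it
and is closed under finite direct sums (including the empty one) and direct summands (in
particular under isomorphisms). -/
inductive AddClosure (S : ObjectProperty D) : ObjectProperty D
  | of (X : D) (h : S X) : AddClosure S X
  | zero (X : D) (h : IsZero X) : AddClosure S X
  | sum (X Y : D) (b : BinaryBicone X Y) (hb : b.IsBilimit)
      (hX : AddClosure S X) (hY : AddClosure S Y) : AddClosure S b.pt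
  | summand (X Y : D) (h : IsSummand X Y) (hY : AddClosure S Y) : AddClosure S X

/-- `A`-proj: the category of finitely generated projective `A`-modules. -/
abbrev ProjCat (A : Type uk) [Ring A] : Type (uk + 1) :=
  ObjectProperty.FullSubcategory
    (fun P : ModuleCat.{uk} A => Module.Finite A P ∧ Module.Projective A P)

/-- A `k`-linear category is finitary if it is (`k`-linearly) equivalent to `A`-proj for some
finite dimensional unital associative `k`-algebra `A`. -/
def IsFinitaryCat (k : Type uk) [Field k] (D : Type u) [Category.{v} D] [Preadditive D]
    [Linear k D] : Prop :=
  ∃ (A : Type uk) (_ : Ring A) (_ : Algebra k A) (_ : Module.Finite k A) (e : D ≌ ProjCat A),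
    e.functor.Additive ∧ e.functor.Linear k

end Categories

/-- Bicategories whose categories of 1-morphisms are preadditive, with biadditive horizontal
composition. -/
class PreadditiveBicategory (C : Type u) [Bicategory.{w, v} C] where
  preadditive : ∀ a b : C, Preadditive (a ⟶ b)
  whiskerLeft_add : ∀ {a b c : C} (f : a ⟶ b) {g h : b ⟶ c} (η θ : g ⟶ h),
    f ◁ (η + θ) = f ◁ η + f ◁ θ
  add_whiskerRight : ∀ {a b c : C} {f g : a ⟶ b} (η θ : f ⟶ g) (h : b ⟶ c),
    (η + θ) ▷ h = η ▷ h + θ ▷ h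

attribute [reducible, instance] PreadditiveBicategory.preadditive

/-- `k`-linear bicategories: moreover the categories of 1-morphisms are `k`-linear and horizontal
composition is `k`-bilinear. -/
class LinearBicategory (k : Type uk) [Field k] (C : Type u) [Bicategory.{w, v} C]
    [PreadditiveBicategory C] where
  linear : ∀ a b : C, Linear k (a ⟶ b)
  whiskerLeft_smul : ∀ {a b c : C} (f : a ⟶ b) {g h : b ⟶ c} (r : k) (η : g ⟶ h),
    f ◁ (r • η) = r • (f ◁ η)
  smul_whiskerRight : ∀ {a b c : C} {f g : a ⟶ b} (r : k) (η : f ⟶ g) (h : b ⟶ c),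
    (r • η) ▷ h = r • (η ▷ h)

attribute [reducible, instance] LinearBicategory.linear

/-- Finitary 2-categories over `k`. -/
structure IsFinitary (k : Type uk) [Field k] (C : Type u) [Bicategory.{w, v} C]
    [PreadditiveBicategory C] [LinearBicategory k C] : Prop where
  strict : Bicategory.Strict C
  finite : Finite C
  finitary : ∀ a b : C, IsFinitaryCat k (a ⟶ b)
  indec_id : ∀ a : C, IsIndec (𝟙 a)

/-- A weak involution: a weak (object preserving) anti-equivalence `f ↦ f⋆`, reversing the
direction of both 1- and 2-morphisms (i.e. a pseudofunctor to the bicategory with both 1- and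
2-morphisms reversed), which is involutive up to isomorphism. -/
structure WeakInvolution (C : Type u) [Bicategory.{w, v} C] where
  star : ∀ a b : C, (a ⟶ b)ᵒᵖ ⥤ (b ⟶ a)
  starId : ∀ a : C, (star a a).obj (op (𝟙 a)) ≅ 𝟙 a
  starComp : ∀ {a b c : C} (f : a ⟶ b) (g : b ⟶ c),
    (star a c).obj (op (f ≫ g)) ≅ (star b c).obj (op g) ≫ (star a b).obj (op f)
  starComp_natural_right : ∀ {a b c : C} (f : a ⟶ b) {g g' : b ⟶ c} (θ : g ⟶ g'),
    (star a c).map (f ◁ θ).op ≫ (starComp f g).hom =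
      (starComp f g').hom ≫ (star b c).map θ.op ▷ (star a b).obj (op f)
  starComp_natural_left : ∀ {a b c : C} {f f' : a ⟶ b} (η : f ⟶ f') (g : b ⟶ c),
    (star a c).map (η ▷ g).op ≫ (starComp f g).hom =
      (starComp f' g).hom ≫ (star b c).obj (op g) ◁ (star a b).map η.op
  star_assoc : ∀ {a b c d : C} (f : a ⟶ b) (g : b ⟶ c) (h : c ⟶ d),
    (star a d).map (α_ f g h).hom.op ≫ (starComp (f ≫ g) h).hom ≫
        (star c d).obj (op h) ◁ (starComp f g).hom =
      (starComp f (g ≫ h)).hom ≫ (starComp g h).hom ▷ (star a b).obj (op f) ≫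
        (α_ ((star c d).obj (op h)) ((star b c).obj (op g)) ((star a b).obj (op f))).hom
  star_left_unit : ∀ {a b : C} (f : a ⟶ b),
    (star a b).map (λ_ f).inv.op =
      (starComp (𝟙 a) f).hom ≫ (star a b).obj (op f) ◁ (starId a).hom ≫
        (ρ_ ((star a b).obj (op f))).hom
  star_right_unit : ∀ {a b : C} (f : a ⟶ b),
    (star a b).map (ρ_ f).inv.op =
      (starComp f (𝟙 b)).hom ≫ (starId b).hom ▷ (star a b).obj (op f) ≫
        (λ_ ((star a b).obj (op f))).hom
  invol : ∀ a b : C, 𝟭 (a ⟶ b) ≅ (star a b).rightOp ⋙ (star b a)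

/-- The 1-morphism `f⋆`. -/
def WeakInvolution.on {C : Type u} [Bicategory.{w, v} C] (S : WeakInvolution C) {a b : C}
    (f : a ⟶ b) : b ⟶ a :=
  (S.star a b).obj (op f)

/-- A finitary 2-category `C` together with a weak involution `⋆` is fiat if `(F, F⋆)` is an
adjoint pair for every 1-morphism `F`. -/
structure IsFiat (k : Type uk) [Field k] {C : Type u} [Bicategory.{w, v} C]
    [PreadditiveBicategory C] [LinearBicategory k C] (S : WeakInvolution C) : Prop where
  finitary : IsFinitary k C
  adj : ∀ {a b : C} (f : a ⟶ b), Nonempty (Bicategory.Adjunction f (S.on f))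

section Cells

variable {C : Type u} [Bicategory.{w, v} C] [PreadditiveBicategory C]

/-- `LeftGE f g` is `f ≥_L g`: `f` is a direct summand of `h ∘ g` for some 1-morphism `h`
(note that `g ≫ h` is `h ∘ g`). -/
inductive LeftGE : ∀ {a b c d : C}, (a ⟶ b) → (c ⟶ d) → Prop
  | intro {a b c : C} (f : a ⟶ c) (g : a ⟶ b) (h : b ⟶ c) (hf : IsSummand f (g ≫ h)) : LeftGE f g

/-- `TwoSidedGE f g` is `f ≥_J g`: `f` is a direct summand of `h₁ ∘ g ∘ h₂` for some 1-morphisms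
`h₁` and `h₂`. -/
def TwoSidedGE {a b c d : C} (f : a ⟶ b) (g : c ⟶ d) : Prop :=
  ∃ (h₂ : a ⟶ c) (h₁ : d ⟶ b), IsSummand f (h₂ ≫ g ≫ h₁)

variable (C) in
/-- Classes of 1-morphisms of `C`. -/
abbrev OneMorClass := ∀ a b : C, Set (a ⟶ b)

/-- A left cell: an equivalence class of indecomposable 1-morphisms for the left preorder. -/
def IsLeftCell (L : OneMorClass C) : Prop :=
  ∃ (a b : C) (f : a ⟶ b), IsIndec f ∧
    ∀ (c d : C) (g : c ⟶ d), g ∈ L c d ↔ IsIndec g ∧ LeftGE g f ∧ LeftGE f g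

/-- A two-sided cell: an equivalence class of indecomposable 1-morphisms for the two-sided
preorder. -/
def IsTwoSidedCell (J : OneMorClass C) : Prop :=
  ∃ (a b : C) (f : a ⟶ b), IsIndec f ∧
    ∀ (c d : C) (g : c ⟶ d), g ∈ J c d ↔ IsIndec g ∧ TwoSidedGE g f ∧ TwoSidedGE f g

/-- The two-sided order on two-sided cells. -/
def CellLE (J J' : OneMorClass C) : Prop :=
  ∀ (a b c d : C) (f : a ⟶ b) (g : c ⟶ d), f ∈ J a b → g ∈ J' c d → TwoSidedGE g f

/-- `J` is the unique maximal element, for the two-sided order, of the collection of all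
two-sided cells which satisfy `p`. -/
def IsUniqueMaximalCell (p : OneMorClass C → Prop) (J : OneMorClass C) : Prop :=
  ∀ J' : OneMorClass C, J' = J ↔
    ((IsTwoSidedCell J' ∧ p J') ∧
      ∀ J'' : OneMorClass C, IsTwoSidedCell J'' → p J'' → CellLE J' J'' → J'' = J')

/-- The part in `C(i,i)` of the intersection `L ∩ L⋆`. If `i` is the common source of the
1-morphisms in `L`, this is all of `L ∩ L⋆`. -/
def diagonalHCell (S : WeakInvolution C) (L : OneMorClass C) (i : C) : Set (i ⟶ i) :=
  {f | f ∈ L i i ∧ ∃ g ∈ L i i, Nonempty (f ≅ S.on g)}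

/-- `F` is a multiplicity free direct sum of representatives of the isomorphism classes of
1-morphisms in `H`. -/
def IsMultiplicityFreeSum {i : C} (H : Set (i ⟶ i)) (F : i ⟶ i) : Prop :=
  ∃ (n : ℕ) (h : Fin n → (i ⟶ i)),
    (∀ t, h t ∈ H) ∧ (∀ s t, Nonempty (h s ≅ h t) → s = t) ∧
    (∀ f ∈ H, ∃ t, Nonempty (f ≅ h t)) ∧
    ∃ b : Bicone h, Nonempty b.IsBilimit ∧ Nonempty (b.pt ≅ F)

end Cells

section TwoReps

/-- `k`-linear 2-representations of `C`: (pseudo)functorial actions of `C` on `k`-linear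
categories, by `k`-linear functors, and linear on 2-morphisms. -/
structure TwoRep (k : Type uk) [Field k] (C : Type u) [Bicategory.{w, v} C]
    [PreadditiveBicategory C] [LinearBicategory k C] where
  toPseudofunctor : Pseudofunctor C Cat.{v', u'}
  preadditive : ∀ a : C, Preadditive (toPseudofunctor.obj a)
  linear : ∀ a : C, Linear k (toPseudofunctor.obj a)
  map_additive : ∀ {a b : C} (f : a ⟶ b), (toPseudofunctor.map f).toFunctor.Additive
  map_linear : ∀ {a b : C} (f : a ⟶ b), (toPseudofunctor.map f).toFunctor.Linear k
  map₂_add : ∀ {a b : C} {f g : a ⟶ b} (η θ : f ⟶ g) (X : toPseudofunctor.obj a),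
    (toPseudofunctor.map₂ (η + θ)).toNatTrans.app X =
      (toPseudofunctor.map₂ η).toNatTrans.app X + (toPseudofunctor.map₂ θ).toNatTrans.app X
  map₂_smul : ∀ {a b : C} {f g : a ⟶ b} (r : k) (η : f ⟶ g) (X : toPseudofunctor.obj a),
    (toPseudofunctor.map₂ (r • η)).toNatTrans.app X =
      r • (toPseudofunctor.map₂ η).toNatTrans.app X

variable {k : Type uk} [Field k] {C : Type u} [Bicategory.{w, v} C]
    [PreadditiveBicategory C] [LinearBicategory k C]

namespace TwoRep

/-- The category `M(a)`. -/
abbrev cat (M : TwoRep.{w, v, u, v', u', uk} k C) (a : C) : Type u' := M.toPseudofunctor.obj a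

instance (M : TwoRep.{w, v, u, v', u', uk} k C) (a : C) : Preadditive (M.cat a) := M.preadditive a

instance (M : TwoRep.{w, v, u, v', u', uk} k C) (a : C) : Linear k (M.cat a) := M.linear a

/-- The functor `M(f) : M(a) ⥤ M(b)`. -/
abbrev act (M : TwoRep.{w, v, u, v', u', uk} k C) {a b : C} (f : a ⟶ b) : M.cat a ⥤ M.cat b :=
  (M.toPseudofunctor.map f).toFunctor

instance (M : TwoRep.{w, v, u, v', u', uk} k C) {a b : C} (f : a ⟶ b) : (M.act f).Additive :=
  M.map_additive f

instance (M : TwoRep.{w, v, u, v', u', uk} k C) {a b : C} (f : a ⟶ b) : (M.act f).Linear k :=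
  M.map_linear f

/-- The natural transformation `M(η)`. -/
abbrev act₂ (M : TwoRep.{w, v, u, v', u', uk} k C) {a b : C} {f g : a ⟶ b} (η : f ⟶ g) :
    M.act f ⟶ M.act g :=
  (M.toPseudofunctor.map₂ η).toNatTrans

/-- Equivalence of 2-representations: a strong 2-natural transformation all of whose components
are `k`-linear equivalences of categories. -/
def Equivalent (M N : TwoRep.{w, v, u, v', u', uk} k C) : Prop :=
  ∃ α : Pseudofunctor.StrongTrans M.toPseudofunctor N.toPseudofunctor, ∀ a : C,
    (α.app a).toFunctor.IsEquivalence ∧ (α.app a).toFunctor.Additive ∧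
      (α.app a).toFunctor.Linear k

/-- Finitary 2-representations. -/
def IsFinitary (M : TwoRep.{w, v, u, v', u', uk} k C) : Prop := ∀ a : C, IsFinitaryCat k (M.cat a)

/-- Transitive (finitary) 2-representations. -/
def IsTransitive (M : TwoRep.{w, v, u, v', u', uk} k C) : Prop :=
  M.IsFinitary ∧ ∀ (a b : C) (X : M.cat a) (Y : M.cat b), IsIndec X → IsIndec Y →
    ∃ f : a ⟶ b, IsSummand Y ((M.act f).obj X)

/-- `C`-stable ideals of a 2-representation. -/
@[ext]
structure StableIdeal (M : TwoRep.{w, v, u, v', u', uk} k C) where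
  carrier : ∀ (a : C) (X Y : M.cat a), Submodule k (X ⟶ Y)
  comp_left : ∀ (a : C) {X Y Z : M.cat a} (φ : X ⟶ Y) (ψ : Y ⟶ Z),
    ψ ∈ carrier a Y Z → φ ≫ ψ ∈ carrier a X Z
  comp_right : ∀ (a : C) {X Y Z : M.cat a} (φ : X ⟶ Y) (ψ : Y ⟶ Z),
    φ ∈ carrier a X Y → φ ≫ ψ ∈ carrier a X Z
  act_mem : ∀ {a b : C} (f : a ⟶ b) {X Y : M.cat a} (φ : X ⟶ Y),
    φ ∈ carrier a X Y → (M.act f).map φ ∈ carrier b ((M.act f).obj X) ((M.act f).obj Y)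

/-- Simple transitive 2-representations: transitive, and every stable ideal is either zero or
everything. -/
def IsSimpleTransitive (M : TwoRep.{w, v, u, v', u', uk} k C) : Prop :=
  M.IsTransitive ∧ ∀ I : M.StableIdeal,
    (∀ (a : C) (X Y : M.cat a), I.carrier a X Y = ⊥) ∨
    (∀ (a : C) (X Y : M.cat a), I.carrier a X Y = ⊤)

/-- `M(f) = 0`. -/
def Annihilates (M : TwoRep.{w, v, u, v', u', uk} k C) {a b : C} (f : a ⟶ b) : Prop :=
  ∀ X : M.cat a, IsZero ((M.act f).obj X)

/-- `J` is the apex of `M`: the unique maximal element among the two-sided cells whose elements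
are not annihilated by `M`. -/
def HasApex (M : TwoRep.{w, v, u, v', u', uk} k C) (J : OneMorClass C) : Prop :=
  IsUniqueMaximalCell (fun J' => ∀ (a b : C) (f : a ⟶ b), f ∈ J' a b → ¬ M.Annihilates f) J

/-- 2-subrepresentations, on full, additively closed subcategories (closed under finite direct
sums and direct summands, hence under isomorphisms). -/
structure SubRep (M : TwoRep.{w, v, u, v', u', uk} k C) where
  mem : ∀ a : C, ObjectProperty (M.cat a)
  zero_mem : ∀ (a : C) (X : M.cat a), IsZero X → mem a X
  sum_mem : ∀ (a : C) (X Y : M.cat a) (b : BinaryBicone X Y), Nonempty b.IsBilimit →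
    mem a X → mem a Y → mem a b.pt
  summand_mem : ∀ (a : C) (X Y : M.cat a), IsSummand X Y → mem a Y → mem a X
  act_mem : ∀ {a b : C} (f : a ⟶ b) (X : M.cat a), mem a X → mem b ((M.act f).obj X)


/-- The functor by which `f` acts on a 2-subrepresentation. -/
abbrev SubRep.functor {M : TwoRep.{w, v, u, v', u', uk} k C} (N : M.SubRep) {a b : C}
    (f : a ⟶ b) : (N.mem a).FullSubcategory ⥤ (N.mem b).FullSubcategory :=
  (N.mem b).lift ((N.mem a).ι ⋙ M.act f) (fun X => N.act_mem f X.obj X.property)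

/-- The pseudofunctor underlying a 2-subrepresentation. -/
def SubRep.toPseudofunctor {M : TwoRep.{w, v, u, v', u', uk} k C} (N : M.SubRep) :
    Pseudofunctor C Cat.{v', u'} where
  obj a := Cat.of (N.mem a).FullSubcategory
  map f := (N.functor f).toCatHom
  map₂ η := NatTrans.toCatHom₂
    { app := fun X => ObjectProperty.homMk ((M.act₂ η).app X.obj)
      naturality := fun _ _ φ => ObjectProperty.hom_ext _ ((M.act₂ η).naturality φ.hom) }
  mapId a := Cat.Hom.isoMk (NatIso.ofComponents
    (fun X => ObjectProperty.isoMk _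
      ((Cat.Hom.toNatIso (M.toPseudofunctor.mapId a)).app X.obj))
    (fun φ => ObjectProperty.hom_ext _
      ((M.toPseudofunctor.mapId a).hom.toNatTrans.naturality φ.hom)))
  mapComp f g := Cat.Hom.isoMk (NatIso.ofComponents
    (fun X => ObjectProperty.isoMk _
      ((Cat.Hom.toNatIso (M.toPseudofunctor.mapComp f g)).app X.obj))
    (fun φ => ObjectProperty.hom_ext _
      ((M.toPseudofunctor.mapComp f g).hom.toNatTrans.naturality φ.hom)))
  map₂_id f := Cat.Hom₂.ext (NatTrans.ext (funext fun X => ObjectProperty.hom_ext _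
    (congrArg (fun t => t.toNatTrans.app X.obj) (M.toPseudofunctor.map₂_id f))))
  map₂_comp η θ := Cat.Hom₂.ext (NatTrans.ext (funext fun X => ObjectProperty.hom_ext _
    (congrArg (fun t => t.toNatTrans.app X.obj) (M.toPseudofunctor.map₂_comp η θ))))
  map₂_whisker_left f _ _ η := Cat.Hom₂.ext (NatTrans.ext (funext fun X =>
    ObjectProperty.hom_ext _ (congrArg (fun t => t.toNatTrans.app X.obj)
      (M.toPseudofunctor.map₂_whisker_left f η))))
  map₂_whisker_right η h := Cat.Hom₂.ext (NatTrans.ext (funext fun X =>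
    ObjectProperty.hom_ext _ (congrArg (fun t => t.toNatTrans.app X.obj)
      (M.toPseudofunctor.map₂_whisker_right η h))))
  map₂_associator f g h := Cat.Hom₂.ext (NatTrans.ext (funext fun X =>
    ObjectProperty.hom_ext _ (congrArg (fun t => t.toNatTrans.app X.obj)
      (M.toPseudofunctor.map₂_associator f g h))))
  map₂_left_unitor f := Cat.Hom₂.ext (NatTrans.ext (funext fun X =>
    ObjectProperty.hom_ext _ (congrArg (fun t => t.toNatTrans.app X.obj)
      (M.toPseudofunctor.map₂_left_unitor f))))
  map₂_right_unitor f := Cat.Hom₂.ext (NatTrans.ext (funext fun X =>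
    ObjectProperty.hom_ext _ (congrArg (fun t => t.toNatTrans.app X.obj)
      (M.toPseudofunctor.map₂_right_unitor f))))

instance SubRep.preadditiveObj {M : TwoRep.{w, v, u, v', u', uk} k C} (N : M.SubRep) (a : C) :
    Preadditive (N.toPseudofunctor.obj a) :=
  Preadditive.fullSubcategory (N.mem a)

instance SubRep.linearObj {M : TwoRep.{w, v, u, v', u', uk} k C} (N : M.SubRep) (a : C) :
    Linear k (N.toPseudofunctor.obj a) :=
  Linear.fullSubcategory (N.mem a)

/-- A 2-subrepresentation, as a 2-representation. -/
def SubRep.toTwoRep {M : TwoRep.{w, v, u, v', u', uk} k C} (N : M.SubRep) :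
    TwoRep.{w, v, u, v', u', uk} k C where
  toPseudofunctor := N.toPseudofunctor
  preadditive a := N.preadditiveObj a
  linear a := N.linearObj a
  map_additive f := ⟨fun {_ _ φ ψ} => ObjectProperty.hom_ext _
    ((M.act f).map_add (f := φ.hom) (g := ψ.hom))⟩
  map_linear f := ⟨fun {_ _} φ r => ObjectProperty.hom_ext _
    ((M.act f).map_smul r φ.hom)⟩
  map₂_add η θ X := ObjectProperty.hom_ext _ (M.map₂_add η θ X.obj)
  map₂_smul r η X := ObjectProperty.hom_ext _ (M.map₂_smul r η X.obj)

namespace StableIdeal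

variable {M : TwoRep.{w, v, u, v', u', uk} k C} (I : M.StableIdeal)

/-- Congruence of morphisms modulo an ideal. -/
def rel (a : C) : HomRel (M.cat a) := fun X Y φ ψ => φ - ψ ∈ I.carrier a X Y

instance (a : C) : Congruence (I.rel a) where
  equivalence :=
    { refl := fun φ => by simp [rel]
      symm := fun {φ ψ} h => by
        have := Submodule.neg_mem _ h
        rwa [neg_sub] at this
      trans := fun {φ ψ χ} h h' => by
        have := Submodule.add_mem _ h h'
        rwa [sub_add_sub_cancel] at this }
  comp_left := fun φ ψ ψ' h => by
    have := I.comp_left a φ _ h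
    rwa [Preadditive.comp_sub] at this
  comp_right := fun ψ h => by
    have := I.comp_right a _ ψ h
    rwa [Preadditive.sub_comp] at this

/-- The quotient category `M(a)/I(a)`. -/
abbrev Quot (a : C) : Type u' := CategoryTheory.Quotient (I.rel a)

/-- The projection `M(a) ⥤ M(a)/I(a)`. -/
abbrev proj (a : C) : M.cat a ⥤ I.Quot a := CategoryTheory.Quotient.functor (I.rel a)

theorem rel_add (a : C) ⦃X Y : M.cat a⦄ (f₁ f₂ g₁ g₂ : X ⟶ Y) (h : I.rel a f₁ f₂)
    (h' : I.rel a g₁ g₂) : I.rel a (f₁ + g₁) (f₂ + g₂) := by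
  have := Submodule.add_mem _ h h'
  rwa [sub_add_sub_comm] at this

theorem rel_smul (a : C) (r : k) ⦃X Y : M.cat a⦄ (f₁ f₂ : X ⟶ Y) (h : I.rel a f₁ f₂) :
    I.rel a (r • f₁) (r • f₂) := by
  have := Submodule.smul_mem _ r h
  rwa [smul_sub] at this

instance preadditiveQuot (a : C) : Preadditive (I.Quot a) :=
  CategoryTheory.Quotient.preadditive (I.rel a) (I.rel_add a)

instance (a : C) : (I.proj a).Additive :=
  CategoryTheory.Quotient.functor_additive (I.rel a) (I.rel_add a)

instance linearQuot (a : C) : Linear k (I.Quot a) :=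
  CategoryTheory.Quotient.linear k (I.rel a) (I.rel_smul a)

/-- The functor by which `f` acts on the quotient. -/
abbrev functor {a b : C} (f : a ⟶ b) : I.Quot a ⥤ I.Quot b :=
  CategoryTheory.Quotient.lift (I.rel a) (M.act f ⋙ I.proj b) (fun _ _ φ ψ h =>
    CategoryTheory.Quotient.sound (I.rel b) (by
      have := I.act_mem f _ h
      rwa [Functor.map_sub] at this))

/-- The pseudofunctor underlying the quotient of a 2-representation by a stable ideal. -/
def toPseudofunctor : Pseudofunctor C Cat.{v', u'} where
  obj a := Cat.of (I.Quot a)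
  map f := (I.functor f).toCatHom
  map₂ {a b f g} η := NatTrans.toCatHom₂
    { app := fun X => (I.proj b).map ((M.act₂ η).app X.as)
      naturality := fun X Y φ => by
        obtain ⟨φ, rfl⟩ := (I.proj a).map_surjective φ
        exact congrArg (I.proj b).map ((M.act₂ η).naturality φ) }
  mapId a := Cat.Hom.isoMk (NatIso.ofComponents
    (fun X => (I.proj a).mapIso
      ((Cat.Hom.toNatIso (M.toPseudofunctor.mapId a)).app X.as))
    (fun {X Y} φ => by
      obtain ⟨φ, rfl⟩ := (I.proj a).map_surjective φ
      exact congrArg (I.proj a).map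
        ((M.toPseudofunctor.mapId a).hom.toNatTrans.naturality φ)))
  mapComp {a b c} f g := Cat.Hom.isoMk (NatIso.ofComponents
    (fun X => (I.proj c).mapIso
      ((Cat.Hom.toNatIso (M.toPseudofunctor.mapComp f g)).app X.as))
    (fun {X Y} φ => by
      obtain ⟨φ, rfl⟩ := (I.proj a).map_surjective φ
      exact congrArg (I.proj c).map
        ((M.toPseudofunctor.mapComp f g).hom.toNatTrans.naturality φ)))
  map₂_id {a b} f := Cat.Hom₂.ext (NatTrans.ext (funext fun X => congrArg (I.proj b).map
    (congrArg (fun t => t.toNatTrans.app X.as) (M.toPseudofunctor.map₂_id f))))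
  map₂_comp {a b _ _ _} η θ := Cat.Hom₂.ext (NatTrans.ext (funext fun X =>
    congrArg (I.proj b).map
    (congrArg (fun t => t.toNatTrans.app X.as) (M.toPseudofunctor.map₂_comp η θ))))
  map₂_whisker_left {a b c} f _ _ η := Cat.Hom₂.ext (NatTrans.ext (funext fun X =>
    congrArg (I.proj c).map (congrArg (fun t => t.toNatTrans.app X.as)
      (M.toPseudofunctor.map₂_whisker_left f η))))
  map₂_whisker_right {a b c _ _} η h := Cat.Hom₂.ext (NatTrans.ext (funext fun X =>
    congrArg (I.proj c).map (congrArg (fun t => t.toNatTrans.app X.as)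
      (M.toPseudofunctor.map₂_whisker_right η h))))
  map₂_associator {a b c d} f g h := Cat.Hom₂.ext (NatTrans.ext (funext fun X =>
    congrArg (I.proj d).map (congrArg (fun t => t.toNatTrans.app X.as)
      (M.toPseudofunctor.map₂_associator f g h))))
  map₂_left_unitor {a b} f := Cat.Hom₂.ext (NatTrans.ext (funext fun X =>
    congrArg (I.proj b).map (congrArg (fun t => t.toNatTrans.app X.as)
      (M.toPseudofunctor.map₂_left_unitor f))))
  map₂_right_unitor {a b} f := Cat.Hom₂.ext (NatTrans.ext (funext fun X =>
    congrArg (I.proj b).map (congrArg (fun t => t.toNatTrans.app X.as)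
      (M.toPseudofunctor.map₂_right_unitor f))))

instance preadditiveObj (a : C) : Preadditive (I.toPseudofunctor.obj a) := I.preadditiveQuot a

instance linearObj (a : C) : Linear k (I.toPseudofunctor.obj a) := I.linearQuot a

/-- The quotient of a 2-representation by a stable ideal. -/
def quotient : TwoRep.{w, v, u, v', u', uk} k C where
  toPseudofunctor := I.toPseudofunctor
  preadditive a := I.preadditiveObj a
  linear a := I.linearObj a
  map_additive {a b} f := ⟨fun {X Y φ ψ} => by
    obtain ⟨φ, rfl⟩ := (I.proj a).map_surjective φ
    obtain ⟨ψ, rfl⟩ := (I.proj a).map_surjective ψ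
    exact congrArg (I.proj b).map ((M.act f).map_add (f := φ) (g := ψ))⟩
  map_linear {a b} f := ⟨fun {X Y} φ r => by
    obtain ⟨φ, rfl⟩ := (I.proj a).map_surjective φ
    exact congrArg (I.proj b).map ((M.act f).map_smul r φ)⟩
  map₂_add {a b _ _} η θ X := congrArg (I.proj b).map (M.map₂_add η θ X.as)
  map₂_smul {a b _ _} r η X := congrArg (I.proj b).map (M.map₂_smul r η X.as)

end StableIdeal

/-- The inclusion between the categories of two nested 2-subrepresentations. -/
def SubRep.incl {M : TwoRep.{w, v, u, v', u', uk} k C} {N N' : M.SubRep}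
    (hle : ∀ a : C, N.mem a ≤ N'.mem a) (a : C) : N.toTwoRep.cat a ⥤ N'.toTwoRep.cat a :=
  ObjectProperty.ιOfLE (hle a)

/-- For subquotients `N/I` and `N'/I'` of the same 2-representation: `N` is contained in `N'`, `I`
is contained in `I'`, and the inclusion of `N` into `N'` induces equivalences from the categories
`N(a)/I(a)` to the categories `N'(a)/I'(a)`. -/
def InclusionInducesEquivalence {M : TwoRep.{w, v, u, v', u', uk} k C} {N N' : M.SubRep}
    (I : N.toTwoRep.StableIdeal) (I' : N'.toTwoRep.StableIdeal) : Prop :=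
  ∃ (hle : ∀ a : C, N.mem a ≤ N'.mem a)
    (hI : ∀ (a : C) (X Y : N.toTwoRep.cat a) (φ ψ : X ⟶ Y), I.rel a φ ψ →
      (SubRep.incl hle a ⋙ I'.proj a).map φ = (SubRep.incl hle a ⋙ I'.proj a).map ψ),
    ∀ a : C, (CategoryTheory.Quotient.lift (I.rel a) (SubRep.incl hle a ⋙ I'.proj a)
      (hI a)).IsEquivalence

end TwoRep

end TwoReps

section Subcategories

variable {C : Type u} [Bicategory.{w, v} C]

/-- A class of 1-morphisms `i ⟶ i` containing the identity and closed under composition. -/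
structure EndoClass (i : C) where
  mem : ObjectProperty (i ⟶ i)
  id_mem : mem (𝟙 i)
  comp_mem : ∀ f g : i ⟶ i, mem f → mem g → mem (f ≫ g)

/-- The 2-full 2-subcategory of `C` given by an `EndoClass`: its only object is `i`, its
1-morphisms are those in the class, and its 2-morphisms are all 2-morphisms of `C` between them. -/
structure EndoClass.SubBicat {i : C} (A : EndoClass i) : Type where

namespace EndoClass

variable {i : C} (A : EndoClass i)

instance : CategoryStruct.{v} A.SubBicat where
  Hom _ _ := A.mem.FullSubcategory
  id _ := ⟨𝟙 i, A.id_mem⟩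
  comp f g := ⟨f.obj ≫ g.obj, A.comp_mem _ _ f.property g.property⟩

instance (x y : A.SubBicat) : Category.{w} (x ⟶ y) :=
  ObjectProperty.FullSubcategory.category A.mem

/-- The 1-morphism of `C` underlying a 1-morphism of the 2-subcategory. -/
abbrev mor {x y : A.SubBicat} (f : x ⟶ y) : i ⟶ i :=
  ObjectProperty.FullSubcategory.obj (P := A.mem) f

/-- The 2-morphism of `C` underlying a 2-morphism of the 2-subcategory. -/
abbrev twoMor {x y : A.SubBicat} {f g : x ⟶ y} (η : f ⟶ g) : A.mor f ⟶ A.mor g :=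
  InducedCategory.Hom.hom (F := ObjectProperty.FullSubcategory.obj (P := A.mem)) η

theorem twoMor_ext {x y : A.SubBicat} {f g : x ⟶ y} {η θ : f ⟶ g}
    (h : A.twoMor η = A.twoMor θ) : η = θ :=
  ObjectProperty.hom_ext A.mem h

/-- The 2-morphism of the 2-subcategory given by a 2-morphism of `C`. -/
abbrev mk₂ {x y : A.SubBicat} {f g : x ⟶ y} (η : A.mor f ⟶ A.mor g) : f ⟶ g :=
  ObjectProperty.homMk (P := A.mem) η

/-- The 2-isomorphism of the 2-subcategory given by a 2-isomorphism of `C`. -/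
abbrev mkIso {x y : A.SubBicat} {f g : x ⟶ y} (e : A.mor f ≅ A.mor g) : f ≅ g :=
  ObjectProperty.isoMk A.mem e

instance : Bicategory.{w, v} A.SubBicat where
  whiskerLeft f _ _ η := A.mk₂ (A.mor f ◁ A.twoMor η)
  whiskerRight η f := A.mk₂ (A.twoMor η ▷ A.mor f)
  associator f g h := A.mkIso (α_ (A.mor f) (A.mor g) (A.mor h))
  leftUnitor f := A.mkIso (λ_ (A.mor f))
  rightUnitor f := A.mkIso (ρ_ (A.mor f))
  whiskerLeft_id _ _ := A.twoMor_ext (Bicategory.whiskerLeft_id _ _)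
  whiskerLeft_comp _ _ _ _ _ _ := A.twoMor_ext (Bicategory.whiskerLeft_comp _ _ _)
  id_whiskerLeft _ := A.twoMor_ext (Bicategory.id_whiskerLeft _)
  comp_whiskerLeft _ _ _ _ _ := A.twoMor_ext (Bicategory.comp_whiskerLeft _ _ _)
  id_whiskerRight _ _ := A.twoMor_ext (Bicategory.id_whiskerRight _ _)
  comp_whiskerRight _ _ _ := A.twoMor_ext (Bicategory.comp_whiskerRight _ _ _)
  whiskerRight_id _ := A.twoMor_ext (Bicategory.whiskerRight_id _)
  whiskerRight_comp _ _ _ := A.twoMor_ext (Bicategory.whiskerRight_comp _ _ _)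
  whisker_assoc _ _ _ _ _ := A.twoMor_ext (Bicategory.whisker_assoc _ _ _)
  whisker_exchange _ _ := A.twoMor_ext (Bicategory.whisker_exchange _ _)
  pentagon _ _ _ _ := A.twoMor_ext (Bicategory.pentagon _ _ _ _)
  triangle _ _ := A.twoMor_ext (Bicategory.triangle _ _)

variable [PreadditiveBicategory C]

instance : PreadditiveBicategory A.SubBicat where
  preadditive _ _ := Preadditive.fullSubcategory A.mem
  whiskerLeft_add f _ _ η θ :=
    A.twoMor_ext (PreadditiveBicategory.whiskerLeft_add (A.mor f) (A.twoMor η) (A.twoMor θ))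
  add_whiskerRight η θ h :=
    A.twoMor_ext (PreadditiveBicategory.add_whiskerRight (A.twoMor η) (A.twoMor θ) (A.mor h))

variable {k : Type uk} [Field k] [LinearBicategory k C]

instance : LinearBicategory k A.SubBicat where
  linear _ _ := Linear.fullSubcategory A.mem
  whiskerLeft_smul f _ _ r η :=
    A.twoMor_ext (LinearBicategory.whiskerLeft_smul (A.mor f) r (A.twoMor η))
  smul_whiskerRight r η h :=
    A.twoMor_ext (LinearBicategory.smul_whiskerRight r (A.twoMor η) (A.mor h))

/-- The pseudofunctor underlying the restriction of a 2-representation of `C` to the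
2-subcategory. -/
def restrictPseudofunctor (M : TwoRep.{w, v, u, v', u', uk} k C) :
    Pseudofunctor A.SubBicat Cat.{v', u'} where
  obj _ := M.toPseudofunctor.obj i
  map f := M.toPseudofunctor.map (A.mor f)
  map₂ η := M.toPseudofunctor.map₂ (A.twoMor η)
  mapId _ := M.toPseudofunctor.mapId i
  mapComp f g := M.toPseudofunctor.mapComp (A.mor f) (A.mor g)
  map₂_id f := M.toPseudofunctor.map₂_id (A.mor f)
  map₂_comp η θ := M.toPseudofunctor.map₂_comp (A.twoMor η) (A.twoMor θ)
  map₂_whisker_left f _ _ η := M.toPseudofunctor.map₂_whisker_left (A.mor f) (A.twoMor η)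
  map₂_whisker_right η h := M.toPseudofunctor.map₂_whisker_right (A.twoMor η) (A.mor h)
  map₂_associator f g h := M.toPseudofunctor.map₂_associator (A.mor f) (A.mor g) (A.mor h)
  map₂_left_unitor f := M.toPseudofunctor.map₂_left_unitor (A.mor f)
  map₂_right_unitor f := M.toPseudofunctor.map₂_right_unitor (A.mor f)

/-- The restriction of a 2-representation of `C` to the 2-subcategory. -/
def restrict (M : TwoRep.{w, v, u, v', u', uk} k C) :
    TwoRep.{w, v, 0, v', u', uk} k A.SubBicat where
  toPseudofunctor := A.restrictPseudofunctor M
  preadditive _ := M.preadditive i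
  linear _ := M.linear i
  map_additive f := M.map_additive (A.mor f)
  map_linear f := M.map_linear (A.mor f)
  map₂_add η θ X := M.map₂_add (A.twoMor η) (A.twoMor θ) X
  map₂_smul r η X := M.map₂_smul r (A.twoMor η) X

/-- A class of 1-morphisms `i ⟶ i` of `C`, considered as a class of 1-morphisms of the
2-subcategory. -/
def oneMorClass (H : Set (i ⟶ i)) : OneMorClass A.SubBicat := fun _ _ => {f | A.mor f ∈ H}

/-- The 1-morphisms of the 2-subcategory generated by `H` and the identity: closure under
composition, finite direct sums and direct summands (in particular isomorphisms). -/
inductive Generated (H : Set (i ⟶ i)) : ObjectProperty (i ⟶ i)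
  | of (f : i ⟶ i) (h : f ∈ H) : Generated H f
  | id : Generated H (𝟙 i)
  | comp (f g : i ⟶ i) (hf : Generated H f) (hg : Generated H g) : Generated H (f ≫ g)
  | zero (f : i ⟶ i) (h : IsZero f) : Generated H f
  | sum (f g : i ⟶ i) (b : BinaryBicone f g) (hb : b.IsBilimit)
      (hf : Generated H f) (hg : Generated H g) : Generated H b.pt
  | summand (f g : i ⟶ i) (h : IsSummand f g) (hg : Generated H g) : Generated H f

/-- The `EndoClass` defining the 2-full 2-subcategory `A_H` generated by `H` and the identity. -/
def generatedBy (H : Set (i ⟶ i)) : EndoClass i where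
  mem := Generated H
  id_mem := Generated.id
  comp_mem f g hf hg := Generated.comp f g hf hg

end EndoClass

end Subcategories

end TwoRepTheory

open TwoRepTheory

/-! The combinatorial core is that the left preorder is symmetric inside the maximal two-sided cell
(`leftGE_of_leftGE`, `IsFiat.leftGE_symm`). Composition on the target side is recorded by
nonnegative matrices of multiplicities. On a maximal left cell such a matrix is positive, so it has
a Perron eigenvector, and precomposing with a fixed 1-morphism again gives an eigenvector, by
associativity. If some `f` in the two-sided cell lay strictly below that left cell, two-sided
equivalence would produce an eigenvector with a positive entry at `f`. The flow from `f` into the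
left cell would then contradict the equality case of Perron's theorem.

Adjunction makes every `f` a summand of `f ≫ f⋆ ≫ f`. Together with the symmetry this shows that `H`
is nonempty, that every indecomposable summand of `f ≫ K ≫ g` with `f`, `g` in `H` and `K` an
arbitrary 1-morphism of the big 2-category lies in `H` (`mem_of_isSummand`), and that any element of
`H` is a summand of the composite of any other one with a suitable third (`exists_isSummand_comp`).
Hence the indecomposables of the 2-subcategory are the identity and `H`, and having apex `H` just
means that no element of `H` acts as zero (`hasApex_iff`).

Transitivity of `N`: if an indecomposable `X` is a summand of `f Z` with `f` in `H`, then `f⋆ X` is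
nonzero by adjunction. Transitivity of `M` connects a summand of `f⋆ X` to any prescribed object by
some `K` which need not lie in the 2-subcategory, but `K` occurs only between two elements of `H`,
and the sandwiched product has the required summands in `H` (`exists_isSummand_act`).

The ideal is `radIdeal`: the morphisms from which no automorphism of an indecomposable of `N` can be
produced by acting and composing. Locality of endomorphism rings makes it an ideal, and it is the
largest stable one avoiding the identities of these objects. A stable ideal of `N` outside it
contains one such identity, hence all of them by transitivity, so the quotient is simple transitive.

Uniqueness: for a simple transitive subquotient `N'/I'` with apex `H`, some `X` in `N'` is not
killed by `H`, and the sandwich argument puts all of `N` into `N'`. No identity of an indecomposable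
of `N` lies in `I'`, as otherwise `H` would act as zero on the quotient. So `I'` lies in the radical
ideal on `N'`, and simplicity forces equality. The induced functor is then fully faithful, and
transitivity of `N'/I'` makes it essentially surjective. -/

namespace TwoRepTheory

/-! ### Fitting decompositions in finite dimensional algebras. -/

section Fitting

/-- Fitting's lemma for an element of a finite dimensional algebra. -/
theorem exists_fitting (k : Type*) {B : Type*} [Field k] [Ring B] [Algebra k B] [Module.Finite k B]
    (f : B) : ∃ (n : ℕ) (y : B), Commute f y ∧ f ^ (n + 1) * y = f ^ n := by
  -- The commutative algebra `k[f]` is Artinian, so the ideals generated by the powers of `f`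
  -- stabilise; looking for `y` inside `k[f]` makes it commute with `f`.
  let R := Algebra.adjoin k {f}
  have : IsArtinian k R := inferInstance
  have : IsArtinianRing R := IsArtinianRing.of_finite k R
  obtain ⟨n, y, hy⟩ := IsArtinian.exists_pow_succ_smul_dvd
    (⟨f, Algebra.subset_adjoin rfl⟩ : R) (1 : R)
  refine ⟨n, y, ?_, ?_⟩
  · exact congrArg Subtype.val (mul_comm (⟨f, Algebra.subset_adjoin rfl⟩ : R) y)
  · simpa [smul_eq_mul] using congrArg Subtype.val hy

/-- The idempotent `e` cuts out the part on which `f` is invertible, with inverse given by `g`; the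
last equation says that `f` is nilpotent on the complement. -/
theorem exists_fitting_idempotent (k : Type*) {B : Type*} [Field k] [Ring B] [Algebra k B]
    [Module.Finite k B] (f : B) :
    ∃ (n : ℕ) (e g : B), e * e = e ∧ Commute f e ∧ Commute f g ∧ f * g = e ∧
      f ^ n * e = f ^ n := by
  obtain ⟨n, y, hc, h⟩ := exists_fitting k f
  have key : ∀ m : ℕ, f ^ (n + m) * y ^ m = f ^ n := by
    intro m
    induction m with
    | zero => simp
    | succ m ih =>
      calc f ^ (n + (m + 1)) * y ^ (m + 1) = f ^ m * (f ^ (n + 1) * y) * y ^ m := by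
            rw [pow_succ' y, ← mul_assoc, ← mul_assoc, ← pow_add]
            congr 3
            omega
        _ = f ^ (n + m) * y ^ m := by rw [h, ← pow_add, add_comm]
        _ = f ^ n := ih
  have hcy : ∀ a b : ℕ, Commute (f ^ a) (y ^ b) := fun a b => hc.pow_pow a b
  have h0 : f ^ (n + 1) * (f ^ (n + 1) * y ^ (n + 1)) = f ^ (n + 1) := by
    have := key (n + 1)
    calc f ^ (n + 1) * (f ^ (n + 1) * y ^ (n + 1))
        = f * (f ^ (n + (n + 1)) * y ^ (n + 1)) := by
          rw [← mul_assoc, ← mul_assoc, ← pow_add, ← pow_succ']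
          congr 2
          omega
      _ = _ := by rw [this, pow_succ']
  -- The exponent `n + 1` ensures that a factor `f` can be split off from the idempotent, even for
  -- `n = 0`; what remains is `g`.
  refine ⟨n + 1, f ^ (n + 1) * y ^ (n + 1), f ^ n * y ^ (n + 1), ?_, ?_, ?_, ?_, ?_⟩
  · calc f ^ (n + 1) * y ^ (n + 1) * (f ^ (n + 1) * y ^ (n + 1))
        = f ^ (n + 1) * (f ^ (n + 1) * y ^ (n + 1)) * y ^ (n + 1) := by
          rw [mul_assoc, mul_assoc, mul_assoc, ← mul_assoc (y ^ (n + 1)) (f ^ (n + 1)),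
            ← (hcy (n + 1) (n + 1)).eq, mul_assoc]
      _ = _ := by rw [h0]
  · exact ((Commute.refl f).pow_right _).mul_right (hc.pow_right _)
  · exact ((Commute.refl f).pow_right _).mul_right (hc.pow_right _)
  · rw [← mul_assoc, ← pow_succ']
  · exact h0

end Fitting

/-! ### Retracts, biproducts and indecomposable objects. -/

section Basic

variable {D : Type u} [Category.{v} D]

theorem IsSummand.refl (X : D) : IsSummand X X := ⟨Retract.refl X⟩

theorem IsSummand.trans {X Y Z : D} (h : IsSummand X Y) (h' : IsSummand Y Z) : IsSummand X Z :=
  ⟨h.some.trans h'.some⟩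

theorem IsSummand.of_iso {X Y : D} (e : X ≅ Y) : IsSummand X Y := ⟨Retract.ofIso e⟩

theorem IsSummand.map {E : Type u'} [Category.{v'} E] (F : D ⥤ E) {X Y : D} (h : IsSummand X Y) :
    IsSummand (F.obj X) (F.obj Y) := ⟨h.some.map F⟩

theorem IsSummand.of_comp {X Y : D} (i : X ⟶ Y) (r : Y ⟶ X) (h : IsIso (i ≫ r)) :
    IsSummand X Y :=
  ⟨⟨i, r ≫ inv (i ≫ r), by rw [← Category.assoc]; exact IsIso.hom_inv_id _⟩⟩

theorem IsZero.of_isSummand {X Y : D} [HasZeroMorphisms D] (hY : IsZero Y) (h : IsSummand X Y) :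
    IsZero X := by
  rw [IsZero.iff_id_eq_zero, ← h.some.retract, hY.eq_of_tgt h.some.i 0, zero_comp]

theorem isSummand_map_iff {E : Type u'} [Category.{v'} E]
    (F : D ⥤ E) [F.Full] [F.Faithful] (X Y : D) :
    IsSummand (F.obj X) (F.obj Y) ↔ IsSummand X Y := by
  refine ⟨fun ⟨h⟩ => ?_, fun h => h.map F⟩
  obtain ⟨i, hi⟩ := F.map_surjective h.i
  obtain ⟨r, hr⟩ := F.map_surjective h.r
  exact ⟨⟨i, r, F.map_injective (by rw [F.map_comp, hi, hr, h.retract, F.map_id])⟩⟩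

variable [Preadditive D]

theorem BinaryBicone.IsBilimit.total' {X Y : D} {b : BinaryBicone X Y} (hb : b.IsBilimit) :
    b.fst ≫ b.inl + b.snd ≫ b.inr = 𝟙 b.pt :=
  IsBilimit.binary_total hb

/-- A bicone with replaced cone point. -/
def biconeOfIso {X Y Z : D} (b : BinaryBicone X Y) (e : b.pt ≅ Z) : BinaryBicone X Y where
  pt := Z
  fst := e.inv ≫ b.fst
  snd := e.inv ≫ b.snd
  inl := b.inl ≫ e.hom
  inr := b.inr ≫ e.hom

theorem biconeOfIso_isBilimit {X Y Z : D} (b : BinaryBicone X Y) (hb : b.IsBilimit)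
    (e : b.pt ≅ Z) : Nonempty (biconeOfIso b e).IsBilimit := by
  refine ⟨isBinaryBilimitOfTotal _ ?_⟩
  have := BinaryBicone.IsBilimit.total' hb
  calc (e.inv ≫ b.fst) ≫ b.inl ≫ e.hom + (e.inv ≫ b.snd) ≫ b.inr ≫ e.hom
      = e.inv ≫ (b.fst ≫ b.inl + b.snd ≫ b.inr) ≫ e.hom := by simp
    _ = _ := by rw [this]; simp [biconeOfIso]

theorem IsSummand.inl {X Y : D} (b : BinaryBicone X Y) : IsSummand X b.pt :=
  ⟨⟨b.inl, b.fst, b.inl_fst⟩⟩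

theorem IsSummand.inr {X Y : D} (b : BinaryBicone X Y) : IsSummand Y b.pt :=
  ⟨⟨b.inr, b.snd, b.inr_snd⟩⟩

/-- The image of a binary biproduct under an additive functor. -/
theorem map_bicone_isBilimit {E : Type u'} [Category.{v'} E] [Preadditive E] (F : D ⥤ E)
    [F.Additive] {X Y : D} (b : BinaryBicone X Y) (hb : b.IsBilimit) :
    Nonempty (F.mapBinaryBicone b).IsBilimit := by
  refine ⟨isBinaryBilimitOfTotal _ ?_⟩
  have := congrArg F.map (BinaryBicone.IsBilimit.total' hb)
  rw [F.map_add, F.map_comp, F.map_comp, F.map_id] at this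
  exact this

theorem IsIndec.of_iso {X Y : D} (hX : IsIndec X) (e : X ≅ Y) : IsIndec Y :=
  ⟨fun h => hX.1 (h.of_iso e), fun _ _ b hb ⟨e'⟩ => hX.2 _ _ b hb ⟨e' ≪≫ e.symm⟩⟩

theorem isZero_of_id_comp {X Y : D} {i : Y ⟶ X} {p : X ⟶ Y} (h : i ≫ p = 𝟙 Y)
    (h' : p ≫ i = 0) : IsZero Y := by
  rw [IsZero.iff_id_eq_zero, ← h, ← Category.comp_id (i ≫ p), ← h, Category.assoc,
    reassoc_of% h', zero_comp, comp_zero]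

/-- Splitting `e` and `𝟙 X - e` gives a biproduct decomposition, and a decomposition is remembered
by the idempotent `b.fst ≫ b.inl`. Indecomposability thereby becomes a property of the ring `End X`,
to which Fitting's lemma applies. -/
theorem isIndec_iff [IsIdempotentComplete D] (X : D) :
    IsIndec X ↔ ¬ IsZero X ∧ ∀ e : X ⟶ X, e ≫ e = e → e = 0 ∨ e = 𝟙 X := by
  refine and_congr_right fun hX => ⟨fun h e he => ?_, fun h Y Z b hb e => ?_⟩
  · obtain ⟨Y, i, p, hip, hpi⟩ := IsIdempotentComplete.idempotents_split X e he
    obtain ⟨Z, j, q, hjq, hqj⟩ := IsIdempotentComplete.idempotents_split X (𝟙 X - e)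
      (Idempotents.idem_of_id_sub_idem e he)
    have hpe : e ≫ p = p := by rw [← hpi, Category.assoc, hip, Category.comp_id]
    have hie : i ≫ e = i := by rw [← hpi, reassoc_of% hip]
    have hje : j ≫ e = 0 := by
      have : j ≫ (𝟙 X - e) = j := by rw [← hqj, reassoc_of% hjq]
      simpa using this
    have heq : e ≫ q = 0 := by
      have : (𝟙 X - e) ≫ q = q := by rw [← hqj, Category.assoc, hjq, Category.comp_id]
      simpa using this
    let b : BinaryBicone Y Z :=
      { pt := X, fst := p, snd := q, inl := i, inr := j
        inl_fst := hip
        inl_snd := by rw [← hie, Category.assoc, heq, comp_zero]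
        inr_fst := by rw [← hpe, ← Category.assoc, hje, zero_comp]
        inr_snd := hjq }
    rcases h Y Z b ⟨isBinaryBilimitOfTotal _ (by simp [b, hpi, hqj])⟩ ⟨Iso.refl _⟩ with h | h
    · left
      rw [← hpi, h.eq_of_tgt p 0, zero_comp]
    · right
      have : 𝟙 X - e = 0 := by rw [← hqj, h.eq_of_tgt q 0, zero_comp]
      exact (sub_eq_zero.mp this).symm
  · obtain ⟨e⟩ := e
    obtain ⟨hb⟩ := hb
    rcases h (e.inv ≫ b.fst ≫ b.inl ≫ e.hom) (by simp) with h | h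
    · left
      refine isZero_of_id_comp b.inl_fst ?_
      simpa using congrArg (fun f => e.hom ≫ f ≫ e.inv) h
    · right
      refine isZero_of_id_comp b.inr_snd ?_
      have h1 : b.fst ≫ b.inl = 𝟙 _ := by simpa using congrArg (fun f => e.hom ≫ f ≫ e.inv) h
      have := BinaryBicone.IsBilimit.total' hb
      rw [h1] at this
      simpa using this

theorem isIndec_map_iff {E : Type u'} [Category.{v'} E] [Preadditive E] [IsIdempotentComplete D]
    [IsIdempotentComplete E] (F : D ⥤ E) [F.Additive] [F.Full] [F.Faithful] (X : D) :
    IsIndec (F.obj X) ↔ IsIndec X := by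
  rw [isIndec_iff, isIndec_iff]
  refine and_congr (not_congr ?_) ⟨fun h e he => ?_, fun h e he => ?_⟩
  · rw [IsZero.iff_id_eq_zero, IsZero.iff_id_eq_zero, ← F.map_id, F.map_eq_zero_iff]
  · rcases h (F.map e) (by rw [← F.map_comp, he]) with h | h
    · exact Or.inl ((F.map_eq_zero_iff).mp h)
    · exact Or.inr (F.map_injective (by rw [h, F.map_id]))
  · obtain ⟨e, rfl⟩ := F.map_surjective e
    rcases h e (F.map_injective (by rw [F.map_comp, he])) with h | h
    · exact Or.inl (by rw [h, F.map_zero])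
    · exact Or.inr (by rw [h, F.map_id])

end Basic

/-- The intrinsic properties of finitary categories: finite dimensional morphism spaces,
split idempotents, finite direct sums, and an additive generator. -/
structure IsFin (k : Type uk) [Field k] (D : Type u) [Category.{v} D] [Preadditive D]
    [Linear k D] : Prop where
  finite_hom : ∀ X Y : D, Module.Finite k (X ⟶ Y)
  idem : IsIdempotentComplete D
  hasZero : HasZeroObject D
  hasBiprod : HasBinaryBiproducts D
  gen : ∃ T : D, ∀ X : D, AddClosure (fun Y => Y = T) X

/-! ### Krull–Schmidt theory: local endomorphism rings and finiteness of indecomposables. -/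

section KrullSchmidt

variable {k : Type uk} [Field k] {D : Type u} [Category.{v} D] [Preadditive D] [Linear k D]

/-- The Fitting idempotent of `f` is `0` or `1`, which are the nilpotent and the invertible case. -/
theorem IsFin.isIso_or_nilpotent (hD : IsFin k D) {X : D} (hX : IsIndec X) (f : End X) :
    IsIso f ∨ ∃ n : ℕ, f ^ n = 0 := by
  have := hD.idem
  have : Module.Finite k (End X) := hD.finite_hom X X
  obtain ⟨n, e, g, he, -, hfg, hfge, hfn⟩ := exists_fitting_idempotent k f
  rcases ((isIndec_iff X).mp hX).2 e he with h | h
  · right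
    refine ⟨n, ?_⟩
    rw [← hfn, h]
    exact mul_zero _
  · left
    refine ⟨g, ?_, ?_⟩
    · rw [← h, ← hfge, hfg.eq]; rfl
    · rw [← h, ← hfge]; rfl

/-- After normalising the sum to the identity, a nilpotent first term leaves a unit as second term.
This locality of `End X` is the form in which the Krull–Schmidt property is used below. -/
theorem IsFin.isIso_of_add (hD : IsFin k D) {X : D} (hX : IsIndec X) (f g : X ⟶ X)
    (h : IsIso (f + g)) : IsIso f ∨ IsIso g := by
  have aux : ∀ f' g' : End X, f' + g' = 1 → IsIso f' ∨ IsIso g' := by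
    intro f' g' h'
    rcases hD.isIso_or_nilpotent hX f' with hf | ⟨n, hn⟩
    · exact Or.inl hf
    · right
      have hu : IsUnit (1 - f') := IsNilpotent.isUnit_one_sub ⟨n, hn⟩
      rw [← h', add_sub_cancel_left] at hu
      exact (isUnit_iff_isIso g').mp hu
  have h1 := aux (f ≫ inv (f + g)) (g ≫ inv (f + g)) (by
    rw [← Preadditive.add_comp]; exact IsIso.hom_inv_id _)
  refine h1.imp (fun h2 : IsIso (f ≫ inv (f + g)) => ?_)
    (fun h2 : IsIso (g ≫ inv (f + g)) => ?_)
  · have := h2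
    exact IsIso.of_isIso_comp_right f (inv (f + g))
  · have := h2
    exact IsIso.of_isIso_comp_right g (inv (f + g))

theorem IsFin.isIso_of_sum (hD : IsFin k D) {X : D} (hX : IsIndec X) {ι : Type*} (s : Finset ι)
    (f : ι → (X ⟶ X)) (h : IsIso (∑ t ∈ s, f t)) : ∃ t ∈ s, IsIso (f t) := by
  classical
  induction s using Finset.induction_on with
  | empty =>
    exfalso
    rw [Finset.sum_empty] at h
    exact hX.1 ((IsZero.iff_id_eq_zero X).mpr (by
      rw [← IsIso.hom_inv_id (0 : X ⟶ X), zero_comp]))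
  | insert a s ha ih =>
    rw [Finset.sum_insert ha] at h
    rcases hD.isIso_of_add hX _ _ h with h | h
    · exact ⟨a, Finset.mem_insert_self _ _, h⟩
    · obtain ⟨t, ht, h'⟩ := ih h
      exact ⟨t, Finset.mem_insert_of_mem ht, h'⟩

theorem not_isIso_zero_of_isIndec {X : D} (hX : IsIndec X) : ¬ IsIso (0 : X ⟶ X) := fun _ =>
  hX.1 ((IsZero.iff_id_eq_zero X).mpr (by rw [← IsIso.hom_inv_id (0 : X ⟶ X), zero_comp]))

/-- An indecomposable summand of a direct sum is a summand of one of the terms. -/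
theorem IsFin.isSummand_or (hD : IsFin k D) {X Y Z : D} (hX : IsIndec X) {b : BinaryBicone Y Z}
    (hb : b.IsBilimit) (h : IsSummand X b.pt) : IsSummand X Y ∨ IsSummand X Z := by
  obtain ⟨h⟩ := h
  have : IsIso ((h.i ≫ b.fst) ≫ (b.inl ≫ h.r) + (h.i ≫ b.snd) ≫ (b.inr ≫ h.r)) := by
    have e : (h.i ≫ b.fst) ≫ (b.inl ≫ h.r) + (h.i ≫ b.snd) ≫ (b.inr ≫ h.r)
        = h.i ≫ (b.fst ≫ b.inl + b.snd ≫ b.inr) ≫ h.r := by simp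
    rw [e, BinaryBicone.IsBilimit.total' hb, Category.id_comp, h.retract]
    infer_instance
  exact (hD.isIso_of_add hX _ _ this).imp (IsSummand.of_comp _ _) (IsSummand.of_comp _ _)

/-- A nonzero summand of an indecomposable object is isomorphic to it. -/
theorem IsFin.iso_of_isSummand (hD : IsFin k D) {X Y : D} (hX : ¬ IsZero X) (hY : IsIndec Y)
    (h : IsSummand X Y) : Nonempty (X ≅ Y) := by
  have := hD.idem
  obtain ⟨h⟩ := h
  rcases ((isIndec_iff Y).mp hY).2 (h.r ≫ h.i) (by simp) with h' | h'
  · exact absurd (isZero_of_id_comp h.retract h') hX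
  · exact ⟨⟨h.i, h.r, h.retract, h'⟩⟩

theorem IsFin.finrank_pos (hD : IsFin k D) {X : D} (hX : ¬ IsZero X) :
    0 < Module.finrank k (X ⟶ X) := by
  have := hD.finite_hom X X
  have : Nontrivial (X ⟶ X) := ⟨𝟙 X, 0, fun h => hX ((IsZero.iff_id_eq_zero X).mpr h)⟩
  exact Module.finrank_pos

/-- Block diagonal endomorphisms embed into all endomorphisms. Proper decompositions therefore lower
the dimension of the endomorphism algebra, which serves as induction measure. -/
theorem IsFin.finrank_add_le (hD : IsFin k D) {X Y : D} (b : BinaryBicone X Y) :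
    Module.finrank k (X ⟶ X) + Module.finrank k (Y ⟶ Y) ≤ Module.finrank k (b.pt ⟶ b.pt) := by
  have := hD.finite_hom
  let F : ((X ⟶ X) × (Y ⟶ Y)) →ₗ[k] (b.pt ⟶ b.pt) :=
    { toFun := fun p => b.fst ≫ p.1 ≫ b.inl + b.snd ≫ p.2 ≫ b.inr
      map_add' := fun p q => by simp; abel
      map_smul' := fun r p => by simp }
  rw [← Module.finrank_prod]
  refine LinearMap.finrank_le_finrank_of_injective (f := F) ?_
  rw [← LinearMap.ker_eq_bot, LinearMap.ker_eq_bot']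
  intro p hp
  have h1 : b.inl ≫ F p ≫ b.fst = p.1 := by simp [F]
  have h2 : b.inr ≫ F p ≫ b.snd = p.2 := by simp [F]
  rw [hp] at h1 h2
  refine Prod.ext ?_ ?_
  · rw [← h1]; simp
  · rw [← h2]; simp

/-- Every object is a finite direct sum of indecomposable ones, as an induction principle. -/
theorem IsFin.induction (hD : IsFin k D) {P : D → Prop} (hzero : ∀ X, IsZero X → P X)
    (hsum : ∀ X Y (b : BinaryBicone X Y), b.IsBilimit → P X → P Y → P b.pt)
    (hindec : ∀ X, IsIndec X → P X) (X : D) : P X := by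
  induction hn : Module.finrank k (X ⟶ X) using Nat.strong_induction_on generalizing X with
  | _ n ih =>
    by_cases h0 : IsZero X
    · exact hzero X h0
    by_cases hi : IsIndec X
    · exact hindec X hi
    simp only [IsIndec, not_and, not_forall, not_or] at hi
    obtain ⟨Y, Z, b, ⟨hb⟩, ⟨e⟩, hY, hZ⟩ := hi h0
    have hle := hD.finrank_add_le (biconeOfIso b e)
    have hY' := hD.finrank_pos hY
    have hZ' := hD.finrank_pos hZ
    change _ ≤ Module.finrank k (X ⟶ X) at hle
    exact hsum Y Z (biconeOfIso b e) (biconeOfIso_isBilimit b hb e).some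
      (ih _ (by omega) Y rfl) (ih _ (by omega) Z rfl)

theorem IsFin.exists_indec_summand (hD : IsFin k D) {X : D} (hX : ¬ IsZero X) :
    ∃ Y, IsIndec Y ∧ IsSummand Y X := by
  have := hD.hasZero
  refine hD.induction (P := fun X => ¬ IsZero X → ∃ Y, IsIndec Y ∧ IsSummand Y X) ?_ ?_ ?_ X hX
  · exact fun X h h' => absurd h h'
  · intro X Y b hb hX hY h
    by_cases h1 : IsZero X
    · by_cases h2 : IsZero Y
      · refine absurd ?_ h
        rw [IsZero.iff_id_eq_zero, ← BinaryBicone.IsBilimit.total' hb, h1.eq_of_tgt b.fst 0,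
          h2.eq_of_tgt b.snd 0]
        simp
      · obtain ⟨Z, hZ, h⟩ := hY h2
        exact ⟨Z, hZ, h.trans (IsSummand.inr b)⟩
    · obtain ⟨Z, hZ, h⟩ := hX h1
      exact ⟨Z, hZ, h.trans (IsSummand.inl b)⟩
  · exact fun X h _ => ⟨X, h, IsSummand.refl X⟩

/-- An additive functor which detects an indecomposable summand detects it on an
indecomposable summand. -/
theorem IsFin.exists_indec_of_map (hD : IsFin k D) {E : Type u'} [Category.{v'} E] [Preadditive E]
    [Linear k E] (hE : IsFin k E) (F : D ⥤ E) [F.Additive] {X : D} {Z : E} (hZ : IsIndec Z)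
    (h : IsSummand Z (F.obj X)) : ∃ Y, IsIndec Y ∧ IsSummand Y X ∧ IsSummand Z (F.obj Y) := by
  refine hD.induction
    (P := fun X => IsSummand Z (F.obj X) → ∃ Y, IsIndec Y ∧ IsSummand Y X ∧ IsSummand Z (F.obj Y))
    ?_ ?_ ?_ X h
  · exact fun X hX h => absurd (IsZero.of_isSummand (F.map_isZero hX) h) hZ.1
  · intro X Y b hb hX hY h
    rcases hE.isSummand_or hZ (map_bicone_isBilimit F b hb).some h with h | h
    · obtain ⟨W, hW, h1, h2⟩ := hX h
      exact ⟨W, hW, h1.trans (IsSummand.inl b), h2⟩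
    · obtain ⟨W, hW, h1, h2⟩ := hY h
      exact ⟨W, hW, h1.trans (IsSummand.inr b), h2⟩
  · exact fun X hX h => ⟨X, hX, IsSummand.refl X, h⟩

/-- An indecomposable object in the additive closure of `S` is a summand of an object of `S`. -/
theorem IsFin.isSummand_of_addClosure (hD : IsFin k D) {S : ObjectProperty D} {X Y : D}
    (hX : IsIndec X) (hY : AddClosure S Y) (h : IsSummand X Y) : ∃ Z, S Z ∧ IsSummand X Z := by
  induction hY with
  | of Y hY => exact ⟨Y, hY, h⟩
  | zero Y hY => exact absurd (IsZero.of_isSummand hY h) hX.1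
  | sum Y Z b hb _ _ ihY ihZ =>
    rcases hD.isSummand_or hX hb h with h | h
    · exact ihY h
    · exact ihZ h
  | summand Y Z hYZ _ ih => exact ih (h.trans hYZ)

/-- The class of objects given by a property closed under direct sums is determined by its
indecomposable objects. -/
theorem IsFin.of_indec_summands (hD : IsFin k D) {P : D → Prop} (hzero : ∀ X, IsZero X → P X)
    (hsum : ∀ X Y (b : BinaryBicone X Y), b.IsBilimit → P X → P Y → P b.pt) (X : D)
    (h : ∀ Y, IsIndec Y → IsSummand Y X → P Y) : P X := by
  refine hD.induction (P := fun X => (∀ Y, IsIndec Y → IsSummand Y X → P Y) → P X) ?_ ?_ ?_ X h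
  · exact fun X hX _ => hzero X hX
  · exact fun X Y b hb hX hY h => hsum X Y b hb
      (hX fun Z hZ hZX => h Z hZ (hZX.trans (IsSummand.inl b)))
      (hY fun Z hZ hZY => h Z hZ (hZY.trans (IsSummand.inr b)))
  · exact fun X hX h => h X hX (IsSummand.refl X)

theorem IsFin.finite_summands (hD : IsFin k D) (X : D) :
    ∃ l : List D, (∀ Y ∈ l, IsIndec Y) ∧
      ∀ Y, IsIndec Y → IsSummand Y X → ∃ Z ∈ l, Nonempty (Y ≅ Z) := by
  refine hD.induction (P := fun X => ∃ l : List D, (∀ Y ∈ l, IsIndec Y) ∧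
      ∀ Y, IsIndec Y → IsSummand Y X → ∃ Z ∈ l, Nonempty (Y ≅ Z)) ?_ ?_ ?_ X
  · exact fun X hX => ⟨[], by simp, fun Y hY h => absurd (IsZero.of_isSummand hX h) hY.1⟩
  · rintro X Y b hb ⟨l, hl, h⟩ ⟨l', hl', h'⟩
    refine ⟨l ++ l', fun Y hY => (List.mem_append.mp hY).elim (hl Y) (hl' Y), fun Z hZ hs => ?_⟩
    rcases hD.isSummand_or hZ hb hs with hs | hs
    · obtain ⟨W, hW, e⟩ := h Z hZ hs
      exact ⟨W, List.mem_append_left _ hW, e⟩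
    · obtain ⟨W, hW, e⟩ := h' Z hZ hs
      exact ⟨W, List.mem_append_right _ hW, e⟩
  · exact fun X hX => ⟨[X], by simpa using hX, fun Y hY hs =>
      ⟨X, by simp, hD.iso_of_isSummand hY.1 hX hs⟩⟩

/-- Any class of indecomposable objects of a finitary category has a finite irredundant
list of representatives. -/
theorem IsFin.exists_representatives (hD : IsFin k D) (P : D → Prop) (hP : ∀ X, P X → IsIndec X) :
    ∃ (n : ℕ) (r : Fin n → D), (∀ s, P (r s)) ∧ (∀ s t, Nonempty (r s ≅ r t) → s = t) ∧
      ∀ X, P X → ∃ s, Nonempty (X ≅ r s) := by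
  obtain ⟨T, hT⟩ := hD.gen
  obtain ⟨l, -, hl⟩ := hD.finite_summands T
  -- Every indecomposable is a summand of the additive generator `T`, which has only finitely many
  -- indecomposable summands up to isomorphism; so `Q` is finite.
  let Q : Set (Quotient (isIsomorphicSetoid D)) := {q | ∃ X, P X ∧ Quotient.mk _ X = q}
  have hQ : Q.Finite := by
    refine Set.Finite.subset (List.finite_toSet (l.map (Quotient.mk (isIsomorphicSetoid D)))) ?_
    rintro _ ⟨X, hX, rfl⟩
    obtain ⟨Z, rfl, hs⟩ := hD.isSummand_of_addClosure (hP X hX) (hT X) (IsSummand.refl X)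
    obtain ⟨W, hW, e⟩ := hl X (hP X hX) hs
    simp only [Set.mem_ofPred_eq, List.mem_map]
    exact ⟨W, hW, (Quotient.sound e).symm⟩
  have := hQ.fintype
  let e := (Fintype.equivFin Q).symm
  have hrep : ∀ s : Fin (Fintype.card Q), ∃ X, P X ∧
      Quotient.mk (isIsomorphicSetoid D) X = (e s).1 := fun s => (e s).2
  choose r hrP hr using hrep
  refine ⟨_, r, hrP, fun s t h => ?_, fun X hX => ?_⟩
  · apply e.injective
    apply Subtype.ext
    rw [← hr s, ← hr t]
    exact Quotient.sound h
  · refine ⟨e.symm ⟨_, X, hX, rfl⟩, Quotient.exact (s := isIsomorphicSetoid D) ?_⟩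
    rw [hr, e.apply_symm_apply]

end KrullSchmidt

/-! ### Multiplicities of indecomposable summands. -/

section Multiplicity

variable {k : Type uk} [Field k] {D : Type u} [Category.{v} D] [Preadditive D] [Linear k D]

variable (k) in
/-- The radical morphisms out of an indecomposable object. -/
def radHom (x Y : D) : Submodule k (x ⟶ Y) :=
  Submodule.span k {φ | ∀ ψ : Y ⟶ x, ¬ IsIso (φ ≫ ψ)}

/-- Locality of `End x` makes the morphisms that are not split monomorphisms closed under addition,
so taking the span adds nothing. -/
theorem IsFin.mem_radHom (hD : IsFin k D) {x Y : D} (hx : IsIndec x) (φ : x ⟶ Y) :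
    φ ∈ radHom k x Y ↔ ∀ ψ : Y ⟶ x, ¬ IsIso (φ ≫ ψ) := by
  refine ⟨fun h => ?_, fun h => Submodule.subset_span h⟩
  refine Submodule.span_induction (p := fun φ _ => ∀ ψ : Y ⟶ x, ¬ IsIso (φ ≫ ψ)) ?_ ?_ ?_ ?_ h
  · exact fun φ h => h
  · intro ψ
    rw [zero_comp]
    exact not_isIso_zero_of_isIndec hx
  · intro φ φ' _ _ h h' ψ hi
    rw [Preadditive.add_comp] at hi
    exact (hD.isIso_of_add hx _ _ hi).elim (h ψ) (h' ψ)
  · intro r φ _ h ψ hi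
    rw [Linear.smul_comp, ← Linear.comp_smul] at hi
    exact h _ hi

variable (k) in
/-- The multiplicity of an indecomposable object `x` as a direct summand of `Y`. -/
noncomputable def mult (x Y : D) : ℝ :=
  (Module.finrank k ((x ⟶ Y) ⧸ radHom k x Y) : ℝ) / Module.finrank k ((x ⟶ x) ⧸ radHom k x x)

theorem mult_nonneg (x Y : D) : 0 ≤ mult k x Y := by unfold mult; positivity

theorem IsFin.finrank_radHom_pos (hD : IsFin k D) {x Y : D} (hx : IsIndec x) (h : IsSummand x Y) :
    0 < Module.finrank k ((x ⟶ Y) ⧸ radHom k x Y) := by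
  have := hD.finite_hom x Y
  obtain ⟨h⟩ := h
  have : Nontrivial ((x ⟶ Y) ⧸ radHom k x Y) := by
    refine ⟨Submodule.Quotient.mk h.i, 0, fun h0 => ?_⟩
    rw [Submodule.Quotient.mk_eq_zero, hD.mem_radHom hx] at h0
    refine h0 h.r ?_
    rw [h.retract]
    infer_instance
  exact Module.finrank_pos

theorem IsFin.mult_pos (hD : IsFin k D) {x Y : D} (hx : IsIndec x) (h : IsSummand x Y) :
    0 < mult k x Y := by
  have h1 := hD.finrank_radHom_pos hx h
  have h2 := hD.finrank_radHom_pos hx (IsSummand.refl x)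
  unfold mult
  positivity

theorem IsFin.mult_self (hD : IsFin k D) {x : D} (hx : IsIndec x) : mult k x x = 1 := by
  have h2 := hD.finrank_radHom_pos hx (IsSummand.refl x)
  unfold mult
  exact div_self (by positivity)

theorem IsFin.mult_eq_zero (hD : IsFin k D) {x Y : D} (hx : IsIndec x) (h : ¬ IsSummand x Y) :
    mult k x Y = 0 := by
  have : Subsingleton ((x ⟶ Y) ⧸ radHom k x Y) := by
    rw [Submodule.Quotient.subsingleton_iff, eq_top_iff]
    intro φ _
    rw [hD.mem_radHom hx]
    exact fun ψ hi => h (IsSummand.of_comp φ ψ hi)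
  unfold mult
  rw [Module.finrank_zero_of_subsingleton]
  simp

/-- A morphism from `x` into a biproduct is radical exactly when both components are, so the
quotients by the radical add up. -/
theorem IsFin.mult_sum (hD : IsFin k D) {x Y Z : D} (hx : IsIndec x) (b : BinaryBicone Y Z)
    (hb : b.IsBilimit) : mult k x b.pt = mult k x Y + mult k x Z := by
  have := hD.finite_hom
  let F : (x ⟶ b.pt) →ₗ[k] ((x ⟶ Y) ⧸ radHom k x Y) × ((x ⟶ Z) ⧸ radHom k x Z) :=
    LinearMap.prod ((radHom k x Y).mkQ ∘ₗ Linear.rightComp k x b.fst)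
      ((radHom k x Z).mkQ ∘ₗ Linear.rightComp k x b.snd)
  have hF : Function.Surjective F := by
    rintro ⟨p, q⟩
    obtain ⟨p, rfl⟩ := Submodule.mkQ_surjective _ p
    obtain ⟨q, rfl⟩ := Submodule.mkQ_surjective _ q
    refine ⟨p ≫ b.inl + q ≫ b.inr, ?_⟩
    simp [F]
  have hker : LinearMap.ker F = radHom k x b.pt := by
    ext φ
    have hφ : φ ∈ LinearMap.ker F ↔ φ ≫ b.fst ∈ radHom k x Y ∧ φ ≫ b.snd ∈ radHom k x Z := by
      simp [F]
    rw [hφ, hD.mem_radHom hx, hD.mem_radHom hx, hD.mem_radHom hx]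
    constructor
    · rintro ⟨h1, h2⟩ ψ hi
      have : φ ≫ ψ = (φ ≫ b.fst) ≫ (b.inl ≫ ψ) + (φ ≫ b.snd) ≫ (b.inr ≫ ψ) := by
        calc φ ≫ ψ = φ ≫ (b.fst ≫ b.inl + b.snd ≫ b.inr) ≫ ψ := by
              rw [BinaryBicone.IsBilimit.total' hb, Category.id_comp]
          _ = _ := by simp
      rw [this] at hi
      exact (hD.isIso_of_add hx _ _ hi).elim (h1 _) (h2 _)
    · exact fun h => ⟨fun ψ hi => h (b.fst ≫ ψ) (by rwa [Category.assoc] at hi),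
        fun ψ hi => h (b.snd ≫ ψ) (by rwa [Category.assoc] at hi)⟩
  have e := (Submodule.quotEquivOfEq _ _ hker.symm).trans (F.quotKerEquivOfSurjective hF)
  unfold mult
  rw [e.finrank_eq, Module.finrank_prod]
  push_cast
  ring

theorem IsFin.mult_iso (hD : IsFin k D) {x Y Z : D} (hx : IsIndec x) (e : Y ≅ Z) :
    mult k x Y = mult k x Z := by
  have := hD.hasZero
  obtain ⟨O, hO⟩ := hD.hasZero
  let b : BinaryBicone Y O :=
    { pt := Z, fst := e.inv, snd := 0, inl := e.hom, inr := 0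
      inr_snd := hO.eq_of_src _ _ }
  have h := hD.mult_sum hx b (isBinaryBilimitOfTotal _ (by simp [b]))
  rw [hD.mult_eq_zero hx (fun h => hx.1 (IsZero.of_isSummand hO h)), add_zero] at h
  exact h.symm

/-- An additive function on objects is determined by its values on indecomposable objects. -/
theorem IsFin.additive_eq_sum (hD : IsFin k D) {n : ℕ} {r : Fin n → D}
    (hr : ∀ s, IsIndec (r s)) (hne : ∀ s t, Nonempty (r s ≅ r t) → s = t)
    (f : D → ℝ) (hf : ∀ X Y (b : BinaryBicone X Y), b.IsBilimit → f b.pt = f X + f Y)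
    (X : D) (hX : ∀ Y, IsIndec Y → IsSummand Y X → ∃ s, Nonempty (Y ≅ r s)) :
    f X = ∑ s, mult k (r s) X * f (r s) := by
  have := hD.hasZero
  have hf0 : ∀ X, IsZero X → f X = 0 := by
    intro X hX
    -- A zero object is the biproduct of two copies of itself, whence `f X = f X + f X`.
    let b : BinaryBicone X X :=
      { pt := X, fst := 0, snd := 0, inl := 0, inr := 0
        inl_fst := hX.eq_of_src _ _, inr_snd := hX.eq_of_src _ _ }
    have h := hf X X b (isBinaryBilimitOfTotal _ (hX.eq_of_src _ _))
    simp only [b] at h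
    linarith
  have hfi : ∀ X Y, Nonempty (X ≅ Y) → f X = f Y := by
    rintro X Y ⟨e⟩
    obtain ⟨O, hO⟩ := hD.hasZero
    let b : BinaryBicone X O :=
      { pt := Y, fst := e.inv, snd := 0, inl := e.hom, inr := 0
        inr_snd := hO.eq_of_src _ _ }
    have h := hf _ _ b (isBinaryBilimitOfTotal _ (by simp [b]))
    rw [hf0 _ hO, add_zero] at h
    exact h.symm
  refine hD.induction (P := fun X => (∀ Y, IsIndec Y → IsSummand Y X → ∃ s, Nonempty (Y ≅ r s)) →
    f X = ∑ s, mult k (r s) X * f (r s)) ?_ ?_ ?_ X hX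
  · intro X hX _
    rw [hf0 X hX, Finset.sum_eq_zero]
    intro s _
    rw [hD.mult_eq_zero (hr s) (fun h => (hr s).1 (IsZero.of_isSummand hX h)), zero_mul]
  · intro X Y b hb hX hY h
    rw [hf X Y b hb, hX fun Z hZ hs => h Z hZ (hs.trans (IsSummand.inl b)),
      hY fun Z hZ hs => h Z hZ (hs.trans (IsSummand.inr b)), ← Finset.sum_add_distrib]
    refine Finset.sum_congr rfl fun s _ => ?_
    rw [hD.mult_sum (hr s) b hb, add_mul]
  · intro X hX h
    obtain ⟨s, ⟨e⟩⟩ := h X hX (IsSummand.refl X)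
    rw [Finset.sum_eq_single s]
    · rw [hD.mult_iso (hr s) e, hD.mult_self (hr s), one_mul, hfi _ _ ⟨e⟩]
    · intro t _ hts
      rw [hD.mult_eq_zero (hr t), zero_mul]
      intro h
      obtain ⟨e'⟩ := hD.iso_of_isSummand (hr t).1 hX h
      exact hts (hne t s ⟨e' ≪≫ e⟩)
    · simp

end Multiplicity

/-! ### Additive closures and structure inherited by full subcategories. -/

section Transfer

variable {D : Type u} [Category.{v} D]

theorem isIdempotentComplete_fullSubcategory [IsIdempotentComplete D] (P : ObjectProperty D)
    (h : ∀ X Y, IsSummand X Y → P Y → P X) : IsIdempotentComplete P.FullSubcategory := by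
  refine ⟨fun X p hp => ?_⟩
  obtain ⟨Y, i, e, hie, hei⟩ := IsIdempotentComplete.idempotents_split X.obj p.hom
    (congrArg InducedCategory.Hom.hom hp)
  exact ⟨⟨Y, h _ _ ⟨⟨i, e, hie⟩⟩ X.property⟩, ObjectProperty.homMk i, ObjectProperty.homMk e,
    ObjectProperty.hom_ext _ hie, ObjectProperty.hom_ext _ hei⟩

variable [Preadditive D]

theorem AddClosure.of_iso {S : ObjectProperty D} {X Y : D} (h : AddClosure S X) (e : X ≅ Y) :
    AddClosure S Y :=
  AddClosure.summand _ _ (IsSummand.of_iso e.symm) h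

theorem AddClosure.map {E : Type u'} [Category.{v'} E] [Preadditive E] (F : D ⥤ E) [F.Additive]
    {S : ObjectProperty D} {S' : ObjectProperty E} (hS : ∀ X, S X → AddClosure S' (F.obj X)) {X : D}
    (h : AddClosure S X) : AddClosure S' (F.obj X) := by
  induction h with
  | of X h => exact hS X h
  | zero X h => exact AddClosure.zero _ (F.map_isZero h)
  | sum X Y b hb _ _ hX hY =>
    exact AddClosure.sum _ _ (F.mapBinaryBicone b) (map_bicone_isBilimit F b hb).some hX hY
  | summand X Y h _ ih => exact AddClosure.summand _ _ (h.map F) ih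

theorem AddClosure.mono {S S' : ObjectProperty D} (h : ∀ X, S X → AddClosure S' X) {X : D}
    (hX : AddClosure S X) : AddClosure S' X :=
  AddClosure.map (𝟭 D) h hX

/-- A binary biproduct in a full subcategory, given by one in the ambient category. -/
def biconeFullSubcategory {P : ObjectProperty D} {X Y : P.FullSubcategory}
    (b : BinaryBicone X.obj Y.obj) (h : P b.pt) : BinaryBicone X Y where
  pt := ⟨b.pt, h⟩
  fst := ObjectProperty.homMk b.fst
  snd := ObjectProperty.homMk b.snd
  inl := ObjectProperty.homMk b.inl
  inr := ObjectProperty.homMk b.inr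
  inl_fst := ObjectProperty.hom_ext _ b.inl_fst
  inl_snd := ObjectProperty.hom_ext _ b.inl_snd
  inr_fst := ObjectProperty.hom_ext _ b.inr_fst
  inr_snd := ObjectProperty.hom_ext _ b.inr_snd

theorem biconeFullSubcategory_isBilimit {P : ObjectProperty D} {X Y : P.FullSubcategory}
    (b : BinaryBicone X.obj Y.obj) (h : P b.pt) (hb : b.IsBilimit) :
    Nonempty (biconeFullSubcategory b h).IsBilimit :=
  ⟨isBinaryBilimitOfTotal _ (ObjectProperty.hom_ext _ (BinaryBicone.IsBilimit.total' hb))⟩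

theorem isZero_fullSubcategory {P : ObjectProperty D} (X : P.FullSubcategory)
    (h : IsZero X.obj) : IsZero X := by
  rw [IsZero.iff_id_eq_zero]
  exact ObjectProperty.hom_ext _ (h.eq_of_src _ _)

theorem hasBinaryBiproducts_fullSubcategory [HasBinaryBiproducts D] (P : ObjectProperty D)
    (h : ∀ (X Y : D) (b : BinaryBicone X Y), b.IsBilimit → P X → P Y → P b.pt) :
    HasBinaryBiproducts P.FullSubcategory := by
  refine ⟨fun X Y => ⟨⟨?_⟩⟩⟩
  have hb := BinaryBiproduct.isBilimit X.obj Y.obj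
  exact ⟨_, (biconeFullSubcategory_isBilimit _ (h _ _ _ hb X.property Y.property) hb).some⟩

theorem hasZeroObject_fullSubcategory [HasZeroObject D] (P : ObjectProperty D)
    (h : ∀ X, IsZero X → P X) : HasZeroObject P.FullSubcategory :=
  ⟨⟨(HasZeroObject.zero (C := D)).choose, h _ (HasZeroObject.zero (C := D)).choose_spec⟩,
    isZero_fullSubcategory _ (HasZeroObject.zero (C := D)).choose_spec⟩

end Transfer

section Equivalence

variable {k : Type uk} [Field k] {D : Type u} [Category.{v} D] [Preadditive D] [Linear k D]
  {E : Type u'} [Category.{v'} E] [Preadditive E] [Linear k E]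

theorem IsFin.of_equivalence (e : D ≌ E) [e.functor.Additive] [e.functor.Linear k]
    (h : IsFin k E) : IsFin k D := by
  have h1 := h.idem
  have h2 := h.hasZero
  have h3 := h.hasBiprod
  obtain ⟨T, hT⟩ := h.gen
  have : e.inverse.Additive := e.inverse_additive
  refine ⟨fun X Y => ?_, ?_, ?_, ?_, ⟨e.inverse.obj T, fun X => ?_⟩⟩
  · have := h.finite_hom (e.functor.obj X) (e.functor.obj Y)
    refine Module.Finite.of_injective (e.functor.mapLinearMap k (X := X) (Y := Y)) ?_
    exact e.functor.map_injective
  · exact (Idempotents.isIdempotentComplete_iff_of_equivalence e).mpr h1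
  · obtain ⟨O, hO⟩ := h2
    exact ⟨e.inverse.obj O, e.inverse.map_isZero hO⟩
  · have : HasBinaryProducts D := Adjunction.hasLimitsOfShape_of_equivalence e.functor
    exact HasBinaryBiproducts.of_hasBinaryProducts
  · refine AddClosure.of_iso ?_ (e.unitIso.app X).symm
    exact AddClosure.map e.inverse (S' := fun Y => Y = e.inverse.obj T)
      (fun Y hY => AddClosure.of _ (congrArg _ hY))
      (hT (e.functor.obj X))

end Equivalence

/-! ### Finitely generated projective modules satisfy the intrinsic conditions `IsFin`. -/

section ProjCat

variable (A : Type uk) [Ring A]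

/-- The defining property of the objects of `ProjCat A`. -/
abbrev projProp : ObjectProperty (ModuleCat.{uk} A) :=
  fun P => Module.Finite A P ∧ Module.Projective A P

variable {A}

theorem projProp_of_isSummand (X Y : ModuleCat.{uk} A) (h : IsSummand X Y) (hY : projProp A Y) :
    projProp A X := by
  obtain ⟨h⟩ := h
  have := hY.1
  have := hY.2
  have hr : h.r.hom ∘ₗ h.i.hom = LinearMap.id := by
    rw [← ModuleCat.hom_comp, h.retract, ModuleCat.hom_id]
  exact ⟨Module.Finite.of_surjective h.r.hom fun x => ⟨h.i.hom x, LinearMap.congr_fun hr x⟩,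
    Module.Projective.of_split h.i.hom h.r.hom hr⟩

theorem projProp_of_isBilimit (X Y : ModuleCat.{uk} A) (b : BinaryBicone X Y) (hb : b.IsBilimit)
    (hX : projProp A X) (hY : projProp A Y) : projProp A b.pt := by
  have := hX.1
  have := hX.2
  have := hY.1
  have := hY.2
  have h : b.fst ≫ b.inl + b.snd ≫ b.inr = 𝟙 b.pt := BinaryBicone.IsBilimit.total' hb
  refine projProp_of_isSummand b.pt (ModuleCat.of A (X × Y))
    ⟨⟨ModuleCat.ofHom (b.fst.hom.prod b.snd.hom),
      ModuleCat.ofHom (b.inl.hom.coprod b.inr.hom), ?_⟩⟩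
    ⟨inferInstanceAs (Module.Finite A (X × Y)), inferInstanceAs (Module.Projective A (X × Y))⟩
  rw [← h]
  ext x
  simp

theorem projProp_of_isZero (X : ModuleCat.{uk} A) (h : IsZero X) : projProp A X := by
  have := ModuleCat.subsingleton_of_isZero h
  have := Module.Free.of_subsingleton A X
  exact ⟨inferInstance, Module.Projective.of_free⟩

variable (A) in
/-- The free module `A ^ n`. -/
abbrev projPow (n : ℕ) : ProjCat A :=
  ⟨ModuleCat.of A (Fin n → A), inferInstanceAs (Module.Finite A (Fin n → A)),
    inferInstanceAs (Module.Projective A (Fin n → A))⟩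

variable (A) in
theorem addClosure_projPow (n : ℕ) : AddClosure (fun Y => Y = projPow A 1) (projPow A n) := by
  induction n with
  | zero =>
    refine AddClosure.zero _ (isZero_fullSubcategory _ ?_)
    exact ModuleCat.isZero_of_subsingleton (ModuleCat.of A (Fin 0 → A))
  | succ n ih =>
    let b : BinaryBicone (ModuleCat.of A (Fin n → A)) (ModuleCat.of A (Fin 1 → A)) :=
      { pt := ModuleCat.of A (Fin (n + 1) → A)
        fst := ModuleCat.ofHom (LinearMap.funLeft A A Fin.castSucc)
        snd := ModuleCat.ofHom (LinearMap.funLeft A A (fun _ => Fin.last n))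
        inl := ModuleCat.ofHom (LinearMap.pi (fun i => Fin.lastCases 0 (fun j => LinearMap.proj j) i))
        inr := ModuleCat.ofHom (LinearMap.pi (fun i => Fin.lastCases (LinearMap.proj 0)
          (fun _ => 0) i))
        inl_fst := by ext; simp [LinearMap.funLeft]
        inl_snd := by ext; simp [LinearMap.funLeft]
        inr_fst := by ext; simp [LinearMap.funLeft]
        inr_snd := by
          apply ModuleCat.hom_ext
          refine LinearMap.ext fun x => funext fun i => ?_
          fin_cases i
          simp [LinearMap.funLeft] }
    have hb : b.IsBilimit := isBinaryBilimitOfTotal _ (by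
      apply ModuleCat.hom_ext
      refine LinearMap.ext fun x => funext fun i => ?_
      refine Fin.lastCases ?_ (fun j => ?_) i
      · simp [b, LinearMap.funLeft]
      · simp [b, LinearMap.funLeft])
    exact AddClosure.sum _ _ _
      (biconeFullSubcategory_isBilimit (X := projPow A n) (Y := projPow A 1) b
        (projPow A (n + 1)).property hb).some ih (AddClosure.of _ rfl)

theorem exists_isSummand_projPow (P : ProjCat A) : ∃ n, IsSummand P (projPow A n) := by
  have := P.property.1
  have := P.property.2
  obtain ⟨n, f, g, -, -, h⟩ := Module.Finite.exists_comp_eq_id_of_projective A P.obj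
  refine ⟨n, ⟨⟨ObjectProperty.homMk (ModuleCat.ofHom g), ObjectProperty.homMk (ModuleCat.ofHom f),
    ObjectProperty.hom_ext _ (ModuleCat.hom_ext h)⟩⟩⟩

open scoped ModuleCat.Algebra in
theorem isFin_projCat (k : Type uk) [Field k] [Algebra k A] [Module.Finite k A] :
    IsFin k (ProjCat A) := by
  refine ⟨fun X Y => ?_, ?_, ?_, ?_, ⟨projPow A 1, fun X => ?_⟩⟩
  · have := X.property.1
    have := Y.property.1
    have : Module.Finite k X.obj := Module.Finite.trans A X.obj
    have : Module.Finite k Y.obj := Module.Finite.trans A Y.obj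
    let F : (X ⟶ Y) →ₗ[k] (X.obj →ₗ[k] Y.obj) :=
      { toFun := fun f => f.hom.hom.restrictScalars k
        map_add' := fun f g => rfl
        map_smul' := fun r f => by
          ext x
          rfl }
    refine Module.Finite.of_injective F fun f g h => ?_
    apply ObjectProperty.hom_ext
    ext x
    exact LinearMap.congr_fun h x
  · exact isIdempotentComplete_fullSubcategory _ projProp_of_isSummand
  · exact hasZeroObject_fullSubcategory _ projProp_of_isZero
  · exact hasBinaryBiproducts_fullSubcategory _ projProp_of_isBilimit
  · obtain ⟨n, h⟩ := exists_isSummand_projPow X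
    exact AddClosure.summand _ _ h (addClosure_projPow A n)

end ProjCat

/-! ### From the intrinsic conditions `IsFin` back to an algebra. -/

section ToProj

variable {k : Type uk} [Field k] {D : Type u} [Category.{v} D] [Preadditive D] [Linear k D]

theorem IsFinitaryCat.isFin (h : IsFinitaryCat k D) : IsFin k D := by
  obtain ⟨A, _, _, _, e, _, _⟩ := h
  exact IsFin.of_equivalence e (isFin_projCat k)

/-- Full faithfulness on morphisms out of `X`. -/
def HomBijective {E : Type u'} [Category.{v'} E] (F : D ⥤ E) (X : D) : Prop :=
  ∀ Y, Function.Bijective (F.map : (X ⟶ Y) → (F.obj X ⟶ F.obj Y))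

/-- Bijectivity on morphisms out of an object is inherited by biproducts and retracts, so it
suffices to test it on a generator. -/
theorem homBijective_of_addClosure {E : Type u'} [Category.{v'} E] [Preadditive E] (F : D ⥤ E)
    [F.Additive] {S : ObjectProperty D} (hS : ∀ X, S X → HomBijective F X) {X : D}
    (h : AddClosure S X) : HomBijective F X := by
  induction h with
  | of X h => exact hS X h
  | zero X h => exact fun Y => ⟨fun f g _ => h.eq_of_src f g,
      fun f => ⟨0, (F.map_isZero h).eq_of_src _ _⟩⟩
  | sum X Y b hb _ _ hX hY =>
    refine fun Z => ⟨fun f g hfg => ?_, fun f => ?_⟩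
    · have h1 : b.inl ≫ f = b.inl ≫ g := (hX Z).1 (by rw [F.map_comp, F.map_comp, hfg])
      have h2 : b.inr ≫ f = b.inr ≫ g := (hY Z).1 (by rw [F.map_comp, F.map_comp, hfg])
      rw [← Category.id_comp f, ← Category.id_comp g, ← BinaryBicone.IsBilimit.total' hb]
      simp [h1, h2]
    · obtain ⟨p, hp⟩ := (hX Z).2 (F.map b.inl ≫ f)
      obtain ⟨q, hq⟩ := (hY Z).2 (F.map b.inr ≫ f)
      refine ⟨b.fst ≫ p + b.snd ≫ q, ?_⟩
      rw [F.map_add, F.map_comp, F.map_comp, hp, hq, ← Category.assoc, ← Category.assoc,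
        ← Preadditive.add_comp, ← F.map_comp, ← F.map_comp, ← F.map_add,
        BinaryBicone.IsBilimit.total' hb, F.map_id, Category.id_comp]
  | summand X Y h _ ih =>
    obtain ⟨h⟩ := h
    refine fun Z => ⟨fun f g hfg => ?_, fun f => ?_⟩
    · have : h.r ≫ f = h.r ≫ g := (ih Z).1 (by rw [F.map_comp, F.map_comp, hfg])
      rw [← Category.id_comp f, ← Category.id_comp g, ← h.retract, Category.assoc, this,
        Category.assoc]
    · obtain ⟨p, hp⟩ := (ih Z).2 (F.map h.r ≫ f)
      refine ⟨h.i ≫ p, ?_⟩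
      rw [F.map_comp, hp, ← Category.assoc, ← F.map_comp, h.retract, F.map_id, Category.id_comp]

/-- The essential image of a fully faithful functor between suitable categories is additively
closed. -/
theorem exists_iso_of_addClosure {E : Type u'} [Category.{v'} E] [Preadditive E] (F : D ⥤ E)
    [F.Additive] [F.Full] [F.Faithful] [IsIdempotentComplete D] [HasZeroObject D]
    [HasBinaryBiproducts D] {S : ObjectProperty E} (hS : ∀ P, S P → ∃ X, Nonempty (F.obj X ≅ P))
    {P : E} (h : AddClosure S P) : ∃ X, Nonempty (F.obj X ≅ P) := by
  induction h with
  | of P h => exact hS P h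
  | zero P h =>
    obtain ⟨O, hO⟩ := HasZeroObject.zero (C := D)
    exact ⟨O, ⟨(F.map_isZero hO).iso h⟩⟩
  | sum P Q b hb _ _ hP hQ =>
    obtain ⟨X, ⟨e⟩⟩ := hP
    obtain ⟨Y, ⟨e'⟩⟩ := hQ
    have h1 := BinaryBicone.IsBilimit.total' hb
    have h2 : F.map (biprod.fst : X ⊞ Y ⟶ X) ≫ F.map biprod.inl +
        F.map (biprod.snd : X ⊞ Y ⟶ Y) ≫ F.map biprod.inr = 𝟙 _ := BinaryBicone.IsBilimit.total'
      (map_bicone_isBilimit F _ (BinaryBiproduct.isBilimit X Y)).some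
    refine ⟨X ⊞ Y, ⟨⟨F.map biprod.fst ≫ e.hom ≫ b.inl + F.map biprod.snd ≫ e'.hom ≫ b.inr,
      b.fst ≫ e.inv ≫ F.map biprod.inl + b.snd ≫ e'.inv ≫ F.map biprod.inr, ?_, ?_⟩⟩⟩
    · simpa using h2
    · simp only [Preadditive.comp_add, Preadditive.add_comp, Category.assoc, ← F.map_comp_assoc]
      simpa using h1
  | summand P Q h _ ih =>
    obtain ⟨X, ⟨e⟩⟩ := ih
    obtain ⟨h⟩ := h
    obtain ⟨p, hp⟩ := F.map_surjective (e.hom ≫ h.r ≫ h.i ≫ e.inv)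
    have hpp : p ≫ p = p := F.map_injective (by simp [hp])
    obtain ⟨Y, i, q, hiq, hqi⟩ := IsIdempotentComplete.idempotents_split X p hpp
    refine ⟨Y, ⟨⟨F.map i ≫ e.hom ≫ h.r, h.i ≫ e.inv ≫ F.map q, ?_, ?_⟩⟩⟩
    · have : (F.map i ≫ e.hom ≫ h.r) ≫ h.i ≫ e.inv ≫ F.map q =
        F.map i ≫ (e.hom ≫ h.r ≫ h.i ≫ e.inv) ≫ F.map q := by simp
      rw [this, ← hp, ← F.map_comp, ← F.map_comp, ← hqi]
      simp [hiq]
    · have : (h.i ≫ e.inv ≫ F.map q) ≫ F.map i ≫ e.hom ≫ h.r =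
        h.i ≫ e.inv ≫ F.map (q ≫ i) ≫ e.hom ≫ h.r := by simp
      rw [this, hqi, hp]
      simp

/-- A category with an additive generator `T` is equivalent to the category of finitely generated
projective modules over the endomorphisms of `T`. -/
theorem IsFin.isFinitaryCat_of_small {D : Type u} [Category.{uk} D] [Preadditive D] [Linear k D]
    (hD : IsFin k D) : IsFinitaryCat k D := by
  obtain ⟨T, hT⟩ := hD.gen
  have := hD.idem
  have := hD.hasZero
  have := hD.hasBiprod
  -- Precomposition by endomorphisms of `T` turns `T ⟶ X` into a module over the opposite of `End
  -- T`.
  let B := (End T)ᵐᵒᵖ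
  have hfin : Module.Finite k (End T) := hD.finite_hom T T
  have : Module.Finite k B := Module.Finite.equiv (MulOpposite.opLinearEquiv k)
  let G : D ⥤ ModuleCat.{uk} B := preadditiveCoyonedaObj T
  have hGT : projProp B (G.obj T) := by
    let e : B ≃ₗ[B] (G.obj T) :=
      { toFun := fun f => (MulOpposite.unop f : T ⟶ T)
        invFun := fun f => MulOpposite.op (f : T ⟶ T)
        map_add' := fun _ _ => rfl
        map_smul' := fun _ _ => rfl
        left_inv := fun _ => rfl
        right_inv := fun _ => rfl }
    exact ⟨Module.Finite.equiv e, Module.Projective.of_equiv e⟩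
  have hG : ∀ X, projProp B (G.obj X) := by
    intro X
    induction hT X with
    | of X h => rw [h]; exact hGT
    | zero X h => exact projProp_of_isZero _ (G.map_isZero h)
    | sum X Y b hb _ _ hX hY =>
      exact projProp_of_isBilimit _ _ (G.mapBinaryBicone b) (map_bicone_isBilimit G b hb).some hX hY
    | summand X Y h _ ih => exact projProp_of_isSummand _ _ (h.map G) ih
  let F : D ⥤ ProjCat B := ObjectProperty.lift _ G hG
  have : F.Additive := ⟨ObjectProperty.hom_ext _ (G.map_add)⟩
  have hbij : ∀ X, HomBijective F X := by
    refine fun X => homBijective_of_addClosure F ?_ (hT X)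
    rintro X rfl Y
    refine ⟨fun f g h => ?_, fun f => ?_⟩
    · have := LinearMap.congr_fun (congrArg (fun t => t.hom.hom) h) (𝟙 X : X ⟶ X)
      change 𝟙 X ≫ f = 𝟙 X ≫ g at this
      simpa using this
    · refine ⟨f.hom.hom (𝟙 X : X ⟶ X), ?_⟩
      apply ObjectProperty.hom_ext
      refine ModuleCat.hom_ext (LinearMap.ext fun (x : X ⟶ X) => ?_)
      have := f.hom.hom.map_smul (MulOpposite.op (x : End X)) (𝟙 X : X ⟶ X)
      change f.hom.hom ((x : X ⟶ X) ≫ 𝟙 X) = (x : X ⟶ X) ≫ _ at this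
      rw [Category.comp_id] at this
      exact this.symm
  have : F.Faithful := ⟨fun {X Y} f g h => (hbij X Y).1 h⟩
  have : F.Full := ⟨fun {X Y} f => (hbij X Y).2 f⟩
  have : F.EssSurj := by
    refine ⟨fun P => ?_⟩
    obtain ⟨n, h⟩ := exists_isSummand_projPow P
    -- The essential image is additively closed, so it is enough to hit the free module of rank one,
    -- which is the image of `T`.
    refine exists_iso_of_addClosure F ?_ (AddClosure.summand _ _ h (addClosure_projPow B n))
    rintro _ rfl
    let e : F.obj T ⟶ projPow B 1 := ObjectProperty.homMk (ModuleCat.ofHom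
      { toFun := fun f _ => MulOpposite.op (f : T ⟶ T)
        map_add' := fun _ _ => rfl
        map_smul' := fun _ _ => rfl })
    let e' : projPow B 1 ⟶ F.obj T := ObjectProperty.homMk (ModuleCat.ofHom
      { toFun := fun f => (MulOpposite.unop (f 0) : T ⟶ T)
        map_add' := fun _ _ => rfl
        map_smul' := fun _ _ => rfl })
    refine ⟨T, ⟨⟨e, e', rfl, ?_⟩⟩⟩
    apply ObjectProperty.hom_ext
    refine ModuleCat.hom_ext (LinearMap.ext fun x => funext fun i => ?_)
    fin_cases i
    rfl
  have : F.IsEquivalence := {}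
  refine ⟨B, inferInstance, inferInstance, inferInstance, F.asEquivalence, ‹F.Additive›, ⟨?_⟩⟩
  intro X Y f r
  apply ObjectProperty.hom_ext
  ext x
  change (x : T ⟶ X) ≫ (r • f) = (r • 𝟙 T) ≫ (x : T ⟶ X) ≫ f
  rw [Linear.smul_comp, Category.id_comp]
  exact Linear.comp_smul T X Y x r f

/-- The `k`-linear structure induced by a fully faithful functor. -/
@[reducible]
def linearOfFullyFaithful (k : Type uk) [Field k] {D : Type u} [Category.{v} D] [Preadditive D]
    {E : Type u'} [Category.{v'} E] [Preadditive E] [Linear k E] {F : D ⥤ E} [F.Additive]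
    (hF : F.FullyFaithful) : Linear k D where
  homModule X Y :=
    letI : SMul k (X ⟶ Y) := ⟨fun r f => hF.preimage (r • F.map f)⟩
    Function.Injective.module k (F.mapAddHom (X := X) (Y := Y))
      (fun _ _ h => hF.map_injective h)
      (fun _ _ => hF.map_preimage _)
  smul_comp X Y Z r f g := hF.map_injective (by
    change F.map (hF.preimage (r • F.map f) ≫ g) = F.map (hF.preimage (r • F.map (f ≫ g)))
    simp)
  comp_smul X Y Z f r g := hF.map_injective (by
    change F.map (f ≫ hF.preimage (r • F.map g)) = F.map (hF.preimage (r • F.map (f ≫ g)))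
    simp)

/-- Finite dimensional morphism spaces are small relative to the universe of `k`, so they can be
shrunk to the size needed for `isFinitaryCat_of_small`, and the linear structure is transported
along. -/
theorem IsFin.isFinitaryCat (hD : IsFin k D) : IsFinitaryCat k D := by
  have : LocallySmall.{uk} D := ⟨fun X Y => by
    have := hD.finite_hom X Y
    exact Module.Finite.small k (X ⟶ Y)⟩
  let D' := ShrinkHoms.{u} D
  have : (ShrinkHoms.equivalence.{uk} D).inverse.Additive :=
    inferInstanceAs (ShrinkHoms.inverse.{uk} D).Additive
  let hF := (ShrinkHoms.equivalence.{uk} D).fullyFaithfulInverse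
  let _ : Linear k D' := linearOfFullyFaithful k hF
  have hinv : (ShrinkHoms.equivalence.{uk} D).symm.functor.Linear k := ⟨fun f r =>
    hF.map_preimage _⟩
  have : (ShrinkHoms.equivalence.{uk} D).symm.functor.Additive := this
  obtain ⟨A, _, _, _, e, _, _⟩ :=
    (IsFin.of_equivalence (ShrinkHoms.equivalence.{uk} D).symm hD).isFinitaryCat_of_small
  have : (ShrinkHoms.equivalence.{uk} D).functor.Additive :=
    inferInstanceAs (ShrinkHoms.functor.{uk} D).Additive
  have : (ShrinkHoms.equivalence.{uk} D).functor.Linear k := by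
    have := (ShrinkHoms.equivalence.{uk} D).symm.inverseLinear k
    exact this
  exact ⟨A, _, _, ‹_›, (ShrinkHoms.equivalence.{uk} D).trans e,
    inferInstanceAs ((ShrinkHoms.equivalence.{uk} D).functor ⋙ e.functor).Additive,
    (inferInstance : ((ShrinkHoms.equivalence.{uk} D).functor ⋙ e.functor).Linear k)⟩

end ToProj
-- Perron–Frobenius theory for positive matrices.
section PerronFrobenius

variable {ι : Type*} [Fintype ι]

/-- The existence part of Perron's theorem. -/
theorem exists_pos_eigenvector [Nonempty ι] (A : ι → ι → ℝ) (hA : ∀ i j, 0 < A i j) :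
    ∃ (t : ℝ) (v : ι → ℝ), (∀ i, 0 < v i) ∧ ∀ i, ∑ j, A i j * v j = t * v i := by
  classical
  set M : ℝ := ∑ i, ∑ j, A i j
  have hpos : ∀ v : ι → ℝ, v ∈ stdSimplex ℝ ι → ∀ i, 0 < ∑ j, A i j * v j := by
    intro v hv i
    have hne : ∃ j, v j ≠ 0 := by
      by_contra! h
      have := hv.2
      simp [h] at this
    obtain ⟨j, hj⟩ := hne
    exact Finset.sum_pos' (fun j _ => mul_nonneg (hA i j).le (hv.1 j))
      ⟨j, Finset.mem_univ _, mul_pos (hA i j) (lt_of_le_of_ne (hv.1 j) hj.symm)⟩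
  have hM : ∀ (t : ℝ) (v : ι → ℝ), v ∈ stdSimplex ℝ ι →
      (∀ i, t * v i ≤ ∑ j, A i j * v j) → t ≤ M := by
    intro t v hv h
    calc t = ∑ i, t * v i := by rw [← Finset.mul_sum, hv.2, mul_one]
      _ ≤ ∑ i, ∑ j, A i j * v j := Finset.sum_le_sum fun i _ => h i
      _ ≤ M := by
        refine Finset.sum_le_sum fun i _ => Finset.sum_le_sum fun j _ => ?_
        have : v j ≤ 1 := by
          rw [← hv.2]
          exact Finset.single_le_sum (fun j _ => hv.1 j) (Finset.mem_univ j)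
        exact mul_le_of_le_one_right (hA i j).le this
  -- The eigenvalue is found by maximising `t` over the pairs with `t v ≤ A v`; the a priori bound
  -- `M` makes this set compact.
  let K : Set (ℝ × (ι → ℝ)) := (Set.Icc 0 M ×ˢ stdSimplex ℝ ι) ∩
    {p | ∀ i, p.1 * p.2 i ≤ ∑ j, A i j * p.2 j}
  have hK : IsCompact K := by
    refine (isCompact_Icc.prod (isCompact_stdSimplex ℝ ι)).inter_right ?_
    have : {p : ℝ × (ι → ℝ) | ∀ i, p.1 * p.2 i ≤ ∑ j, A i j * p.2 j} =
        ⋂ i, {p : ℝ × (ι → ℝ) | p.1 * p.2 i ≤ ∑ j, A i j * p.2 j} := by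
      ext; simp
    rw [this]
    exact isClosed_iInter fun i => isClosed_le (by fun_prop) (by fun_prop)
  have hKne : K.Nonempty := by
    obtain ⟨i⟩ := ‹Nonempty ι›
    have hv := single_mem_stdSimplex ℝ i
    refine ⟨(0, Pi.single i 1), ⟨⟨le_rfl, ?_⟩, hv⟩, fun j => ?_⟩
    · exact Finset.sum_nonneg fun i _ => Finset.sum_nonneg fun j _ => (hA i j).le
    · simpa using (hpos _ hv j).le
  obtain ⟨⟨t, v⟩, ⟨⟨ht, hv⟩, hle⟩, hmax⟩ := hK.exists_isMaxOn hKne continuous_fst.continuousOn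
  simp only at ht hv hle
  have heq : ∀ i, ∑ j, A i j * v j = t * v i := by
    by_contra! hne
    obtain ⟨i₀, hi₀⟩ := hne
    -- If `A v ≠ t v`, positivity of `A` spreads the single strict inequality to all coordinates of
    -- `y = A v`. After normalisation `y` then admits a factor larger than `t`, against maximality.
    set y : ι → ℝ := fun i => ∑ j, A i j * v j with hy
    have hyp : ∀ i, 0 < y i := hpos v hv
    have hlt : ∀ i, t * y i < ∑ j, A i j * y j := by
      intro i
      have : 0 < ∑ j, A i j * (y j - t * v j) := by
        refine Finset.sum_pos' (fun j _ => mul_nonneg (hA i j).le (sub_nonneg.mpr (hle j)))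
          ⟨i₀, Finset.mem_univ _, mul_pos (hA i i₀) (sub_pos.mpr ?_)⟩
        exact lt_of_le_of_ne (hle i₀) hi₀.symm
      have e : ∑ j, A i j * (y j - t * v j) = ∑ j, A i j * y j - t * y i := by
        rw [hy, Finset.mul_sum, ← Finset.sum_sub_distrib]
        exact Finset.sum_congr rfl fun j _ => by ring
      linarith
    obtain ⟨i₁, -, hi₁⟩ := Finset.exists_min_image Finset.univ
      (fun i => (∑ j, A i j * y j) / y i) Finset.univ_nonempty
    set t' := (∑ j, A i₁ j * y j) / y i₁ with ht'
    have htt' : t < t' := by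
      rw [ht', lt_div_iff₀ (hyp i₁)]
      exact hlt i₁
    set s := ∑ i, y i with hs
    have hsp : 0 < s := Finset.sum_pos (fun i _ => hyp i) Finset.univ_nonempty
    have hv' : (fun i => y i / s) ∈ stdSimplex ℝ ι := by
      refine ⟨fun i => (div_pos (hyp i) hsp).le, ?_⟩
      rw [← Finset.sum_div, div_self hsp.ne']
    have hle' : ∀ i, t' * (y i / s) ≤ ∑ j, A i j * (y j / s) := by
      intro i
      have h1 : t' * y i ≤ ∑ j, A i j * y j := (le_div_iff₀ (hyp i)).mp (hi₁ i (Finset.mem_univ _))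
      have h2 : ∑ j, A i j * (y j / s) = (∑ j, A i j * y j) / s := by
        rw [Finset.sum_div]
        exact Finset.sum_congr rfl fun j _ => by ring
      rw [h2, ← mul_div_assoc]
      exact div_le_div_of_nonneg_right h1 hsp.le
    have hmem : (t', fun i => y i / s) ∈ K :=
      ⟨⟨⟨ht.1.trans htt'.le, hM _ _ hv' hle'⟩, hv'⟩, hle'⟩
    have h3 : t' ≤ t := hmax hmem
    exact absurd h3 (not_le.mpr htt')
  refine ⟨t, v, fun i => ?_, heq⟩
  have h1 := hpos v hv i
  rw [heq i] at h1
  exact pos_of_mul_pos_right h1 ht.1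

/-- A subinvariant vector for the Perron eigenvalue is an eigenvector. -/
theorem eq_of_subinvariant (A : ι → ι → ℝ) (hA : ∀ i j, 0 < A i j)
    {t : ℝ} {v : ι → ℝ} (hv : ∀ i, 0 < v i) (hAv : ∀ i, ∑ j, A i j * v j = t * v i)
    {y : ι → ℝ} (hy : ∀ i, ∑ j, A i j * y j ≤ t * y i) (i : ι) :
    ∑ j, A i j * y j = t * y i := by
  -- Subtracting the largest multiple of `v` that lies below `y` leaves a nonnegative subinvariant
  -- vector vanishing at `i₀`. Row `i₀` of the positive matrix then forces it to vanish everywhere,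
  -- so `y` is a multiple of `v`.
  obtain ⟨i₀, -, hi₀⟩ := Finset.exists_min_image Finset.univ (fun i => y i / v i)
    ⟨i, Finset.mem_univ i⟩
  set s := y i₀ / v i₀ with hs
  have hnn : ∀ j, 0 ≤ y j - s * v j := by
    intro j
    have := (le_div_iff₀ (hv j)).mp (hi₀ j (Finset.mem_univ _))
    linarith
  have h0 : y i₀ - s * v i₀ = 0 := by
    rw [hs, div_mul_cancel₀ _ (hv i₀).ne', sub_self]
  have key : ∀ i, ∑ j, A i j * (y j - s * v j) ≤ t * (y i - s * v i) := by
    intro i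
    have e : ∑ j, A i j * (y j - s * v j) = ∑ j, A i j * y j - s * ∑ j, A i j * v j := by
      rw [Finset.mul_sum, ← Finset.sum_sub_distrib]
      exact Finset.sum_congr rfl fun j _ => by ring
    rw [e, hAv i]
    linarith [hy i]
  have hz : ∀ j, y j = s * v j := by
    have h1 := key i₀
    rw [h0, mul_zero] at h1
    have h2 : ∑ j, A i₀ j * (y j - s * v j) = 0 :=
      le_antisymm h1 (Finset.sum_nonneg fun j _ => mul_nonneg (hA i₀ j).le (hnn j))
    intro j
    have h3 := (Finset.sum_eq_zero_iff_of_nonneg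
      (fun j _ => mul_nonneg (hA i₀ j).le (hnn j))).mp h2 j (Finset.mem_univ _)
    rcases mul_eq_zero.mp h3 with h | h
    · exact absurd h (hA i₀ j).ne'
    · linarith
  calc ∑ j, A i j * y j = s * ∑ j, A i j * v j := by
        rw [Finset.mul_sum]
        exact Finset.sum_congr rfl fun j _ => by rw [hz]; ring
    _ = t * y i := by rw [hAv i, hz i]; ring

end PerronFrobenius

/-! ### The cell preorders and additivity of horizontal composition. -/

section Bicat

variable {C : Type u} [Bicategory.{w, v} C]

theorem IsSummand.comp {a b c : C} {f f' : a ⟶ b} {g g' : b ⟶ c} (h : IsSummand f f')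
    (h' : IsSummand g g') : IsSummand (f ≫ g) (f' ≫ g') :=
  (h.map (postcomp a g)).trans (h'.map (precomp c f'))

theorem leftGE_iff {a b c : C} (f : a ⟶ c) (g : a ⟶ b) :
    LeftGE f g ↔ ∃ h : b ⟶ c, IsSummand f (g ≫ h) :=
  ⟨fun ⟨_, _, h, hf⟩ => ⟨h, hf⟩, fun ⟨h, hf⟩ => ⟨f, g, h, hf⟩⟩

theorem LeftGE.source_eq {a b c d : C} {f : a ⟶ b} {g : c ⟶ d} (h : LeftGE f g) : a = c := by
  cases h
  rfl

theorem LeftGE.trans {a b a' b' a'' b'' : C} {f : a ⟶ b} {g : a' ⟶ b'} {h : a'' ⟶ b''}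
    (h1 : LeftGE f g) (h2 : LeftGE g h) : LeftGE f h := by
  obtain ⟨f, g, k, hf⟩ := h1
  obtain ⟨_, h, k', hg⟩ := h2
  exact ⟨f, h, k' ≫ k, (hf.trans (hg.comp (IsSummand.refl k))).trans
    (IsSummand.of_iso (α_ h k' k))⟩

theorem LeftGE.refl {a b : C} (f : a ⟶ b) : LeftGE f f :=
  ⟨f, f, 𝟙 b, IsSummand.of_iso (ρ_ f).symm⟩

theorem LeftGE.of_isSummand {a b : C} {f g : a ⟶ b} (h : IsSummand f g) : LeftGE f g :=
  ⟨f, g, 𝟙 b, h.trans (IsSummand.of_iso (ρ_ g).symm)⟩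

theorem TwoSidedGE.trans {a b a' b' a'' b'' : C} {f : a ⟶ b} {g : a' ⟶ b'} {h : a'' ⟶ b''}
    (h1 : TwoSidedGE f g) (h2 : TwoSidedGE g h) : TwoSidedGE f h := by
  obtain ⟨k, l, hf⟩ := h1
  obtain ⟨k', l', hg⟩ := h2
  refine ⟨k ≫ k', l' ≫ l, hf.trans
    (((IsSummand.refl k).comp (hg.comp (IsSummand.refl l))).trans (IsSummand.of_iso ?_))⟩
  exact whiskerLeftIso k (α_ k' (h ≫ l') l ≪≫ whiskerLeftIso k' (α_ h l' l)) ≪≫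
    (α_ k k' (h ≫ l' ≫ l)).symm

theorem TwoSidedGE.of_comp {a b c d : C} {f : a ⟶ d} {h : a ⟶ b} {g : b ⟶ c} {h' : c ⟶ d}
    (hf : IsSummand f (h ≫ g ≫ h')) : TwoSidedGE f g := ⟨h, h', hf⟩

theorem TwoSidedGE.of_comp_right {a b c : C} {f : a ⟶ c} {g : a ⟶ b} {h : b ⟶ c}
    (hf : IsSummand f (g ≫ h)) : TwoSidedGE f g :=
  ⟨𝟙 a, h, hf.trans (IsSummand.of_iso (λ_ (g ≫ h)).symm)⟩

theorem LeftGE.twoSidedGE {a b c d : C} {f : a ⟶ b} {g : c ⟶ d} (h : LeftGE f g) :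
    TwoSidedGE f g := by
  obtain ⟨f, g, h, hf⟩ := h
  exact TwoSidedGE.of_comp_right hf

theorem TwoSidedGE.refl {a b : C} (f : a ⟶ b) : TwoSidedGE f f := (LeftGE.refl f).twoSidedGE

variable [PreadditiveBicategory C]

instance precomp_additive {a b : C} (c : C) (f : a ⟶ b) : (precomp c f).Additive :=
  ⟨PreadditiveBicategory.whiskerLeft_add f _ _⟩

instance postcomp_additive (a : C) {b c : C} (f : b ⟶ c) : (postcomp a f).Additive :=
  ⟨PreadditiveBicategory.add_whiskerRight _ _ f⟩

end Bicat

/-! ### Symmetry of the left preorder by means of Perron eigenvectors. -/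

section Regularity

variable {k : Type uk} [Field k] {C : Type u} [Bicategory.{w, v} C] [PreadditiveBicategory C]
  [LinearBicategory k C]

theorem IsFinitary.isFin (hC : IsFinitary k C) (a b : C) : IsFin k (a ⟶ b) :=
  (hC.finitary a b).isFin

theorem IsFinitary.exists_indec_comp (hC : IsFinitary k C) {a b c : C} {x : a ⟶ c} {f : a ⟶ b}
    {g : b ⟶ c} (hx : IsIndec x) (h : IsSummand x (f ≫ g)) :
    ∃ (f' : a ⟶ b) (g' : b ⟶ c), IsIndec f' ∧ IsIndec g' ∧ IsSummand f' f ∧ IsSummand g' g ∧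
      IsSummand x (f' ≫ g') := by
  obtain ⟨f', hf', hs, h'⟩ :=
    (hC.isFin a b).exists_indec_of_map (hC.isFin a c) (postcomp a g) hx h
  obtain ⟨g', hg', hs', h''⟩ :=
    (hC.isFin b c).exists_indec_of_map (hC.isFin a c) (precomp c f') hx h'
  exact ⟨f', g', hf', hg', hs, hs', h''⟩

/-- Above any element there is an element which is maximal for a preorder on a finite type. -/
theorem exists_maximal_above {α : Type*} [Finite α] (r : α → α → Prop)
    (ht : ∀ a b c, r a b → r b c → r a c) (hr : ∀ a, r a a) (a : α) :
    ∃ b, r b a ∧ ∀ c, r c b → r b c := by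
  let s : α → α → Prop := fun x y => r x y ∧ ¬ r y x
  have : IsTrans α s := ⟨fun x y z h h' => ⟨ht _ _ _ h.1 h'.1, fun h'' => h'.2 (ht _ _ _ h'' h.1)⟩⟩
  have : Std.Irrefl s := ⟨fun x h => h.2 h.1⟩
  have hwf : WellFounded s := Finite.wellFounded_of_trans_of_irrefl s
  obtain ⟨b, hb, hmin⟩ := hwf.has_min {b | r b a} ⟨a, hr a⟩
  exact ⟨b, hb, fun c hc => by
    by_contra h
    exact hmin c (ht _ _ _ hc hb) ⟨hc, h⟩⟩

/-- If every indecomposable `y` above `f` in the left preorder is equivalent to `f` in the two-sided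
preorder, then it is equivalent to `f` in the left preorder. -/
theorem leftGE_of_leftGE (hC : IsFinitary k C) {a b d : C} {f : a ⟶ b} (hf : IsIndec f)
    (hJ : ∀ (c : C) (y : a ⟶ c), IsIndec y → LeftGE y f → TwoSidedGE f y)
    {x : a ⟶ d} (hx : IsIndec x) (hxf : LeftGE x f) : LeftGE f x := by
  classical
  have := hC.finite
  have := Fintype.ofFinite C
  have hfin := fun c => hC.isFin a c
  choose n r hr hne hrep using fun c => (hfin c).exists_representatives IsIndec (fun _ h => h)
  have hgen := fun c d => (hC.isFin c d).gen
  choose T hT using hgen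
  -- Composition with the generators `T c d` already detects everything above `y`, so the single
  -- matrix of the multiplicities of `R s` in `R s' ≫ T` records the whole left preorder.
  have hcomp : ∀ {c d : C} {y : a ⟶ c} {z : a ⟶ d}, IsIndec z → LeftGE z y →
      IsSummand z (y ≫ T c d) := by
    intro c d y z hz h
    obtain ⟨g, hg⟩ := (leftGE_iff z y).mp h
    obtain ⟨_, rfl, h'⟩ := (hfin d).isSummand_of_addClosure (S := fun g => g = y ≫ T c d) hz
      (AddClosure.map (precomp d y) (S := fun g => g = T c d)
        (fun g hg => AddClosure.of _ (by rw [hg]; rfl)) (hT c d g)) hg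
    exact h'
  let I := Σ c, Fin (n c)
  let R : (s : I) → (a ⟶ s.1) := fun s => r s.1 s.2
  have hR : ∀ s, IsIndec (R s) := fun s => hr s.1 s.2
  have hexp : ∀ {c d : C} (F : (a ⟶ c) ⥤ (a ⟶ d)) [F.Additive] (s : Fin (n d)) (Y : a ⟶ c),
      mult k (r d s) (F.obj Y) = ∑ t, mult k (r c t) Y * mult k (r d s) (F.obj (r c t)) := by
    intro c d F _ s Y
    exact (hfin c).additive_eq_sum (hr c) (hne c) (fun Y => mult k (r d s) (F.obj Y))
      (fun X Y b hb => (hfin d).mult_sum (hr d s) (F.mapBinaryBicone b)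
        (map_bicone_isBilimit F b hb).some) Y (fun Z hZ _ => hrep c Z hZ)
  -- choose a maximal left cell above `x`
  obtain ⟨tx, ⟨ex⟩⟩ := hrep d x hx
  obtain ⟨s₀, hs₀, hmax⟩ := exists_maximal_above (fun s t : I => LeftGE (R s) (R t))
    (fun _ _ _ h h' => h.trans h') (fun s => LeftGE.refl _) ⟨d, tx⟩
  have hs₀x : LeftGE (R s₀) x := hs₀.trans (LeftGE.of_isSummand (IsSummand.of_iso ex.symm))
  by_contra hfx
  have hfs₀ : ¬ LeftGE f (R s₀) := fun h => hfx (h.trans hs₀x)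
  -- By the choice of `s₀` this upward closed set is a single left equivalence class, so the matrix
  -- restricted to it has only positive entries.
  let Λ : Set I := {s | LeftGE (R s) (R s₀)}
  let A : Λ → Λ → ℝ := fun s s' => mult k (R s) (R s' ≫ T s'.1.1 s.1.1)
  have hA : ∀ s s', 0 < A s s' := by
    rintro ⟨s, hs⟩ ⟨s', hs'⟩
    exact (hfin s.1).mult_pos (hR s) (hcomp (hR s) (hs.trans (hmax s' hs')))
  have : Nonempty Λ := ⟨⟨s₀, LeftGE.refl _⟩⟩
  obtain ⟨lam, p, hp, hAp⟩ := exists_pos_eigenvector A hA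
  -- The columns of the full matrix indexed by `Λ` vanish outside `Λ`, because `Λ` is upward closed.
  -- Extension by zero therefore keeps `p` an eigenvector.
  let q : I → ℝ := fun s => if h : s ∈ Λ then p ⟨s, h⟩ else 0
  have hq0 : ∀ s, 0 ≤ q s := fun s => by
    by_cases h : s ∈ Λ
    · simp only [q, h, dif_pos]; exact (hp _).le
    · simp [q, h]
  have hsumΛ : ∀ g : I → ℝ, ∑ s : Λ, g s = ∑ s, if s ∈ Λ then g s else 0 := by
    intro g
    rw [← Finset.sum_filter]
    exact (Finset.sum_subtype (Finset.univ.filter (· ∈ Λ)) (by simp) g).symm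
  have hq : ∀ s, ∑ s', mult k (R s) (R s' ≫ T s'.1 s.1) * q s' = lam * q s := by
    intro s
    by_cases hs : s ∈ Λ
    · have h1 := hAp ⟨s, hs⟩
      have h2 : q s = p ⟨s, hs⟩ := by simp [q, hs]
      rw [h2, ← h1]
      have h3 := hsumΛ (fun s' => mult k (R s) (R s' ≫ T s'.1 s.1) * q s')
      have h4 : ∀ s', (if s' ∈ Λ then mult k (R s) (R s' ≫ T s'.1 s.1) * q s' else 0) =
          mult k (R s) (R s' ≫ T s'.1 s.1) * q s' := by
        intro s'
        by_cases h : s' ∈ Λ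
        · simp [h]
        · simp [h, q]
      simp only [h4] at h3
      rw [← h3]
      refine Finset.sum_congr rfl fun s' _ => ?_
      simp [q, A]
    · have h2 : q s = 0 := by simp [q, hs]
      rw [h2, mul_zero]
      refine Finset.sum_eq_zero fun s' _ => ?_
      by_cases hs' : s' ∈ Λ
      · rw [(hfin s.1).mult_eq_zero (hR s), zero_mul]
        intro h
        exact hs (LeftGE.trans ⟨_, _, _, h⟩ hs')
      · simp [q, hs']
  -- transport the eigenvector by right multiplication
  obtain ⟨k₂, k₁, hk⟩ := hJ _ (R s₀) (hR s₀) (hs₀x.trans hxf)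
  obtain ⟨x', hx', hx's, hfx'⟩ :=
    (hfin b).exists_indec_of_map (hfin b) (precomp b k₂) hf hk
  obtain ⟨t₁, ⟨e₁⟩⟩ := hrep b x' hx'
  obtain ⟨tf, ⟨ef⟩⟩ := hrep b f hf
  have ht₁ : (⟨b, t₁⟩ : I) ∈ Λ :=
    (LeftGE.of_isSummand (IsSummand.of_iso e₁.symm)).trans ⟨_, _, _, hx's⟩
  have htf : (⟨b, tf⟩ : I) ∉ Λ := fun h =>
    hfs₀ ((LeftGE.of_isSummand (IsSummand.of_iso ef)).trans h)
  -- This is the multiplicity vector of `k₂` precomposed to the formal combination with coefficients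
  -- `q`. Precomposition commutes with composing with `T` by associativity, so `y` has the same
  -- eigenvalue; its entry at `f` is positive although `f` lies outside `Λ`.
  let y : I → ℝ := fun s => ∑ t, q ⟨s.1, t⟩ * mult k (R s) (k₂ ≫ r s.1 t)
  have hy0 : ∀ s, 0 ≤ y s := fun s =>
    Finset.sum_nonneg fun t _ => mul_nonneg (hq0 _) (mult_nonneg _ _)
  have hyf : 0 < y ⟨b, tf⟩ := by
    refine Finset.sum_pos' (fun t _ => mul_nonneg (hq0 _) (mult_nonneg _ _))
      ⟨t₁, Finset.mem_univ _, mul_pos ?_ ?_⟩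
    · simp only [q, ht₁, dif_pos]
      exact hp _
    · exact (hfin b).mult_pos (hr b tf) ((IsSummand.of_iso ef.symm).trans
        (hfx'.trans ((IsSummand.of_iso e₁).map (precomp b k₂))))
  have hy : ∀ s, ∑ s', mult k (R s) (R s' ≫ T s'.1 s.1) * y s' = lam * y s := by
    rintro ⟨c, t⟩
    have h1 : ∀ s' : I, mult k (r c t) (R s' ≫ T s'.1 c) * y s' = ∑ t'' : Fin (n s'.1),
        q ⟨s'.1, t''⟩ * (mult k (r s'.1 s'.2) (k₂ ≫ r s'.1 t'') *
          mult k (r c t) (r s'.1 s'.2 ≫ T s'.1 c)) := by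
      intro s'
      simp only [y, Finset.mul_sum]
      exact Finset.sum_congr rfl fun t'' _ => by simp only [R]; ring
    have h2 : ∀ (c' : C) (t'' : Fin (n c')), ∑ t' : Fin (n c'),
        mult k (r c' t') (k₂ ≫ r c' t'') * mult k (r c t) (r c' t' ≫ T c' c) =
        ∑ t₃ : Fin (n c), mult k (r c t₃) (r c' t'' ≫ T c' c) * mult k (r c t) (k₂ ≫ r c t₃) := by
      intro c' t''
      have e1 := hexp (postcomp a (T c' c)) t (k₂ ≫ r c' t'')
      have e2 := hexp (precomp c k₂) t (r c' t'' ≫ T c' c)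
      have e3 := (hfin c).mult_iso (k := k) (hr c t) (α_ k₂ (r c' t'') (T c' c))
      exact e1.symm.trans (e3.trans e2)
    calc ∑ s', mult k (R ⟨c, t⟩) (R s' ≫ T s'.1 c) * y s'
        = ∑ c', ∑ t', ∑ t'', q ⟨c', t''⟩ * (mult k (r c' t') (k₂ ≫ r c' t'') *
          mult k (r c t) (r c' t' ≫ T c' c)) := by
          rw [Fintype.sum_sigma]
          exact Finset.sum_congr rfl fun c' _ => Finset.sum_congr rfl fun t' _ => h1 ⟨c', t'⟩
      _ = ∑ c', ∑ t'', q ⟨c', t''⟩ * ∑ t₃, mult k (r c t₃) (r c' t'' ≫ T c' c) *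
            mult k (r c t) (k₂ ≫ r c t₃) := by
          refine Finset.sum_congr rfl fun c' _ => ?_
          rw [Finset.sum_comm]
          refine Finset.sum_congr rfl fun t'' _ => ?_
          rw [← h2, Finset.mul_sum]
      _ = ∑ t₃, (∑ s' : I, mult k (r c t₃) (R s' ≫ T s'.1 c) * q s') *
            mult k (r c t) (k₂ ≫ r c t₃) := by
          symm
          simp only [Finset.sum_mul, Finset.mul_sum]
          rw [Finset.sum_comm, Fintype.sum_sigma]
          refine Finset.sum_congr rfl fun c' _ => Finset.sum_congr rfl fun t'' _ =>
            Finset.sum_congr rfl fun t₃ _ => ?_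
          simp only [R]
          ring
      _ = lam * y ⟨c, t⟩ := by
          simp only [y, Finset.mul_sum]
          refine Finset.sum_congr rfl fun t₃ _ => ?_
          have := hq ⟨c, t₃⟩
          simp only [R] at this ⊢
          rw [this]
          ring
  -- compare on the maximal cell
  have hsub : ∀ s : Λ, ∑ s' : Λ, A s s' * y s' + mult k (R s) (f ≫ T b s.1.1) * y ⟨b, tf⟩
      ≤ lam * y s := by
    rintro ⟨s, hs⟩
    have h1 := hsumΛ (fun s' => mult k (R s) (R s' ≫ T s'.1 s.1) * y s')
    rw [← hy s]
    have h2 : ∑ s' : Λ, A ⟨s, hs⟩ s' * y s' =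
      ∑ s' : Λ, mult k (R s) (R s' ≫ T s'.1.1 s.1) * y s' := rfl
    have h5 : mult k (R s) (f ≫ T b s.1) = mult k (R s) (R ⟨b, tf⟩ ≫ T b s.1) :=
      (hfin s.1).mult_iso (hR s) ((postcomp a (T b s.1)).mapIso ef)
    rw [h2, h1, h5, ← Finset.sum_filter]
    have h3 : (⟨b, tf⟩ : I) ∉ Finset.univ.filter (· ∈ Λ) := by simpa using htf
    have h4 := Finset.sum_insert (f := fun s' => mult k (R s) (R s' ≫ T s'.1 s.1) * y s') h3
    rw [add_comm]
    refine h4.symm.le.trans (Finset.sum_le_univ_sum_of_nonneg fun s' =>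
      mul_nonneg (mult_nonneg _ _) (hy0 _))
  -- The column of `f` contributes strictly at `s₀`, since `R s₀` is above `f`. But `y` restricted
  -- to `Λ` is subinvariant, hence exactly invariant, which leaves no room for this contribution.
  have hpos : 0 < mult k (R s₀) (f ≫ T b s₀.1) * y ⟨b, tf⟩ :=
    mul_pos ((hfin _).mult_pos (hR s₀) (hcomp (hR s₀) (hs₀x.trans hxf))) hyf
  have hle := hsub ⟨s₀, LeftGE.refl _⟩
  have heq := eq_of_subinvariant A hA hp hAp (y := fun s => y s) (fun s =>
    (le_add_of_nonneg_right (mul_nonneg (mult_nonneg _ _) (hy0 _))).trans (hsub s))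
    ⟨s₀, LeftGE.refl _⟩
  simp only at heq
  rw [heq] at hle
  exact absurd hpos (not_lt.mpr (by linarith))

end Regularity

/-- This criterion speaks of retracts only, so it passes through the contravariant functor `⋆`,
whose additivity is not part of the data. If one term of a decomposition is isomorphic to the whole,
the dimension count forces the other to be zero. -/
theorem IsFin.isIndec_iff_summand {k : Type uk} [Field k] {D : Type u} [Category.{v} D]
    [Preadditive D] [Linear k D] (hD : IsFin k D) (X : D) :
    IsIndec X ↔ ¬ IsZero X ∧ ∀ Y, IsSummand Y X → IsZero Y ∨ Nonempty (Y ≅ X) := by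
  refine ⟨fun h => ⟨h.1, fun Y hY => ?_⟩, fun h => ⟨h.1, fun Y Z b hb e => ?_⟩⟩
  · by_cases h0 : IsZero Y
    · exact Or.inl h0
    · exact Or.inr (hD.iso_of_isSummand h0 h hY)
  · obtain ⟨e⟩ := e
    by_contra! hne
    rcases h.2 Y ((IsSummand.inl b).trans (IsSummand.of_iso e)) with h0 | ⟨⟨e'⟩⟩
    · exact hne.1 h0
    · have h1 := hD.finrank_add_le b
      have h2 := hD.finrank_pos hne.2
      have h3 := (Linear.homCongr k (e' ≪≫ e.symm) (e' ≪≫ e.symm)).finrank_eq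
      omega

theorem IsZero.isSummand {D : Type u} [Category.{v} D] [HasZeroMorphisms D] {X : D} (h : IsZero X)
    (Y : D) : IsSummand X Y :=
  ⟨⟨0, 0, h.eq_of_src _ _⟩⟩

/-! ### The involution and the adjunctions. -/

section Star

variable {C : Type u} [Bicategory.{w, v} C] (S : WeakInvolution C)

theorem WeakInvolution.on_isSummand {a b : C} {f g : a ⟶ b} (h : IsSummand f g) :
    IsSummand (S.on f) (S.on g) :=
  ⟨h.some.op.map (S.star a b)⟩

/-- The involution is involutive on 1-morphisms. -/
def WeakInvolution.onOn {a b : C} (f : a ⟶ b) : S.on (S.on f) ≅ f :=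
  ((S.invol a b).app f).symm

theorem WeakInvolution.on_comp_summand {a b c : C} {x : a ⟶ c} {f : a ⟶ b} {g : b ⟶ c}
    (h : IsSummand x (f ≫ g)) : IsSummand (S.on x) (S.on g ≫ S.on f) :=
  (S.on_isSummand h).trans (IsSummand.of_iso (S.starComp f g))

variable [PreadditiveBicategory C]

variable {k : Type uk} [Field k] [LinearBicategory k C] {S}

/-- Zero objects are retracts of everything, in particular `f` is one of `S.on O`; applying `⋆`
exhibits `S.on f` as a retract of the zero object `O`. -/
theorem IsFiat.on_isZero (hC : IsFiat k S) {a b : C} {f : a ⟶ b} (h : IsZero f) :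
    IsZero (S.on f) := by
  obtain ⟨O, hO⟩ := (hC.finitary.isFin b a).hasZero
  exact IsZero.of_isSummand hO
    ((S.on_isSummand (IsZero.isSummand h (S.on O))).trans (IsSummand.of_iso (S.onOn O)))

theorem IsFiat.on_isIndec (hC : IsFiat k S) {a b : C} {f : a ⟶ b} (h : IsIndec f) :
    IsIndec (S.on f) := by
  rw [(hC.finitary.isFin _ _).isIndec_iff_summand] at h ⊢
  refine ⟨fun h0 => h.1 ((hC.on_isZero h0).of_iso (S.onOn f).symm), fun y hy => ?_⟩
  rcases h.2 (S.on y) ((S.on_isSummand hy).trans (IsSummand.of_iso (S.onOn f))) with h0 | ⟨⟨e⟩⟩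
  · exact Or.inl ((hC.on_isZero h0).of_iso (S.onOn y).symm)
  · exact Or.inr ⟨(S.onOn y).symm ≪≫ ((S.star a b).mapIso e.op).symm⟩

/-- Every 1-morphism `f` is a direct summand of `f f⋆ f`. -/
theorem IsFiat.isSummand_triple (hC : IsFiat k S) {a b : C} (f : a ⟶ b) :
    IsSummand f (f ≫ S.on f ≫ f) := by
  obtain ⟨adj⟩ := hC.adj f
  refine ⟨⟨(λ_ f).inv ≫ adj.unit ▷ f ≫ (α_ _ _ _).hom, f ◁ adj.counit ≫ (ρ_ f).hom, ?_⟩⟩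
  have := adj.left_triangle
  simp only [leftZigzag, bicategoricalComp, BicategoricalCoherence.iso] at this
  simp at this
  simp [reassoc_of% this]

theorem IsFiat.twoSidedGE_on (hC : IsFiat k S) {a b : C} (f : a ⟶ b) : TwoSidedGE f (S.on f) :=
  TwoSidedGE.of_comp (hC.isSummand_triple f)

theorem IsFiat.on_twoSidedGE (hC : IsFiat k S) {a b : C} (f : a ⟶ b) : TwoSidedGE (S.on f) f :=
  (hC.twoSidedGE_on (S.on f)).trans
    (LeftGE.of_isSummand (IsSummand.of_iso (S.onOn f))).twoSidedGE

end Star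

/-! ### Left cells in the maximal two-sided cell and the intersection of a left cell with its dual.
-/

section Cells

variable {k : Type uk} [Field k] {C : Type u} [Bicategory.{w, v} C] [PreadditiveBicategory C]

theorem IsTwoSidedCell.isIndec {J : OneMorClass C} (hJ : IsTwoSidedCell J) {a b : C} {f : a ⟶ b}
    (hf : f ∈ J a b) : IsIndec f := by
  obtain ⟨_, _, f₀, -, h⟩ := hJ
  exact ((h _ _ _).mp hf).1

theorem IsTwoSidedCell.twoSidedGE {J : OneMorClass C} (hJ : IsTwoSidedCell J) {a b c d : C}
    {f : a ⟶ b} {g : c ⟶ d} (hf : f ∈ J a b) (hg : g ∈ J c d) : TwoSidedGE f g := by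
  obtain ⟨_, _, f₀, -, h⟩ := hJ
  exact ((h _ _ _).mp hf).2.1.trans ((h _ _ _).mp hg).2.2

theorem isTwoSidedCell_of_isIndec {a b : C} {f : a ⟶ b} (hf : IsIndec f) :
    IsTwoSidedCell (fun c d => {g : c ⟶ d | IsIndec g ∧ TwoSidedGE g f ∧ TwoSidedGE f g}) :=
  ⟨a, b, f, hf, fun _ _ _ => Iff.rfl⟩

theorem IsLeftCell.isIndec {L : OneMorClass C} (hL : IsLeftCell L) {a b : C} {f : a ⟶ b}
    (hf : f ∈ L a b) : IsIndec f := by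
  obtain ⟨_, _, f₀, -, h⟩ := hL
  exact ((h _ _ _).mp hf).1

theorem IsLeftCell.leftGE {L : OneMorClass C} (hL : IsLeftCell L) {a b c d : C}
    {f : a ⟶ b} {g : c ⟶ d} (hf : f ∈ L a b) (hg : g ∈ L c d) : LeftGE f g := by
  obtain ⟨_, _, f₀, -, h⟩ := hL
  exact ((h _ _ _).mp hf).2.1.trans ((h _ _ _).mp hg).2.2

theorem IsLeftCell.mem {L : OneMorClass C} (hL : IsLeftCell L) {a b c d : C}
    {f : a ⟶ b} {g : c ⟶ d} (hf : f ∈ L a b) (hg : IsIndec g) (h : LeftGE g f)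
    (h' : LeftGE f g) : g ∈ L c d := by
  obtain ⟨_, _, f₀, -, hL⟩ := hL
  have := (hL _ _ _).mp hf
  exact (hL _ _ _).mpr ⟨hg, h.trans this.2.1, this.2.2.trans h'⟩

theorem IsUniqueMaximalCell.isTwoSidedCell {p : OneMorClass C → Prop} {J : OneMorClass C}
    (hJ : IsUniqueMaximalCell p J) : IsTwoSidedCell J :=
  ((hJ J).mp rfl).1.1

/-- The two-sided cell of `g` lies above `J`, so it equals `J` by maximality. -/
theorem IsUniqueMaximalCell.mem {J : OneMorClass C}
    (hJ : IsUniqueMaximalCell (fun _ => True) J) {a b c d : C} {f : a ⟶ b} {g : c ⟶ d}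
    (hf : f ∈ J a b) (hg : IsIndec g) (h : TwoSidedGE g f) : g ∈ J c d := by
  have := ((hJ J).mp rfl).2 _ (isTwoSidedCell_of_isIndec hg) trivial
    (fun _ _ _ _ f' g' hf' hg' => hg'.2.1.trans (h.trans (hJ.isTwoSidedCell.twoSidedGE hf hf')))
  rw [← this]
  exact ⟨hg, TwoSidedGE.refl g, TwoSidedGE.refl g⟩

variable [LinearBicategory k C] {S : WeakInvolution C}

/-- Left cells in a maximal two-sided cell are incomparable. -/
theorem IsFiat.leftGE_symm (hC : IsFiat k S) {J : OneMorClass C}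
    (hJ : IsUniqueMaximalCell (fun _ => True) J) {a b c d : C} {f : a ⟶ b} {x : c ⟶ d}
    (hf : f ∈ J a b) (hx : IsIndec x) (h : LeftGE x f) : LeftGE f x := by
  obtain rfl := h.source_eq
  exact leftGE_of_leftGE hC.finitary (hJ.isTwoSidedCell.isIndec hf)
    (fun _ y hy hyf => hJ.isTwoSidedCell.twoSidedGE hf (hJ.mem hf hy hyf.twoSidedGE)) hx h

theorem IsFiat.on_mem (hC : IsFiat k S) {J : OneMorClass C}
    (hJ : IsUniqueMaximalCell (fun _ => True) J) {a b : C} {f : a ⟶ b} (hf : f ∈ J a b) :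
    S.on f ∈ J b a :=
  hJ.mem hf (hC.on_isIndec (hJ.isTwoSidedCell.isIndec hf)) (hC.on_twoSidedGE f)

/-- The data of a left cell in the maximal two-sided cell of a fiat 2-category. -/
structure MaximalLeftCell (k : Type uk) [Field k] {C : Type u} [Bicategory.{w, v} C]
    [PreadditiveBicategory C] [LinearBicategory k C] (S : WeakInvolution C)
    (J L : OneMorClass C) (i : C) : Prop where
  fiat : IsFiat k S
  maximal : IsUniqueMaximalCell (fun _ => True) J
  leftCell : IsLeftCell L
  le : ∀ (a b : C) (f : a ⟶ b), f ∈ L a b → f ∈ J a b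
  source : ∀ (a b : C) (f : a ⟶ b), f ∈ L a b → a = i

namespace MaximalLeftCell

variable {J L : OneMorClass C} {i : C} (h : MaximalLeftCell k S J L i)

include h

/-- Symmetry of the left preorder makes `L` upward closed; the next lemma is its downward
counterpart inside `J`. -/
theorem mem_of_leftGE {a b c d : C} {f : a ⟶ b} {x : c ⟶ d} (hf : f ∈ L a b) (hx : IsIndec x)
    (hxf : LeftGE x f) : x ∈ L c d :=
  h.leftCell.mem hf hx hxf (h.fiat.leftGE_symm h.maximal (h.le _ _ _ hf) hx hxf)

theorem mem_of_leftGE' {a b c d : C} {f : a ⟶ b} {x : c ⟶ d} (hf : f ∈ L a b) (hx : x ∈ J c d)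
    (hxf : LeftGE f x) : x ∈ L c d :=
  h.mem_of_leftGE hf (h.maximal.isTwoSidedCell.isIndec hx)
    (h.fiat.leftGE_symm h.maximal hx (h.leftCell.isIndec hf) hxf)

/-- Since `⋆` is involutive, `g` in the definition can be taken to be `S.on f`. In this form
membership is checked by two left comparisons. -/
theorem mem_diagonalHCell {f : i ⟶ i} :
    f ∈ diagonalHCell S L i ↔ f ∈ L i i ∧ S.on f ∈ L i i := by
  refine and_congr_right fun hf => ⟨?_, fun hf' => ⟨S.on f, hf', ⟨(S.onOn f).symm⟩⟩⟩
  rintro ⟨g, hg, ⟨e⟩⟩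
  have e' : S.on f ≅ g := ((S.star i i).mapIso e.op).symm ≪≫ S.onOn g
  exact h.mem_of_leftGE hg (h.fiat.on_isIndec (h.leftCell.isIndec hf))
    (LeftGE.of_isSummand (IsSummand.of_iso e'))

theorem isIndec {f : i ⟶ i} (hf : f ∈ diagonalHCell S L i) : IsIndec f :=
  h.leftCell.isIndec hf.1

theorem on_mem_diagonalHCell {f : i ⟶ i} (hf : f ∈ diagonalHCell S L i) :
    S.on f ∈ diagonalHCell S L i := by
  rw [h.mem_diagonalHCell] at hf ⊢
  exact ⟨hf.2, h.mem_of_leftGE hf.1 (h.fiat.on_isIndec (h.fiat.on_isIndec (h.leftCell.isIndec hf.1)))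
    (LeftGE.of_isSummand (IsSummand.of_iso (S.onOn f)))⟩

/-- The first factor `f` puts `x` above `f`; after applying `⋆` the last factor puts `S.on x` above
`S.on g`. That `K` is an arbitrary 1-morphism of `C` is what later carries transitivity over to the
2-subcategory. -/
theorem mem_of_isSummand {f g K x : i ⟶ i} (hf : f ∈ diagonalHCell S L i)
    (hg : g ∈ diagonalHCell S L i) (hx : IsIndec x) (hs : IsSummand x (f ≫ K ≫ g)) :
    x ∈ diagonalHCell S L i := by
  rw [h.mem_diagonalHCell] at hf hg ⊢
  refine ⟨h.mem_of_leftGE hf.1 hx ⟨_, _, _, hs⟩, ?_⟩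
  refine h.mem_of_leftGE hg.2 (h.fiat.on_isIndec hx) ⟨_, _, S.on K ≫ S.on f, ?_⟩
  have hs' : IsSummand x ((f ≫ K) ≫ g) := hs.trans (IsSummand.of_iso (α_ f K g).symm)
  exact (S.on_comp_summand hs').trans
    ((IsSummand.refl _).comp (IsSummand.of_iso (S.starComp f K)))

theorem mem_of_isSummand_comp {f g x : i ⟶ i} (hf : f ∈ diagonalHCell S L i)
    (hg : g ∈ diagonalHCell S L i) (hx : IsIndec x) (hs : IsSummand x (f ≫ g)) :
    x ∈ diagonalHCell S L i :=
  h.mem_of_isSummand hf hg (K := 𝟙 i) hx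
    (hs.trans ((IsSummand.refl f).comp (IsSummand.of_iso (λ_ g).symm)))

theorem mem_of_iso {f g : i ⟶ i} (hf : f ∈ diagonalHCell S L i) (e : f ≅ g) :
    g ∈ diagonalHCell S L i := by
  have hg := (h.isIndec hf).of_iso e
  rw [h.mem_diagonalHCell] at hf ⊢
  exact ⟨h.mem_of_leftGE hf.1 hg (LeftGE.of_isSummand (IsSummand.of_iso e.symm)),
    h.mem_of_leftGE hf.2 (h.fiat.on_isIndec hg)
      (LeftGE.of_isSummand (S.on_isSummand (IsSummand.of_iso e.symm)))⟩

/-- For `f` in `L`, the composite `f ≫ S.on f` is an endomorphism of `i`, nonzero because `f` is a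
summand of `f ≫ S.on f ≫ f`, and isomorphic to its own dual. Its indecomposable summands and their
duals are thus above `f`. -/
theorem diagonalHCell_nonempty : (diagonalHCell S L i).Nonempty := by
  have hL := h.leftCell
  obtain ⟨a, b, f, hfi, hL⟩ := hL
  have hf : f ∈ L a b := (hL _ _ _).mpr ⟨hfi, LeftGE.refl f, LeftGE.refl f⟩
  obtain rfl := h.source _ _ _ hf
  obtain ⟨x, _, hx, -, hxs, -, -⟩ := h.fiat.finitary.exists_indec_comp hfi
    ((h.fiat.isSummand_triple f).trans (IsSummand.of_iso (α_ _ _ _).symm))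
  refine ⟨x, h.mem_diagonalHCell.mpr ⟨h.mem_of_leftGE hf hx ⟨_, _, _, hxs⟩,
    h.mem_of_leftGE hf (h.fiat.on_isIndec hx) ⟨_, _, S.on f, ?_⟩⟩⟩
  exact (S.on_comp_summand hxs).trans
    ((IsSummand.of_iso (S.onOn f)).comp (IsSummand.refl _))

/-- Left equivalence gives `f` as a summand of `g ≫ K`, with no control over `K`. Replacing `g` by
`g ≫ S.on g ≫ g` turns the right factor into `S.on g ≫ g ≫ K`, whose summands lie in `L`; dualising
the relation shows that the relevant one also has its dual in `L`. -/
theorem exists_isSummand_comp {f g : i ⟶ i} (hf : f ∈ diagonalHCell S L i)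
    (hg : g ∈ diagonalHCell S L i) :
    ∃ y ∈ diagonalHCell S L i, IsSummand f (g ≫ y) := by
  have hfi := h.isIndec hf
  rw [h.mem_diagonalHCell] at hf hg
  obtain ⟨K, hK⟩ := (leftGE_iff f g).mp (h.leftCell.leftGE hf.1 hg.1)
  have hs : IsSummand f (g ≫ (S.on g ≫ g) ≫ K) :=
    (hK.trans ((h.fiat.isSummand_triple g).comp (IsSummand.refl K))).trans
      (IsSummand.of_iso (α_ _ _ _))
  obtain ⟨y, hy, hys, hfy⟩ := (h.fiat.finitary.isFin i i).exists_indec_of_map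
    (h.fiat.finitary.isFin i i) (precomp i g) hfi hs
  have hyL : y ∈ L i i := h.mem_of_leftGE hg.2 hy
    ⟨_, _, g ≫ K, hys.trans (IsSummand.of_iso (α_ _ _ _))⟩
  refine ⟨y, h.mem_diagonalHCell.mpr ⟨hyL, ?_⟩, hfy⟩
  exact h.mem_of_leftGE' hf.2 (h.fiat.on_mem h.maximal (h.le _ _ _ hyL))
    ⟨_, _, S.on g, S.on_comp_summand hfy⟩

end MaximalLeftCell

end Cells

section Multiplicity

variable {k : Type uk} [Field k] {D : Type u} [Category.{v} D] [Preadditive D] [Linear k D]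

theorem IsFin.isSummand_of_bicone (hD : IsFin k D) {X : D} (hX : IsIndec X) {n : ℕ} {f : Fin n → D}
    {b : Bicone f} (hb : b.IsBilimit) (h : IsSummand X b.pt) : ∃ j, IsSummand X (f j) := by
  obtain ⟨h⟩ := h
  have : IsIso (∑ j, (h.i ≫ b.π j) ≫ (b.ι j ≫ h.r)) := by
    have e : ∑ j, (h.i ≫ b.π j) ≫ (b.ι j ≫ h.r) = h.i ≫ (∑ j, b.π j ≫ b.ι j) ≫ h.r := by
      simp [Preadditive.comp_sum, Preadditive.sum_comp]
    rw [e, IsBilimit.total hb, Category.id_comp, h.retract]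
    infer_instance
  obtain ⟨j, -, hj⟩ := hD.isIso_of_sum hX _ _ this
  exact ⟨j, IsSummand.of_comp _ _ hj⟩

end Multiplicity

/-! ### The indecomposable 1-morphisms generated by `H`. -/

section Generated

variable {k : Type uk} [Field k] {C : Type u} [Bicategory.{w, v} C] [PreadditiveBicategory C]
  [LinearBicategory k C] {S : WeakInvolution C} {J L : OneMorClass C} {i : C}

theorem IsMultiplicityFreeSum.isSummand {H : Set (i ⟶ i)} {F : i ⟶ i}
    (hF : IsMultiplicityFreeSum H F) {f : i ⟶ i} (hf : f ∈ H) : IsSummand f F := by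
  obtain ⟨n, g, -, -, hg, b, -, ⟨e⟩⟩ := hF
  obtain ⟨t, ⟨e'⟩⟩ := hg f hf
  exact (IsSummand.of_iso e').trans
    (IsSummand.trans ⟨⟨b.ι t, b.π t, bicone_ι_π_self b t⟩⟩ (IsSummand.of_iso e))

namespace MaximalLeftCell

variable (h : MaximalLeftCell k S J L i)

include h

theorem exists_isMultiplicityFreeSum :
    ∃ F : i ⟶ i, IsMultiplicityFreeSum (diagonalHCell S L i) F := by
  have hfin := h.fiat.finitary.isFin i i
  obtain ⟨n, r, hr, hne, hrep⟩ := hfin.exists_representatives (· ∈ diagonalHCell S L i)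
    (fun _ hf => h.isIndec hf)
  have := hfin.hasZero
  have := hfin.hasBiprod
  have : HasFiniteProducts (i ⟶ i) := hasFiniteProducts_of_has_binary_and_terminal
  have : HasFiniteBiproducts (i ⟶ i) := HasFiniteBiproducts.of_hasFiniteProducts
  exact ⟨_, n, r, hr, hne, hrep, biproduct.bicone r, ⟨biproduct.isBilimit r⟩, ⟨Iso.refl _⟩⟩

theorem mem_of_isMultiplicityFreeSum {F : i ⟶ i}
    (hF : IsMultiplicityFreeSum (diagonalHCell S L i) F) {x : i ⟶ i} (hx : IsIndec x)
    (hs : IsSummand x F) : x ∈ diagonalHCell S L i := by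
  obtain ⟨n, g, hg, -, -, b, ⟨hb⟩, ⟨e⟩⟩ := hF
  have hfin := h.fiat.finitary.isFin i i
  obtain ⟨t, ht⟩ := hfin.isSummand_of_bicone hx hb (hs.trans (IsSummand.of_iso e.symm))
  obtain ⟨e'⟩ := hfin.iso_of_isSummand hx.1 (h.isIndec (hg t)) ht
  exact h.mem_of_iso (hg t) e'.symm

/-- The indecomposable 1-morphisms generated by `H` and the identity are those in `H` and the
identity. -/
theorem iso_id_or_mem {f : i ⟶ i} (hf : EndoClass.Generated (diagonalHCell S L i) f) {x : i ⟶ i}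
    (hx : IsIndec x) (hs : IsSummand x f) :
    Nonempty (x ≅ 𝟙 i) ∨ x ∈ diagonalHCell S L i := by
  have hfin := h.fiat.finitary.isFin i i
  induction hf generalizing x with
  | of f hf =>
    obtain ⟨e⟩ := hfin.iso_of_isSummand hx.1 (h.isIndec hf) hs
    exact Or.inr (h.mem_of_iso hf e.symm)
  | id => exact Or.inl (hfin.iso_of_isSummand hx.1 (h.fiat.finitary.indec_id i) hs)
  | comp f g _ _ ihf ihg =>
    obtain ⟨f', g', hf', hg', hfs, hgs, hxs⟩ := h.fiat.finitary.exists_indec_comp hx hs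
    rcases ihf hf' hfs with ⟨⟨e⟩⟩ | hfm
    · exact ihg hx (hxs.trans ((((IsSummand.of_iso e).comp hgs)).trans
        (IsSummand.of_iso (λ_ g))))
    · rcases ihg hg' hgs with ⟨⟨e⟩⟩ | hgm
      · exact ihf hx (hxs.trans ((hfs.comp (IsSummand.of_iso e)).trans
          (IsSummand.of_iso (ρ_ f))))
      · exact Or.inr (h.mem_of_isSummand_comp hfm hgm hx hxs)
  | zero f hf => exact absurd (IsZero.of_isSummand hf hs) hx.1
  | sum f g b hb _ _ ihf ihg => exact (hfin.isSummand_or hx hb hs).elim (ihf hx) (ihg hx)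
  | summand f g hfg _ ih => exact ih hx (hs.trans hfg)

theorem mem_of_comp_generated {f K x : i ⟶ i} (hf : f ∈ diagonalHCell S L i)
    (hK : EndoClass.Generated (diagonalHCell S L i) K) (hx : IsIndec x)
    (hs : IsSummand x (f ≫ K)) : x ∈ diagonalHCell S L i := by
  have hfin := h.fiat.finitary.isFin i i
  obtain ⟨K', hK', hKs, hxs⟩ := hfin.exists_indec_of_map hfin (precomp i f) hx hs
  rcases h.iso_id_or_mem hK hK' hKs with ⟨⟨e⟩⟩ | hm
  · obtain ⟨e'⟩ := hfin.iso_of_isSummand hx.1 (h.isIndec hf)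
      (hxs.trans (IsSummand.of_iso (whiskerLeftIso f e ≪≫ ρ_ f)))
    exact h.mem_of_iso hf e'.symm
  · exact h.mem_of_isSummand_comp hf hm hx hxs

theorem mem_of_generated_comp {f K x : i ⟶ i} (hf : f ∈ diagonalHCell S L i)
    (hK : EndoClass.Generated (diagonalHCell S L i) K) (hx : IsIndec x)
    (hs : IsSummand x (K ≫ f)) : x ∈ diagonalHCell S L i := by
  have hfin := h.fiat.finitary.isFin i i
  obtain ⟨K', hK', hKs, hxs⟩ := hfin.exists_indec_of_map hfin (postcomp i f) hx hs
  rcases h.iso_id_or_mem hK hK' hKs with ⟨⟨e⟩⟩ | hm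
  · obtain ⟨e'⟩ := hfin.iso_of_isSummand hx.1 (h.isIndec hf)
      (hxs.trans (IsSummand.of_iso (whiskerRightIso e f ≪≫ λ_ f)))
    exact h.mem_of_iso hf e'.symm
  · exact h.mem_of_isSummand_comp hm hf hx hxs

end MaximalLeftCell

end Generated

/-! ### Two-sided cells of the 2-subcategory and the apex condition. -/

section Apex

open EndoClass

theorem isSummand_subBicat_iff {C : Type u} [Bicategory.{w, v} C] {i : C} (A : EndoClass i) {x y : A.SubBicat} (f g : x ⟶ y) :
    IsSummand f g ↔ IsSummand (A.mor f) (A.mor g) :=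
  (isSummand_map_iff A.mem.ι f g).symm

variable {k : Type uk} [Field k] {C : Type u} [Bicategory.{w, v} C] [PreadditiveBicategory C]
  [LinearBicategory k C] {S : WeakInvolution C} {J L : OneMorClass C} {i : C}

theorem isIndec_generatedBy_iff (hfin : IsFin k (i ⟶ i)) (H : Set (i ⟶ i))
    {x y : (generatedBy H).SubBicat} (f : x ⟶ y) :
    IsIndec f ↔ IsIndec ((generatedBy H).mor f) := by
  have := hfin.idem
  have : IsIdempotentComplete (generatedBy H).mem.FullSubcategory :=
    isIdempotentComplete_fullSubcategory _ (fun X Y h hY => Generated.summand X Y h hY)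
  exact (isIndec_map_iff (generatedBy H).mem.ι f).symm

namespace MaximalLeftCell

variable (h : MaximalLeftCell k S J L i)

include h

theorem mem_of_twoSidedGE {x y x' y' : (generatedBy (diagonalHCell S L i)).SubBicat}
    {f : x ⟶ y} {g : x' ⟶ y'} (hf : (generatedBy (diagonalHCell S L i)).mor f ∈ diagonalHCell S L i)
    (hg : IsIndec g) (hgf : TwoSidedGE g f) :
    (generatedBy (diagonalHCell S L i)).mor g ∈ diagonalHCell S L i := by
  have hfin := h.fiat.finitary.isFin i i
  rw [isIndec_generatedBy_iff hfin] at hg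
  obtain ⟨h₂, h₁, hs⟩ := hgf
  rw [isSummand_subBicat_iff] at hs
  obtain ⟨z, hz, hzs, hgz⟩ := hfin.exists_indec_of_map hfin
    (precomp i ((generatedBy (diagonalHCell S L i)).mor h₂)) hg hs
  exact h.mem_of_generated_comp (h.mem_of_comp_generated hf h₁.property hz hzs) h₂.property hg hgz

theorem twoSidedGE_of_mem {x y x' y' : (generatedBy (diagonalHCell S L i)).SubBicat}
    {f : x ⟶ y} {g : x' ⟶ y'} (hf : (generatedBy (diagonalHCell S L i)).mor f ∈ diagonalHCell S L i)
    (hg : (generatedBy (diagonalHCell S L i)).mor g ∈ diagonalHCell S L i) : TwoSidedGE f g := by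
  obtain ⟨z, hz, hs⟩ := h.exists_isSummand_comp hf hg
  exact TwoSidedGE.of_comp_right (f := f) (g := g)
    (h := (⟨z, Generated.of z hz⟩ : y' ⟶ y)) ((isSummand_subBicat_iff _ _ _).mpr hs)

theorem isTwoSidedCell_oneMorClass :
    IsTwoSidedCell ((generatedBy (diagonalHCell S L i)).oneMorClass (diagonalHCell S L i)) := by
  obtain ⟨f₀, hf₀⟩ := h.diagonalHCell_nonempty
  have hfin := h.fiat.finitary.isFin i i
  let f : (⟨⟩ : (generatedBy (diagonalHCell S L i)).SubBicat) ⟶ ⟨⟩ := ⟨f₀, Generated.of f₀ hf₀⟩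
  refine ⟨⟨⟩, ⟨⟩, f, (isIndec_generatedBy_iff hfin _ f).mpr (h.isIndec hf₀), fun x y g => ?_⟩
  refine ⟨fun hg => ⟨(isIndec_generatedBy_iff hfin _ g).mpr (h.isIndec hg),
    h.twoSidedGE_of_mem hg hf₀, h.twoSidedGE_of_mem hf₀ hg⟩, fun hg => ?_⟩
  exact h.mem_of_twoSidedGE (f := f) hf₀ hg.1 hg.2.1

/-- An indecomposable of the 2-subcategory is the identity or lies in `H`, so `H` is a two-sided
cell above all others. It is the apex as soon as it qualifies at all. -/
theorem hasApex_iff (Q : TwoRep.{w, v, 0, v', u', uk} k (generatedBy (diagonalHCell S L i)).SubBicat) :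
    Q.HasApex ((generatedBy (diagonalHCell S L i)).oneMorClass (diagonalHCell S L i)) ↔
      ∀ (x y : (generatedBy (diagonalHCell S L i)).SubBicat) (f : x ⟶ y),
        (generatedBy (diagonalHCell S L i)).mor f ∈ diagonalHCell S L i → ¬ Q.Annihilates f := by
  refine ⟨fun hQ => ((hQ _).mp rfl).1.2, fun hQ J' => ⟨?_, fun hJ' => ?_⟩⟩
  · rintro rfl
    refine ⟨⟨h.isTwoSidedCell_oneMorClass, hQ⟩, fun J'' hJ'' _ hle => ?_⟩
    obtain ⟨f₀, hf₀⟩ := h.diagonalHCell_nonempty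
    let f : (⟨⟩ : (generatedBy (diagonalHCell S L i)).SubBicat) ⟶ ⟨⟩ := ⟨f₀, Generated.of f₀ hf₀⟩
    have hsub : ∀ (x y : (generatedBy (diagonalHCell S L i)).SubBicat) (g : x ⟶ y), g ∈ J'' x y →
        (generatedBy (diagonalHCell S L i)).mor g ∈ diagonalHCell S L i := fun x y g hg =>
      h.mem_of_twoSidedGE (f := f) hf₀ (hJ''.isIndec hg) (hle _ _ _ _ f g hf₀ hg)
    funext x y
    refine Set.ext fun g => ⟨fun hg => hsub x y g hg, fun hg => ?_⟩
    obtain ⟨x₁, y₁, g₁, hg₁, hJ₁⟩ := hJ''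
    have hm : g₁ ∈ J'' x₁ y₁ := (hJ₁ _ _ _).mpr ⟨hg₁, TwoSidedGE.refl _, TwoSidedGE.refl _⟩
    exact (hJ₁ _ _ _).mpr ⟨h.isTwoSidedCell_oneMorClass.isIndec hg,
      h.twoSidedGE_of_mem hg (hsub _ _ _ hm), h.twoSidedGE_of_mem (hsub _ _ _ hm) hg⟩
  · refine (hJ'.2 _ h.isTwoSidedCell_oneMorClass hQ ?_).symm
    intro x y x' y' f g hf hg
    have hfin := h.fiat.finitary.isFin i i
    rcases h.iso_id_or_mem f.property
      ((isIndec_generatedBy_iff hfin _ f).mp (hJ'.1.1.isIndec hf)) (IsSummand.refl _) with ⟨⟨e⟩⟩ | hm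
    · refine TwoSidedGE.of_comp_right (f := g) (g := f)
        (h := (⟨(generatedBy (diagonalHCell S L i)).mor g, g.property⟩ : y ⟶ y'))
        ((isSummand_subBicat_iff _ _ _).mpr (IsSummand.of_iso ?_))
      exact (λ_ _).symm ≪≫ whiskerRightIso e.symm _
    · exact h.twoSidedGE_of_mem hg hm

end MaximalLeftCell

end Apex

/-! ### Additively closed full subcategories of finitary categories. -/

section FullSubcategory

variable {k : Type uk} [Field k] {D : Type u} [Category.{v} D] [Preadditive D] [Linear k D]

theorem AddClosure.fullSubcategory {P : ObjectProperty D} (hzero : ∀ X, IsZero X → P X)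
    (hsum : ∀ (X Y : D) (b : BinaryBicone X Y), b.IsBilimit → P X → P Y → P b.pt)
    (hsummand : ∀ X Y, IsSummand X Y → P Y → P X)
    {T : P.FullSubcategory} {X : D} (h : AddClosure (fun Y => Y = T.obj) X) :
    ∃ hX : P X, AddClosure (fun Y => Y = T) (⟨X, hX⟩ : P.FullSubcategory) := by
  induction h with
  | of X h => exact ⟨h ▸ T.property, AddClosure.of _ (by cases h; rfl)⟩
  | zero X h => exact ⟨hzero X h, AddClosure.zero _ (isZero_fullSubcategory _ h)⟩
  | sum X Y b hb _ _ ihX ihY =>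
    obtain ⟨h1, h1'⟩ := ihX
    obtain ⟨h2, h2'⟩ := ihY
    have h3 := hsum X Y b hb h1 h2
    exact ⟨h3, AddClosure.sum _ _ (biconeFullSubcategory (X := ⟨X, h1⟩) (Y := ⟨Y, h2⟩) b h3)
      (biconeFullSubcategory_isBilimit _ _ hb).some h1' h2'⟩
  | summand X Y h _ ih =>
    obtain ⟨h1, h1'⟩ := ih
    have h2 := hsummand X Y h h1
    exact ⟨h2, AddClosure.summand _ _
      ((isSummand_map_iff P.ι (⟨X, h2⟩ : P.FullSubcategory) ⟨Y, h1⟩).mp h) h1'⟩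

/-- A full additively closed subcategory of a finitary category is finitary, provided that it
has an additive generator. -/
theorem IsFin.fullSubcategory (hD : IsFin k D) {P : ObjectProperty D}
    (hzero : ∀ X, IsZero X → P X)
    (hsum : ∀ (X Y : D) (b : BinaryBicone X Y), b.IsBilimit → P X → P Y → P b.pt)
    (hsummand : ∀ X Y, IsSummand X Y → P Y → P X)
    (hgen : ∃ T : P.FullSubcategory, ∀ X, AddClosure (fun Y => Y = T) X) :
    IsFin k P.FullSubcategory := by
  have := hD.idem
  have := hD.hasZero
  have := hD.hasBiprod
  refine ⟨fun X Y => ?_, isIdempotentComplete_fullSubcategory P hsummand,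
    hasZeroObject_fullSubcategory P hzero, hasBinaryBiproducts_fullSubcategory P hsum, hgen⟩
  have : Module.Finite k (P.ι.obj X ⟶ P.ι.obj Y) := hD.finite_hom X.obj Y.obj
  exact Module.Finite.of_injective (P.ι.mapLinearMap k (X := X) (Y := Y)) P.ι.map_injective

end FullSubcategory

/-! ### Actions on objects and the radical stable ideal. -/

section TwoReps

variable {k : Type uk} [Field k] {C : Type u} [Bicategory.{w, v} C]
    [PreadditiveBicategory C] [LinearBicategory k C]

namespace TwoRep

variable (M : TwoRep.{w, v, u, v', u', uk} k C)

/-- The action of the identity. -/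
def actId {a : C} (X : M.cat a) : (M.act (𝟙 a)).obj X ≅ X :=
  (Cat.Hom.toNatIso (M.toPseudofunctor.mapId a)).app X

/-- The action of a composition. -/
def actComp {a b c : C} (f : a ⟶ b) (g : b ⟶ c) (X : M.cat a) :
    (M.act (f ≫ g)).obj X ≅ (M.act g).obj ((M.act f).obj X) :=
  (Cat.Hom.toNatIso (M.toPseudofunctor.mapComp f g)).app X

theorem actComp_naturality {a b c : C} (f : a ⟶ b) (g : b ⟶ c) {X Y : M.cat a} (φ : X ⟶ Y) :
    (M.act (f ≫ g)).map φ ≫ (M.actComp f g Y).hom =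
      (M.actComp f g X).hom ≫ (M.act g).map ((M.act f).map φ) :=
  (M.toPseudofunctor.mapComp f g).hom.toNatTrans.naturality φ

/-- Evaluation of 1-morphisms at an object. -/
def evalFunctor {a : C} (b : C) (X : M.cat a) : (a ⟶ b) ⥤ M.cat b where
  obj f := (M.act f).obj X
  map η := (M.act₂ η).app X
  map_id f := congrArg (fun t => t.toNatTrans.app X) (M.toPseudofunctor.map₂_id f)
  map_comp η θ := congrArg (fun t => t.toNatTrans.app X) (M.toPseudofunctor.map₂_comp η θ)

instance {a : C} (b : C) (X : M.cat a) : (M.evalFunctor b X).Additive :=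
  ⟨fun {_ _ η θ} => M.map₂_add η θ X⟩

variable {M}

theorem IsFinitary.isFin (hM : M.IsFinitary) (a : C) : IsFin k (M.cat a) := (hM a).isFin

theorem isSummand_act {a b : C} {f g : a ⟶ b} (h : IsSummand f g) (X : M.cat a) :
    IsSummand ((M.act f).obj X) ((M.act g).obj X) := h.map (M.evalFunctor b X)

/-- The retraction from `f Z` to `X` corresponds under adjunction to a morphism from `Z` to `g X`,
which is zero. -/
theorem isZero_of_isSummand_act {a b : C} {f : a ⟶ b} {g : b ⟶ a} (adj : Bicategory.Adjunction f g)
    {Z : M.cat a} {X : M.cat b} (hX : IsSummand X ((M.act f).obj Z))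
    (h0 : IsZero ((M.act g).obj X)) : IsZero X := by
  obtain ⟨hX⟩ := hX
  have adj' : M.act f ⊣ M.act g := CategoryTheory.Adjunction.ofCat (M.toPseudofunctor.mapAdjunction adj)
  have hr : hX.r = 0 := (adj'.homEquiv Z X).injective (h0.eq_of_tgt _ _)
  rw [IsZero.iff_id_eq_zero, ← hX.retract, hr, comp_zero]

/-- The ideal induced by a stable ideal on a 2-subrepresentation. -/
def StableIdeal.restrict (I : M.StableIdeal) (N : M.SubRep) : N.toTwoRep.StableIdeal where
  carrier a X Y := (I.carrier a X.obj Y.obj).comap ((N.mem a).ι.mapLinearMap k (X := X) (Y := Y))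
  comp_left a _ _ _ φ ψ h := I.comp_left a φ.hom ψ.hom h
  comp_right a _ _ _ φ ψ h := I.comp_right a φ.hom ψ.hom h
  act_mem f _ _ φ h := I.act_mem f φ.hom h

/-- The largest stable ideal which contains no identity of an indecomposable object
satisfying `P`. -/
def radIdeal (hM : ∀ a, IsFin k (M.cat a)) (P : ∀ a : C, ObjectProperty (M.cat a)) :
    M.StableIdeal where
  carrier a X Y :=
    -- Testing after the action of every `f` builds in stability, and locality of `End Z` gives
    -- closure under sums.
    { carrier := {φ | ∀ (b : C) (f : a ⟶ b) (Z : M.cat b), P b Z → IsIndec Z →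
        ∀ (α : Z ⟶ (M.act f).obj X) (β : (M.act f).obj Y ⟶ Z),
          ¬ IsIso (α ≫ (M.act f).map φ ≫ β)}
      zero_mem' := by
        intro b f Z hZ hZi α β
        rw [Functor.map_zero, zero_comp, comp_zero]
        exact not_isIso_zero_of_isIndec hZi
      add_mem' := by
        intro φ ψ hφ hψ b f Z hZ hZi α β h
        rw [Functor.map_add, Preadditive.add_comp, Preadditive.comp_add] at h
        exact ((hM b).isIso_of_add hZi _ _ h).elim (hφ b f Z hZ hZi α β) (hψ b f Z hZ hZi α β)
      smul_mem' := by
        intro r φ hφ b f Z hZ hZi α β h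
        rw [Functor.map_smul, Linear.smul_comp, ← Linear.comp_smul] at h
        exact hφ b f Z hZ hZi α (r • β) h }
  comp_left a X Y Z φ ψ hψ := by
    intro b f W hW hWi α β h
    rw [Functor.map_comp, Category.assoc, ← Category.assoc] at h
    exact hψ b f W hW hWi _ _ h
  comp_right a X Y Z φ ψ hφ := by
    intro b f W hW hWi α β h
    rw [Functor.map_comp, Category.assoc] at h
    exact hφ b f W hW hWi _ _ h
  act_mem {a b} f X Y φ hφ := by
    intro c g W hW hWi α β h
    refine hφ c (f ≫ g) W hW hWi (α ≫ (M.actComp f g X).inv) ((M.actComp f g Y).hom ≫ β) ?_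
    have e : (α ≫ (M.actComp f g X).inv) ≫ (M.act (f ≫ g)).map φ ≫ (M.actComp f g Y).hom ≫ β =
        α ≫ (M.act g).map ((M.act f).map φ) ≫ β := by
      have := M.actComp_naturality f g φ
      rw [reassoc_of% this]
      simp
    rw [e]
    exact h

theorem id_notMem_radIdeal (hM : ∀ a, IsFin k (M.cat a)) (P : ∀ a : C, ObjectProperty (M.cat a))
    {a : C} {Z : M.cat a} (hZ : P a Z) (hZi : IsIndec Z) :
    𝟙 Z ∉ (radIdeal hM P).carrier a Z Z := by
  intro h
  refine h a (𝟙 a) Z hZ hZi (M.actId Z).inv (M.actId Z).hom ?_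
  rw [CategoryTheory.Functor.map_id, Category.id_comp, Iso.inv_hom_id]
  infer_instance

/-- A stable ideal of a 2-subrepresentation which contains no identity of an indecomposable
object satisfying `P` is contained in `radIdeal`. -/
theorem le_radIdeal (hM : ∀ a, IsFin k (M.cat a)) {P : ∀ a : C, ObjectProperty (M.cat a)}
    (N : M.SubRep) (hPN : ∀ a, P a ≤ N.mem a) (I : N.toTwoRep.StableIdeal)
    (hI : ∀ (a : C) (Z : N.toTwoRep.cat a), P a Z.obj → IsIndec Z.obj → 𝟙 Z ∉ I.carrier a Z Z)
    (a : C) (X Y : N.toTwoRep.cat a) :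
    I.carrier a X Y ≤ ((radIdeal hM P).restrict N).carrier a X Y := by
  intro φ hφ b f Z hZ hZi α β h
  have h : IsIso (α ≫ (M.act f).map φ.hom ≫ β) := h
  -- An invertible composite through `φ` would put `𝟙 Z` into `I`; as `Z` lies in `N`, the whole
  -- composite lives in `N`.
  let Z' : N.toTwoRep.cat b := ⟨Z, hPN b Z hZ⟩
  refine hI b Z' hZ hZi ?_
  let α' : Z' ⟶ (N.toTwoRep.act f).obj X := ObjectProperty.homMk α
  let β' : (N.toTwoRep.act f).obj Y ⟶ Z' :=
    ObjectProperty.homMk (β ≫ inv (α ≫ (M.act f).map φ.hom ≫ β))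
  have h1 : α' ≫ (N.toTwoRep.act f).map φ ≫ β' ∈ I.carrier b Z' Z' :=
    I.comp_left b _ _ (I.comp_right b _ _ (I.act_mem f φ hφ))
  have h2 : α' ≫ (N.toTwoRep.act f).map φ ≫ β' = 𝟙 Z' := by
    apply ObjectProperty.hom_ext
    change α ≫ (M.act f).map φ.hom ≫ β ≫ inv (α ≫ (M.act f).map φ.hom ≫ β) = 𝟙 Z
    have := IsIso.hom_inv_id (α ≫ (M.act f).map φ.hom ≫ β)
    simpa only [Category.assoc] using this
  rwa [h2] at h1

end TwoRep

end TwoReps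

/-- An element of a finite dimensional algebra whose image is idempotent can be replaced by an
idempotent with the same image. -/
theorem exists_idempotent_lift (k : Type*) {B E : Type*} [Field k] [Ring B] [Algebra k B]
    [Module.Finite k B] [Monoid E] (F : B →* E) (f : B) (hf : F f * F f = F f) :
    ∃ e : B, e * e = e ∧ F e = F f := by
  obtain ⟨n, e, g, he, -, -, hfg, hfe⟩ := exists_fitting_idempotent k f
  -- The Fitting idempotent `e` is congruent to `f`: the image of `f` equals its own powers, which
  -- absorb `e`, while `e = f * g` is absorbed by the idempotent image of `f`.
  have h1 : F f * F e = F f := by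
    have hp : F f ^ (n + 1) = F f := IsIdempotentElem.pow_succ_eq n hf
    have := congrArg (fun x => F (f * x)) hfe
    simpa only [map_mul, map_pow, ← mul_assoc, ← pow_succ', hp] using this
  have h2 : F f * F e = F e := by
    rw [← hfg, map_mul, ← mul_assoc, hf]
  exact ⟨e, he, h2.symm.trans h1⟩

/-! ### Quotients by stable ideals. -/

section TwoReps

variable {k : Type uk} [Field k] {C : Type u} [Bicategory.{w, v} C]
    [PreadditiveBicategory C] [LinearBicategory k C]

namespace TwoRep

variable {M : TwoRep.{w, v, u, v', u', uk} k C}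

namespace StableIdeal

variable (I : M.StableIdeal)

instance proj_linear (a : C) : (I.proj a).Linear k :=
  CategoryTheory.Quotient.linear_functor k (I.rel a) (I.rel_smul a)

theorem proj_map_eq_iff {a : C} {X Y : M.cat a} (φ ψ : X ⟶ Y) :
    (I.proj a).map φ = (I.proj a).map ψ ↔ φ - ψ ∈ I.carrier a X Y :=
  CategoryTheory.Quotient.functor_map_eq_iff (I.rel a) φ ψ

theorem proj_map_eq_zero_iff {a : C} {X Y : M.cat a} (φ : X ⟶ Y) :
    (I.proj a).map φ = 0 ↔ φ ∈ I.carrier a X Y := by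
  rw [← (I.proj a).map_zero, proj_map_eq_iff, sub_zero]

theorem isFin_quot {a : C} (hM : IsFin k (M.cat a)) : IsFin k (I.Quot a) := by
  have := hM.idem
  have := hM.hasBiprod
  obtain ⟨T, hT⟩ := hM.gen
  refine ⟨fun X Y => ?_, ⟨fun X p hp => ?_⟩, ?_, ⟨fun X Y => ⟨⟨?_⟩⟩⟩, ⟨(I.proj a).obj T, fun X => ?_⟩⟩
  · have := hM.finite_hom X.as Y.as
    exact Module.Finite.of_surjective ((I.proj a).mapLinearMap k (X := X.as) (Y := Y.as))
      (I.proj a).map_surjective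
  · obtain ⟨f, rfl⟩ := (I.proj a).map_surjective p
    have : Module.Finite k (End X.as) := hM.finite_hom X.as X.as
    -- Idempotents of the quotient category lift, so they split because their lifts do.
    obtain ⟨e, he, hfe⟩ := exists_idempotent_lift k ((I.proj a).mapEnd X.as) f hp
    obtain ⟨Y, i, r, h1, h2⟩ := IsIdempotentComplete.idempotents_split X.as e he
    refine ⟨(I.proj a).obj Y, (I.proj a).map i, (I.proj a).map r, ?_, ?_⟩
    · rw [← Functor.map_comp, h1, CategoryTheory.Functor.map_id]
    · rw [← Functor.map_comp, h2]
      exact hfe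
  · obtain ⟨O, hO⟩ := hM.hasZero
    exact ⟨(I.proj a).obj O, (I.proj a).map_isZero hO⟩
  · exact ⟨_, (map_bicone_isBilimit (I.proj a) _ (BinaryBiproduct.isBilimit X.as Y.as)).some⟩
  · exact AddClosure.map (I.proj a) (S' := fun Y => Y = (I.proj a).obj T)
      (fun Y hY => AddClosure.of _ (congrArg _ hY)) (hT X.as)

/-- The representative of an indecomposable of the quotient may decompose into further terms, so
both objects are replaced by suitable indecomposable summands of their representatives. -/
theorem isTransitive_quotient (hM : M.IsTransitive) : I.quotient.IsTransitive := by
  have hfin := fun a => I.isFin_quot (IsFinitary.isFin hM.1 a)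
  refine ⟨fun a => (hfin a).isFinitaryCat, fun a b X Y hX hY => ?_⟩
  have hX0 : ¬ IsZero X.as := fun h => hX.1 ((I.proj a).map_isZero h)
  obtain ⟨X', hX', hXs⟩ := (IsFinitary.isFin hM.1 a).exists_indec_summand hX0
  obtain ⟨Y', hY', -, hYs⟩ := (IsFinitary.isFin hM.1 b).exists_indec_of_map (hfin b) (I.proj b)
    (X := Y.as) (Z := Y) hY (IsSummand.refl _)
  obtain ⟨f, hf⟩ := hM.2 a b X' Y' hX' hY'
  exact ⟨f, hYs.trans ((hf.trans (hXs.map (M.act f))).map (I.proj b))⟩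

/-- The preimage of a stable ideal of a quotient. -/
def comap (I₁ : I.quotient.StableIdeal) : M.StableIdeal where
  carrier a X Y := (I₁.carrier a ((I.proj a).obj X) ((I.proj a).obj Y)).comap
    ((I.proj a).mapLinearMap k)
  comp_left a _ _ _ φ ψ h := by
    have := I₁.comp_left a ((I.proj a).map φ) _ h
    exact (congrArg (· ∈ I₁.carrier a _ _) ((I.proj a).map_comp φ ψ)).mpr this
  comp_right a _ _ _ φ ψ h := by
    have := I₁.comp_right a _ ((I.proj a).map ψ) h
    exact (congrArg (· ∈ I₁.carrier a _ _) ((I.proj a).map_comp φ ψ)).mpr this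
  act_mem f _ _ φ h := I₁.act_mem f ((I.proj _).map φ) h

/-- The image of a stable ideal in a quotient. -/
def map (I₁ : M.StableIdeal) : I.quotient.StableIdeal where
  carrier a X Y := (I₁.carrier a X.as Y.as).map
    ((I.proj a).mapLinearMap k (X := X.as) (Y := Y.as))
  comp_left a X Y Z φ ψ h := by
    obtain ⟨φ, rfl⟩ := (I.proj a).map_surjective (X := X.as) (Y := Y.as) φ
    obtain ⟨ψ, hψ, rfl⟩ := h
    exact ⟨φ ≫ ψ, I₁.comp_left a φ ψ hψ, (I.proj a).map_comp φ ψ⟩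
  comp_right a X Y Z φ ψ h := by
    obtain ⟨ψ, rfl⟩ := (I.proj a).map_surjective (X := Y.as) (Y := Z.as) ψ
    obtain ⟨φ, hφ, rfl⟩ := h
    exact ⟨φ ≫ ψ, I₁.comp_right a φ ψ hφ, (I.proj a).map_comp φ ψ⟩
  act_mem f X Y φ h := by
    obtain ⟨φ, hφ, rfl⟩ := h
    exact ⟨(M.act f).map φ, I₁.act_mem f φ hφ, rfl⟩

/-- Simplicity of a quotient in terms of ideals of the original 2-representation. -/
theorem isSimpleTransitive_quotient (hM : M.IsTransitive)
    (h : ∀ I₁ : M.StableIdeal, (∀ a X Y, I.carrier a X Y ≤ I₁.carrier a X Y) →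
      (∀ a X Y, I₁.carrier a X Y ≤ I.carrier a X Y) ∨ (∀ a X Y, I₁.carrier a X Y = ⊤)) :
    I.quotient.IsSimpleTransitive := by
  refine ⟨I.isTransitive_quotient hM, fun I₁ => ?_⟩
  refine (h (I.comap I₁) ?_).imp (fun h' => ?_) (fun h' => ?_)
  · intro a X Y φ hφ
    have : (I.proj a).map φ = 0 := (I.proj_map_eq_zero_iff φ).mpr hφ
    change (I.proj a).map φ ∈ I₁.carrier a _ _
    rw [this]
    exact Submodule.zero_mem _
  · intro a X Y
    rw [eq_bot_iff]
    intro φ hφ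
    obtain ⟨φ, rfl⟩ := (I.proj a).map_surjective (X := X.as) (Y := Y.as) φ
    exact (I.proj_map_eq_zero_iff φ).mpr (h' a X.as Y.as hφ)
  · intro a X Y
    rw [eq_top_iff]
    intro φ _
    obtain ⟨φ, rfl⟩ := (I.proj a).map_surjective (X := X.as) (Y := Y.as) φ
    have : φ ∈ (I.comap I₁).carrier a X.as Y.as := by rw [h']; trivial
    exact this

theorem le_or_eq_top_of_isSimpleTransitive (h : I.quotient.IsSimpleTransitive)
    (I₁ : M.StableIdeal) (hle : ∀ a X Y, I.carrier a X Y ≤ I₁.carrier a X Y) :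
    (∀ a X Y, I₁.carrier a X Y ≤ I.carrier a X Y) ∨ (∀ a X Y, I₁.carrier a X Y = ⊤) := by
  refine (h.2 (I.map I₁)).imp (fun h' => ?_) (fun h' => ?_)
  · intro a X Y φ hφ
    have h1 : (I.proj a).map φ ∈ (I.map I₁).carrier a ((I.proj a).obj X) ((I.proj a).obj Y) :=
      ⟨φ, hφ, rfl⟩
    exact (I.proj_map_eq_zero_iff φ).mp ((SetLike.ext_iff.mp (h' a _ _) _).mp h1)
  · intro a X Y
    rw [eq_top_iff]
    intro φ _
    have h1 : (I.proj a).map φ ∈ (I.map I₁).carrier a ((I.proj a).obj X) ((I.proj a).obj Y) :=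
      (SetLike.ext_iff.mp (h' a _ _) _).mpr trivial
    obtain ⟨ψ, hψ, hφ⟩ := h1
    have h2 := hle _ _ _ ((I.proj_map_eq_iff ψ φ).mp hφ)
    have h3 := Submodule.sub_mem _ hψ h2
    rwa [sub_sub_cancel] at h3

end StableIdeal

end TwoRep

end TwoReps

/-! ### Simplicity of the radical quotient and comparison of subquotients. -/

section TwoReps

variable {k : Type uk} [Field k] {C : Type u} [Bicategory.{w, v} C]
    [PreadditiveBicategory C] [LinearBicategory k C]

namespace TwoRep

variable {M : TwoRep.{w, v, u, v', u', uk} k C}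

theorem StableIdeal.eq_top_of_id_mem (I : M.StableIdeal)
    (h : ∀ (a : C) (X : M.cat a), 𝟙 X ∈ I.carrier a X X) (a : C) (X Y : M.cat a) :
    I.carrier a X Y = ⊤ := by
  rw [eq_top_iff]
  intro φ _
  have := I.comp_right a _ φ (h a X)
  rwa [Category.id_comp] at this

theorem StableIdeal.id_mem_of_isSummand (I : M.StableIdeal) {a : C} {X Y : M.cat a}
    (h : IsSummand X Y) (hY : 𝟙 Y ∈ I.carrier a Y Y) : 𝟙 X ∈ I.carrier a X X := by
  obtain ⟨h⟩ := h
  have := I.comp_left a h.i _ (I.comp_right a _ h.r hY)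
  rwa [Category.id_comp, h.retract] at this

theorem StableIdeal.id_act_mem (I : M.StableIdeal) {a b : C} (f : a ⟶ b) {X : M.cat a}
    (hX : 𝟙 X ∈ I.carrier a X X) :
    𝟙 ((M.act f).obj X) ∈ I.carrier b ((M.act f).obj X) ((M.act f).obj X) := by
  have := I.act_mem f _ hX
  rwa [CategoryTheory.Functor.map_id] at this

theorem StableIdeal.id_mem_of_indec (I : M.StableIdeal) {a : C} (hM : IsFin k (M.cat a))
    (h : ∀ X : M.cat a, IsIndec X → 𝟙 X ∈ I.carrier a X X) (X : M.cat a) :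
    𝟙 X ∈ I.carrier a X X := by
  refine hM.induction (P := fun X => 𝟙 X ∈ I.carrier a X X) ?_ ?_ h X
  · intro X hX
    rw [hX.eq_of_src (𝟙 X) 0]
    exact Submodule.zero_mem _
  · intro X Y b hb hX hY
    rw [← BinaryBicone.IsBilimit.total' hb]
    have h1 := I.comp_left a b.fst _ (I.comp_right a _ b.inl hX)
    have h2 := I.comp_left a b.snd _ (I.comp_right a _ b.inr hY)
    rw [Category.id_comp] at h1 h2
    exact Submodule.add_mem _ h1 h2

theorem SubRep.isIndec_iff {a : C} (hM : IsFin k (M.cat a)) (N : M.SubRep)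
    (X : N.toTwoRep.cat a) : IsIndec X ↔ IsIndec X.obj := by
  have := hM.idem
  have : IsIdempotentComplete (N.mem a).FullSubcategory :=
    isIdempotentComplete_fullSubcategory _ (N.summand_mem a)
  exact (isIndec_map_iff (N.mem a).ι X).symm

theorem SubRep.isSummand_iff {a : C} (N : M.SubRep)
    (X Y : N.toTwoRep.cat a) : IsSummand X Y ↔ IsSummand X.obj Y.obj :=
  (isSummand_map_iff (N.mem a).ι X Y).symm

/-- A stable ideal of `N` without identities of indecomposables is contained in the radical ideal.
One that contains such an identity contains the identity of every indecomposable, by transitivity,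
and is everything. -/
theorem isSimpleTransitive_radIdeal (hM : ∀ a, IsFin k (M.cat a)) (N : M.SubRep)
    (hN : N.toTwoRep.IsTransitive) :
    ((radIdeal hM N.mem).restrict N).quotient.IsSimpleTransitive := by
  refine StableIdeal.isSimpleTransitive_quotient _ hN fun I₁ _ => ?_
  by_cases h : ∀ (a : C) (Z : N.toTwoRep.cat a), N.mem a Z.obj → IsIndec Z.obj →
      𝟙 Z ∉ I₁.carrier a Z Z
  · exact Or.inl (le_radIdeal hM N (fun a => le_rfl) I₁ h)
  · right
    push Not at h
    obtain ⟨a, Z, -, hZi, hZ⟩ := h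
    refine I₁.eq_top_of_id_mem fun b => I₁.id_mem_of_indec (IsFinitary.isFin hN.1 b) fun Y hY => ?_
    obtain ⟨f, hf⟩ := hN.2 a b Z Y ((N.isIndec_iff (hM a) Z).mpr hZi) hY
    exact I₁.id_mem_of_isSummand hf (I₁.id_act_mem f hZ)

section Comparison

variable {N N' : M.SubRep} (hle : ∀ a : C, N.mem a ≤ N'.mem a)
  {I : N.toTwoRep.StableIdeal} {I' : N'.toTwoRep.StableIdeal}
  (hI : ∀ (a : C) (X Y : N.toTwoRep.cat a) (φ ψ : X ⟶ Y), I.rel a φ ψ →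
      (SubRep.incl hle a ⋙ I'.proj a).map φ = (SubRep.incl hle a ⋙ I'.proj a).map ψ)

/-- The functor between subquotients induced by the inclusion of 2-subrepresentations. -/
abbrev comparison (a : C) : I.Quot a ⥤ I'.Quot a :=
  CategoryTheory.Quotient.lift (I.rel a) (SubRep.incl hle a ⋙ I'.proj a) (hI a)

instance comparison_additive (a : C) : (comparison hle hI a).Additive := ⟨fun {X Y φ ψ} => by
  obtain ⟨φ, rfl⟩ := (I.proj a).map_surjective (X := X.as) (Y := Y.as) φ
  obtain ⟨ψ, rfl⟩ := (I.proj a).map_surjective (X := X.as) (Y := Y.as) ψ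
  rfl⟩

instance comparison_linear (a : C) : (comparison hle hI a).Linear k := ⟨fun {X Y} φ r => by
  obtain ⟨φ, rfl⟩ := (I.proj a).map_surjective (X := X.as) (Y := Y.as) φ
  rfl⟩

theorem eq_comp_of_eq_id {D : Type*} [Category* D] {X Y : D} {f : X ⟶ Y} {g : Y ⟶ Y}
    (h : g = 𝟙 Y) : f = f ≫ g := by
  rw [h, Category.comp_id]

/-- The strong transformation between subquotients induced by the inclusion. -/
def comparisonTrans :
    Pseudofunctor.StrongTrans I.quotient.toPseudofunctor I'.quotient.toPseudofunctor where
  app a := (comparison hle hI a).toCatHom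
  -- Both composites agree on objects by definition, so the structure isomorphisms are identities
  -- and the coherence laws below only cancel identities.
  naturality {a b} f := Cat.Hom.isoMk (NatIso.ofComponents (fun X => Iso.refl _) (fun {X Y} φ => by
    obtain ⟨φ, rfl⟩ := (I.proj a).map_surjective (X := X.as) (Y := Y.as) φ
    exact (Category.comp_id _).trans (Category.id_comp _).symm))
  naturality_naturality {a b f g} η := by
    refine Cat.Hom₂.ext (NatTrans.ext (funext fun X => ?_))
    exact (Category.comp_id _).trans (Category.id_comp _).symm
  naturality_id a := by
    refine Cat.Hom₂.ext (NatTrans.ext (funext fun X => ?_))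
    refine (Category.id_comp _).trans ?_
    exact ((congrArg _ (Category.comp_id _)).trans (Category.comp_id _)).symm
  naturality_comp {a b c} f g := by
    refine Cat.Hom₂.ext (NatTrans.ext (funext fun X => ?_))
    refine (Category.id_comp _).trans ?_
    refine eq_comp_of_eq_id ?_
    refine (Category.id_comp _).trans ((Category.id_comp _).trans ((Category.id_comp _).trans
      ((Category.comp_id _).trans ?_)))
    exact (I'.functor g).map_id _

/-- Fullness is that of `N` in `N'`, and faithfulness is `heq`. For essential surjectivity, `Z₀` is
nonzero in the target, so by transitivity every indecomposable there is a summand of some `f Z₀`,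
which comes from `N`; the essential image is closed under summands. -/
theorem comparison_isEquivalence (hN : N.toTwoRep.IsTransitive)
    (hI' : I'.quotient.IsTransitive)
    (heq : ∀ (a : C) (X Y : N.toTwoRep.cat a) (φ : X ⟶ Y),
      (SubRep.incl hle a).map φ ∈ I'.carrier a _ _ → φ ∈ I.carrier a X Y)
    {a₀ : C} (Z₀ : N.toTwoRep.cat a₀)
    (hZ₀ : 𝟙 ((SubRep.incl hle a₀).obj Z₀) ∉ I'.carrier a₀ _ _) (a : C) :
    (comparison hle hI a).IsEquivalence := by
  have : (comparison hle hI a).Faithful := ⟨fun {X Y} φ ψ h => by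
    obtain ⟨φ, rfl⟩ := (I.proj a).map_surjective (X := X.as) (Y := Y.as) φ
    obtain ⟨ψ, rfl⟩ := (I.proj a).map_surjective (X := X.as) (Y := Y.as) ψ
    refine (I.proj_map_eq_iff φ ψ).mpr (heq _ _ _ _ ?_)
    exact (I'.proj_map_eq_iff ((SubRep.incl hle a).map φ) ((SubRep.incl hle a).map ψ)).mp h⟩
  have : (comparison hle hI a).Full := ⟨fun {X Y} φ => by
    obtain ⟨φ, rfl⟩ := (I'.proj a).map_surjective (X := (SubRep.incl hle a).obj X.as)
      (Y := (SubRep.incl hle a).obj Y.as) φ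
    exact ⟨(I.proj a).map (ObjectProperty.homMk φ.hom), rfl⟩⟩
  have hfin : IsFin k (I.Quot a) := I.isFin_quot (IsFinitary.isFin hN.1 a)
  have hfin' : ∀ a, IsFin k (I'.Quot a) := fun a => IsFinitary.isFin hI'.1 a
  have := hfin.idem
  have := hfin.hasZero
  have := hfin.hasBiprod
  have : (comparison hle hI a).EssSurj := by
    refine ⟨fun Y => ?_⟩
    refine exists_iso_of_addClosure (comparison hle hI a)
      (S := fun Q => ∃ X, Q = (comparison hle hI a).obj X) ?_ ?_
    · rintro _ ⟨X, rfl⟩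
      exact ⟨X, ⟨Iso.refl _⟩⟩
    · refine (hfin' a).induction (fun X hX => AddClosure.zero X hX)
        (fun X Y b hb hX hY => AddClosure.sum X Y b hb hX hY) (fun Y hY => ?_) Y
      have h0 : ¬ IsZero ((I'.proj a₀).obj ((SubRep.incl hle a₀).obj Z₀)) := fun h =>
        hZ₀ ((I'.proj_map_eq_zero_iff _).mp (h.eq_of_src _ _))
      obtain ⟨X, hX, hXs⟩ := (hfin' a₀).exists_indec_summand h0
      obtain ⟨f, hf⟩ := hI'.2 a₀ a X Y hX hY
      refine AddClosure.summand _ _ (hf.trans (hXs.map (I'.functor f))) (AddClosure.of _ ?_)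
      exact ⟨(I.proj a).obj ((N.toTwoRep.act f).obj Z₀), rfl⟩
  exact {}

end Comparison

/-- Uniqueness of simple transitive subquotients. -/
theorem comparison_of_isSimpleTransitive (hM : ∀ a, IsFin k (M.cat a)) {N N' : M.SubRep}
    (hN : N.toTwoRep.IsTransitive) {a₀ : C} {Z₀ : M.cat a₀} (hZ₀ : N.mem a₀ Z₀) (hZ₀i : IsIndec Z₀)
    (hle : ∀ a : C, N.mem a ≤ N'.mem a) (I' : N'.toTwoRep.StableIdeal)
    (hI' : I'.quotient.IsSimpleTransitive)
    (hid : ∀ (a : C) (Z : N'.toTwoRep.cat a), N.mem a Z.obj → IsIndec Z.obj →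
      𝟙 Z ∉ I'.carrier a Z Z) :
    ((radIdeal hM N.mem).restrict N).quotient.Equivalent I'.quotient ∧
      InclusionInducesEquivalence ((radIdeal hM N.mem).restrict N) I' := by
  have h1 := le_radIdeal hM N' hle I' hid
  -- The radical ideal on `N'` contains `I'` and omits the identity of `Z₀`, so simplicity of
  -- `N'/I'` forces it to be equal to `I'`.
  have h2 : ∀ a X Y, ((radIdeal hM N.mem).restrict N').carrier a X Y ≤ I'.carrier a X Y := by
    refine (I'.le_or_eq_top_of_isSimpleTransitive hI' _ h1).resolve_right fun h => ?_
    let Z : N'.toTwoRep.cat a₀ := ⟨Z₀, hle _ _ hZ₀⟩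
    have h3 : 𝟙 Z ∈ ((radIdeal hM N.mem).restrict N').carrier a₀ Z Z := by rw [h]; trivial
    exact id_notMem_radIdeal hM N.mem hZ₀ hZ₀i h3
  have hI : ∀ (a : C) (X Y : N.toTwoRep.cat a) (φ ψ : X ⟶ Y),
      ((radIdeal hM N.mem).restrict N).rel a φ ψ →
      (SubRep.incl hle a ⋙ I'.proj a).map φ = (SubRep.incl hle a ⋙ I'.proj a).map ψ := by
    intro a X Y φ ψ h
    exact (I'.proj_map_eq_iff _ _).mpr (h2 _ _ _ h)
  have heqv := comparison_isEquivalence hle hI hN hI'.1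
    (fun a X Y φ h => h1 a _ _ h) ⟨Z₀, hZ₀⟩ (hid a₀ ⟨Z₀, hle _ _ hZ₀⟩ hZ₀ hZ₀i)
  exact ⟨⟨comparisonTrans hle hI, fun a => ⟨heqv a, comparison_additive hle hI a,
    comparison_linear hle hI a⟩⟩, hle, hI, heqv⟩

end TwoRep

end TwoReps

/-- The stable ideal induced on a smaller 2-subrepresentation. -/
def TwoRep.StableIdeal.pullback {k : Type uk} [Field k] {C : Type u} [Bicategory.{w, v} C]
    [PreadditiveBicategory C] [LinearBicategory k C] {M : TwoRep.{w, v, u, v', u', uk} k C}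
    {N N' : M.SubRep} (I' : N'.toTwoRep.StableIdeal) (hle : ∀ a, N.mem a ≤ N'.mem a) :
    N.toTwoRep.StableIdeal where
  carrier a _ _ :=
    { carrier := {φ | (SubRep.incl hle a).map φ ∈ I'.carrier a _ _}
      zero_mem' := (I'.carrier a _ _).zero_mem
      add_mem' := fun hφ hψ => (I'.carrier a _ _).add_mem hφ hψ
      smul_mem' := fun r _ hφ => (I'.carrier a _ _).smul_mem r hφ }
  comp_left a _ _ _ φ ψ h := I'.comp_left a ((SubRep.incl hle a).map φ)
    ((SubRep.incl hle a).map ψ) h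
  comp_right a _ _ _ φ ψ h := I'.comp_right a ((SubRep.incl hle a).map φ)
    ((SubRep.incl hle a).map ψ) h
  act_mem {a _} f _ _ φ h := I'.act_mem f ((SubRep.incl hle a).map φ) h

/-! ### The 2-subrepresentation generated by the action of `H`. -/

namespace MaximalLeftCell

open EndoClass

variable {k : Type uk} [Field k] {C : Type u} [Bicategory.{w, v} C] [PreadditiveBicategory C]
  [LinearBicategory k C] {S : WeakInvolution C} {J L : OneMorClass C} {i : C}
  (h : MaximalLeftCell k S J L i) (M : TwoRep.{w, v, u, v', u', uk} k C)

/-- The additive closure of the objects `F Z`. -/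
abbrev actClosure (F : i ⟶ i) : ObjectProperty (M.cat i) :=
  AddClosure (fun Y : M.cat i => ∃ Z : M.cat i, Y = (M.act F).obj Z)

variable {M}

include h

theorem exists_indec_act (hM : M.IsFinitary) {a b : C} {f : a ⟶ b} {X : M.cat a} {Y : M.cat b}
    (hY : IsIndec Y) (hs : IsSummand Y ((M.act f).obj X)) :
    ∃ f' : a ⟶ b, IsIndec f' ∧ IsSummand f' f ∧ IsSummand Y ((M.act f').obj X) :=
  (h.fiat.finitary.isFin a b).exists_indec_of_map (hM.isFin b) (M.evalFunctor b X) hY hs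

theorem exists_mem_of_actClosure (hM : M.IsFinitary) {F : i ⟶ i}
    (hF : IsMultiplicityFreeSum (diagonalHCell S L i) F) {Y : M.cat i} (hY : IsIndec Y)
    (hYF : actClosure M F Y) :
    ∃ f ∈ diagonalHCell S L i, ∃ Z : M.cat i, IsSummand Y ((M.act f).obj Z) := by
  obtain ⟨_, ⟨Z, rfl⟩, hs⟩ := (hM.isFin i).isSummand_of_addClosure hY hYF (IsSummand.refl Y)
  obtain ⟨f, hf, hfs, hfY⟩ := h.exists_indec_act hM hY hs
  exact ⟨f, h.mem_of_isMultiplicityFreeSum hF hf hfs, Z, hfY⟩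

omit h in
theorem actClosure_of_mem {F : i ⟶ i} (hF : IsMultiplicityFreeSum (diagonalHCell S L i) F)
    {f : i ⟶ i} (hf : f ∈ diagonalHCell S L i) (Z : M.cat i) :
    actClosure M F ((M.act f).obj Z) :=
  AddClosure.summand _ _ (TwoRep.isSummand_act (hF.isSummand hf) Z) (AddClosure.of _ ⟨Z, rfl⟩)

/-- Each indecomposable summand of `K (F Z)` is a summand of `x Z` for an indecomposable summand `x`
of `F ≫ K`, and such `x` belong to `H`. -/
theorem actClosure_act (hM : M.IsFinitary) {F : i ⟶ i}
    (hF : IsMultiplicityFreeSum (diagonalHCell S L i) F) {K : i ⟶ i}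
    (hK : Generated (diagonalHCell S L i) K) {X : M.cat i} (hX : actClosure M F X) :
    actClosure M F ((M.act K).obj X) := by
  refine AddClosure.map (M.act K) ?_ hX
  rintro _ ⟨Z, rfl⟩
  refine (hM.isFin i).of_indec_summands (fun X hX => AddClosure.zero X hX)
    (fun X Y b hb hX hY => AddClosure.sum X Y b hb hX hY) _ fun Y hY hYs => ?_
  obtain ⟨x, hx, hxs, hYx⟩ := h.exists_indec_act hM hY
    (hYs.trans (IsSummand.of_iso (M.actComp F K Z).symm))
  obtain ⟨f, hf, hfs, hxf⟩ := (h.fiat.finitary.isFin i i).exists_indec_of_map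
    (h.fiat.finitary.isFin i i) (postcomp i K) hx hxs
  have hxH := h.mem_of_comp_generated (h.mem_of_isMultiplicityFreeSum hF hf hfs) hK hx hxf
  exact AddClosure.summand _ _ hYx (actClosure_of_mem hF hxH Z)

/-- The adjoint `S.on f`, again in `H`, cannot kill a nonzero summand of `f Z`. -/
theorem exists_not_isZero_act {f : i ⟶ i} (hf : f ∈ diagonalHCell S L i) {X Z : M.cat i}
    (hX : ¬ IsZero X) (hs : IsSummand X ((M.act f).obj Z)) :
    ∃ g ∈ diagonalHCell S L i, ¬ IsZero ((M.act g).obj X) := by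
  obtain ⟨adj⟩ := h.fiat.adj f
  exact ⟨S.on f, h.on_mem_diagonalHCell hf, fun h0 => hX (TwoRep.isZero_of_isSummand_act adj hs h0)⟩

/-- Transitivity of `M` over `C` joins a summand of `g X` to a summand of `Z` by some `K`, making
`Y` a summand of the action of `g ≫ K ≫ f` on `X`. Although `K` may lie outside the 2-subcategory,
the indecomposable summands of this composite are in `H`. -/
theorem exists_isSummand_act (hM : M.IsTransitive) {f g : i ⟶ i} (hf : f ∈ diagonalHCell S L i)
    (hg : g ∈ diagonalHCell S L i) {X Y Z : M.cat i} (hX : ¬ IsZero ((M.act g).obj X))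
    (hY : IsIndec Y) (hs : IsSummand Y ((M.act f).obj Z)) :
    ∃ x ∈ diagonalHCell S L i, IsSummand Y ((M.act x).obj X) := by
  have hfin := hM.1.isFin i
  obtain ⟨W, hW, hWs⟩ := hfin.exists_indec_summand hX
  obtain ⟨Z', hZ', -, hYZ⟩ := hfin.exists_indec_of_map hfin (M.act f) hY hs
  obtain ⟨K, hK⟩ := hM.2 i i W Z' hW hZ'
  have hs' : IsSummand Y ((M.act (g ≫ K ≫ f)).obj X) :=
    (hYZ.trans ((hK.trans (hWs.map (M.act K))).map (M.act f))).trans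
      (IsSummand.of_iso ((M.actComp g (K ≫ f) X) ≪≫ M.actComp K f _).symm)
  obtain ⟨x, hx, hxs, hYx⟩ := h.exists_indec_act hM.1 hY hs'
  exact ⟨x, h.mem_of_isSummand hg hf hx hxs, hYx⟩

/-- The 2-subrepresentation on the additive closure of the objects `F Z`. -/
def subRep (hM : M.IsFinitary) {F : i ⟶ i}
    (hF : IsMultiplicityFreeSum (diagonalHCell S L i) F) :
    ((generatedBy (diagonalHCell S L i)).restrict M).SubRep where
  mem _ := actClosure M F
  zero_mem _ X hX := AddClosure.zero X hX
  sum_mem _ X Y b hb hX hY := AddClosure.sum X Y b hb.some hX hY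
  summand_mem _ X Y hs hY := AddClosure.summand X Y hs hY
  act_mem f _ hX := h.actClosure_act hM hF f.property hX

theorem subRep_isTransitive (hM : M.IsTransitive) {F : i ⟶ i}
    (hF : IsMultiplicityFreeSum (diagonalHCell S L i) F) :
    (h.subRep hM.1 hF).toTwoRep.IsTransitive := by
  have hfin := hM.1.isFin i
  have hfin' : ∀ a, IsFin k (((generatedBy (diagonalHCell S L i)).restrict M).cat a) :=
    fun _ => hfin
  refine ⟨fun a => IsFin.isFinitaryCat ?_, fun a b X Y hX hY => ?_⟩
  -- If `T` generates `M(i)`, then `F T` is an additive generator of the closure.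
  · obtain ⟨T, hT⟩ := hfin.gen
    have hFT : actClosure M F ((M.act F).obj T) := AddClosure.of _ ⟨T, rfl⟩
    refine IsFin.fullSubcategory (P := actClosure M F) hfin (fun X hX => AddClosure.zero X hX)
      (fun X Y b hb hX hY => AddClosure.sum X Y b hb hX hY)
      (fun X Y hs hY => AddClosure.summand X Y hs hY) ⟨⟨_, hFT⟩, fun X => ?_⟩
    refine (AddClosure.fullSubcategory (P := actClosure M F) (T := ⟨_, hFT⟩)
      (fun X hX => AddClosure.zero X hX)
      (fun X Y b hb hX hY => AddClosure.sum X Y b hb hX hY)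
      (fun X Y hs hY => AddClosure.summand X Y hs hY)
      (AddClosure.mono ?_ X.property)).choose_spec
    rintro _ ⟨Z, rfl⟩
    exact AddClosure.map (M.act F) (S' := fun Y => Y = (M.act F).obj T)
      (fun Y hY => AddClosure.of _ (congrArg _ hY)) (hT Z)
  · have hX' : IsIndec (X.obj : M.cat i) := ((h.subRep hM.1 hF).isIndec_iff (hfin' a) X).mp hX
    have hY' : IsIndec (Y.obj : M.cat i) := ((h.subRep hM.1 hF).isIndec_iff (hfin' b) Y).mp hY
    obtain ⟨f, hf, Z, hs⟩ := h.exists_mem_of_actClosure hM.1 hF hX' X.property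
    obtain ⟨f', hf', Z', hs'⟩ := h.exists_mem_of_actClosure hM.1 hF hY' Y.property
    obtain ⟨g, hg, hgX⟩ := h.exists_not_isZero_act hf hX'.1 hs
    obtain ⟨x, hx, hYx⟩ := h.exists_isSummand_act hM hf' hg hgX hY' hs'
    exact ⟨(⟨x, Generated.of x hx⟩ : a ⟶ b), ((h.subRep hM.1 hF).isSummand_iff _ _).mpr hYx⟩

/-- The dual of `exists_isSummand_comp` under `⋆`. -/
theorem exists_isSummand_comp_left {f g : i ⟶ i} (hf : f ∈ diagonalHCell S L i)
    (hg : g ∈ diagonalHCell S L i) :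
    ∃ y ∈ diagonalHCell S L i, IsSummand f (y ≫ g) := by
  obtain ⟨y, hy, hs⟩ := h.exists_isSummand_comp (h.on_mem_diagonalHCell hf)
    (h.on_mem_diagonalHCell hg)
  exact ⟨S.on y, h.on_mem_diagonalHCell hy, ((IsSummand.of_iso (S.onOn f).symm).trans
    (S.on_comp_summand hs)).trans ((IsSummand.refl _).comp (IsSummand.of_iso (S.onOn g)))⟩

theorem exists_indec_mem (hM : M.IsFinitary)
    (hMJ : ∀ (a b : C) (f : a ⟶ b), f ∈ J a b → ¬ M.Annihilates f) {F : i ⟶ i}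
    (hF : IsMultiplicityFreeSum (diagonalHCell S L i) F) :
    ∃ Z : M.cat i, actClosure M F Z ∧ IsIndec Z := by
  obtain ⟨f, hf⟩ := h.diagonalHCell_nonempty
  have := hMJ i i f (h.le _ _ _ hf.1)
  simp only [TwoRep.Annihilates, not_forall] at this
  obtain ⟨X, hX⟩ := this
  obtain ⟨Z, hZ, hs⟩ := (hM.isFin i).exists_indec_summand hX
  exact ⟨Z, AddClosure.summand _ _ hs (actClosure_of_mem hF hf X), hZ⟩

/-- A proper quotient of the transitive 2-subrepresentation has apex `H`. -/
theorem hasApex_quotient (hM : M.IsFinitary) {F : i ⟶ i}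
    (hF : IsMultiplicityFreeSum (diagonalHCell S L i) F)
    (I : (h.subRep hM hF).toTwoRep.StableIdeal) {Z : M.cat i} (hZ : actClosure M F Z)
    (hZi : IsIndec Z)
    (hI : 𝟙 (⟨Z, hZ⟩ : (h.subRep hM hF).toTwoRep.cat ⟨⟩) ∉ I.carrier ⟨⟩ _ _) :
    I.quotient.HasApex ((generatedBy (diagonalHCell S L i)).oneMorClass (diagonalHCell S L i)) := by
  rw [h.hasApex_iff]
  intro x y f hf hann
  obtain ⟨g, hg, W, hs⟩ := h.exists_mem_of_actClosure hM hF hZi hZ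
  -- `Z` is a summand of `f (t W)` with `t W` in the 2-subrepresentation
  obtain ⟨t, ht, hgt⟩ := h.exists_isSummand_comp_left hg hf
  have hfin := hM.isFin i
  have h1 : IsSummand Z ((M.act ((generatedBy (diagonalHCell S L i)).mor f)).obj
      ((M.act t).obj W)) :=
    (hs.trans (TwoRep.isSummand_act hgt W)).trans (IsSummand.of_iso (M.actComp _ _ W))
  let V : (h.subRep hM hF).toTwoRep.cat x := ⟨(M.act t).obj W, actClosure_of_mem hF ht W⟩
  -- If `f` acted as zero, the identity of `f (t W)` would lie in `I`, and with it that of its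
  -- summand `Z`.
  have h2 := hann ((I.proj x).obj V)
  have h3 := (I.proj_map_eq_zero_iff (𝟙 (((h.subRep hM hF).toTwoRep.act f).obj V))).mp
    (h2.eq_of_src _ _)
  exact hI (I.id_mem_of_isSummand (((h.subRep hM hF).isSummand_iff
    (⟨Z, hZ⟩ : (h.subRep hM hF).toTwoRep.cat y) _).mpr h1) h3)

/-- Some `X` in `N'` satisfies `g X ≠ 0` with `g` in `H`. By `exists_isSummand_act`, every
indecomposable of the closure is then a summand of `x X` with `x` in `H`, and so lies in `N'`. -/
theorem le_of_hasApex (hM : M.IsTransitive) {F : i ⟶ i}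
    (hF : IsMultiplicityFreeSum (diagonalHCell S L i) F)
    (N' : ((generatedBy (diagonalHCell S L i)).restrict M).SubRep) (I' : N'.toTwoRep.StableIdeal)
    (hI' : I'.quotient.HasApex
      ((generatedBy (diagonalHCell S L i)).oneMorClass (diagonalHCell S L i)))
    (a : (generatedBy (diagonalHCell S L i)).SubBicat) :
    (h.subRep hM.1 hF).mem a ≤ N'.mem a := by
  rw [h.hasApex_iff] at hI'
  obtain ⟨g, hg⟩ := h.diagonalHCell_nonempty
  let g' : a ⟶ a := ⟨g, Generated.of g hg⟩
  have h1 := hI' a a g' hg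
  simp only [TwoRep.Annihilates, not_forall] at h1
  obtain ⟨X, hX⟩ := h1
  have hX' : ¬ IsZero ((M.act g).obj X.as.obj) := fun h0 =>
    hX ((I'.proj a).map_isZero
      (isZero_fullSubcategory ((N'.toTwoRep.act g').obj X.as) h0))
  intro Y hY
  have hfin := hM.1.isFin i
  refine hfin.of_indec_summands (P := N'.mem a) (N'.zero_mem a)
    (fun X Y b hb hX hY => N'.sum_mem a X Y b ⟨hb⟩ hX hY) Y fun Y' hY' hs => ?_
  obtain ⟨f, hf, Z, hs'⟩ := h.exists_mem_of_actClosure hM.1 hF hY'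
    (AddClosure.summand _ _ hs hY)
  obtain ⟨x, hx, hxs⟩ := h.exists_isSummand_act hM hf hg hX' hY' hs'
  exact N'.summand_mem a _ _ hxs
    (N'.act_mem (⟨x, Generated.of x hx⟩ : a ⟶ a) X.as.obj X.as.property)

/-- One such identity in `I'` would, by transitivity of the closure, bring in the identities of all
its objects. These include all `g X` with `g` in `H` and `X` in `N'`, so `g` would act as zero on
the quotient. -/
theorem id_notMem_of_hasApex (hM : M.IsTransitive) {F : i ⟶ i}
    (hF : IsMultiplicityFreeSum (diagonalHCell S L i) F)
    (N' : ((generatedBy (diagonalHCell S L i)).restrict M).SubRep) (I' : N'.toTwoRep.StableIdeal)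
    (hI' : I'.quotient.HasApex
      ((generatedBy (diagonalHCell S L i)).oneMorClass (diagonalHCell S L i)))
    (a : (generatedBy (diagonalHCell S L i)).SubBicat) (Z : N'.toTwoRep.cat a)
    (hZ : (h.subRep hM.1 hF).mem a Z.obj) (hZi : IsIndec Z.obj) :
    𝟙 Z ∉ I'.carrier a Z Z := by
  intro hid
  have hle := h.le_of_hasApex hM hF N' I' hI'
  have hfin : ∀ a, IsFin k (((generatedBy (diagonalHCell S L i)).restrict M).cat a) :=
    fun _ => hM.1.isFin i
  have hN := h.subRep_isTransitive hM hF
  rw [h.hasApex_iff] at hI'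
  obtain ⟨g, hg⟩ := h.diagonalHCell_nonempty
  refine hI' a a (⟨g, Generated.of g hg⟩ : a ⟶ a) hg fun X => ?_
  have key : ∀ Y : M.cat i, ∀ (hY : actClosure M F Y),
      𝟙 (⟨Y, hle a _ hY⟩ : N'.toTwoRep.cat a) ∈ I'.carrier a _ _ := by
    have hI : ∀ Y : (h.subRep hM.1 hF).toTwoRep.cat a, IsIndec Y →
        𝟙 ((TwoRep.SubRep.incl hle a).obj Y) ∈ I'.carrier a _ _ := by
      intro Y hY
      obtain ⟨f, hf⟩ := hN.2 a a ⟨Z.obj, hZ⟩ Y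
        (((h.subRep hM.1 hF).isIndec_iff (hfin a) _).mpr hZi) hY
      exact I'.id_mem_of_isSummand (hf.map (TwoRep.SubRep.incl hle a)) (I'.id_act_mem f hid)
    intro Y hY
    exact (I'.pullback hle).id_mem_of_indec (TwoRep.IsFinitary.isFin hN.1 a) hI ⟨Y, hY⟩
  rw [IsZero.iff_id_eq_zero]
  exact (I'.proj_map_eq_zero_iff _).mpr (key _ (actClosure_of_mem hF hg X.as.obj))

end MaximalLeftCell

end TwoRepTheory

/-! ### The main theorem. -/

theorem mainTheorem4 {k : Type uk} [Field k] [IsAlgClosed k]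
    {C : Type u} [Bicategory.{w, v} C] [PreadditiveBicategory C] [LinearBicategory k C]
    (S : WeakInvolution C) (hC : IsFiat k S)
    (J : OneMorClass C) (hJ : IsUniqueMaximalCell (fun _ => True) J)
    (L : OneMorClass C) (hL : IsLeftCell L)
    (hLJ : ∀ (a b : C) (f : a ⟶ b), f ∈ L a b → f ∈ J a b)
    (i : C) (hi : ∀ (a b : C) (f : a ⟶ b), f ∈ L a b → a = i)
    (H : Set (i ⟶ i)) (hH : H = diagonalHCell S L i)
    (A : EndoClass i) (hA : A = EndoClass.generatedBy H)
    (M : TwoRep.{w, v, u, v', u', uk} k C) (hM : M.IsSimpleTransitive) (hMJ : M.HasApex J) :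
    (∃ F : i ⟶ i, IsMultiplicityFreeSum H F) ∧
    ∀ F : i ⟶ i, IsMultiplicityFreeSum H F →
      ∃ N : (A.restrict M).SubRep,
        (∀ X : M.cat i, N.mem ⟨⟩ X ↔
          AddClosure (fun Y : M.cat i => ∃ Z : M.cat i, Y = (M.act F).obj Z) X) ∧
        N.toTwoRep.IsTransitive ∧
        ∃ I : N.toTwoRep.StableIdeal,
          I.quotient.IsSimpleTransitive ∧
          I.quotient.HasApex (A.oneMorClass H) ∧
          ∀ (N' : (A.restrict M).SubRep) (I' : N'.toTwoRep.StableIdeal),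
            I'.quotient.IsSimpleTransitive → I'.quotient.HasApex (A.oneMorClass H) →
              I.quotient.Equivalent I'.quotient ∧ TwoRep.InclusionInducesEquivalence I I' := by
  subst hA hH
  have h : MaximalLeftCell k S J L i := ⟨hC, hJ, hL, hLJ, hi⟩
  refine ⟨h.exists_isMultiplicityFreeSum, fun F hF => ⟨h.subRep hM.1.1 hF, fun X => Iff.rfl,
    h.subRep_isTransitive hM.1 hF, ?_⟩⟩
  have hfin : ∀ a, IsFin k (((EndoClass.generatedBy (diagonalHCell S L i)).restrict M).cat a) :=
    fun _ => hM.1.1.isFin i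
  -- Elements of `J` do not act as zero on `M`, so the closure contains an indecomposable `Z`; its
  -- identity witnesses that the radical ideal is proper.
  obtain ⟨Z, hZ, hZi⟩ := h.exists_indec_mem hM.1.1 ((hMJ J).mp rfl).1.2 hF
  exact ⟨(TwoRep.radIdeal hfin (h.subRep hM.1.1 hF).mem).restrict _,
    TwoRep.isSimpleTransitive_radIdeal hfin _ (h.subRep_isTransitive hM.1 hF),
    h.hasApex_quotient hM.1.1 hF _ hZ hZi
      (TwoRep.id_notMem_radIdeal hfin (h.subRep hM.1.1 hF).mem hZ hZi),
    fun N' I' hI' hIa => TwoRep.comparison_of_isSimpleTransitive hfin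
      (h.subRep_isTransitive hM.1 hF) (a₀ := ⟨⟩) hZ hZi (h.le_of_hasApex hM.1 hF N' I' hIa) I' hI'
      (h.id_notMem_of_hasApex hM.1 hF N' I' hIa)⟩
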